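/- **Setting.** Let $d\ge 1$ and let $\{f(\cdot;\theta)\}$, $\theta\in\Theta\subset\mathbb R^d$, be densities of a nonnegative lifetime with distribution functions $F(\cdot;\theta)$. An observation is $\boldsymbol x=(t,C,t_l)$: observed time, censoring indicator ($C=1$ if right-censored) and left-truncation time ($0$ if there is no truncation). Its log-likelihood is $$l(\boldsymbol x,\theta)=(1-C)\log f(t;\theta)+C\log[1-F(t;\theta)]-\log[1-F(t_l;\theta)],$$ with gradient $\dot l$ and Hessian $\ddot l=(\ddot l_{(jk)})$ in $\theta$; for almost every $\boldsymbol x$ it is finite and twice continuously differentiable at every point of $\Theta$. For a column vector $v$ write $v^2=vv^\top$. The data $\mathcal D_n=\{\boldsymbol x_1,\dots,\boldsymbol x_n\}$ are the first $n$ members of an i.i.d. sequence with the law of $\boldsymbol x$; $l_i=l(\boldsymbol x_i,\cdot)$, and $n_0$ is the number of uncensored observations among them. The set $\Theta$ is convex and the true value $\theta_0$ is an interior point of $\Theta$ and maximizes $\mathbb E\,l(\boldsymbol x,\theta)$ over $\Theta$. Let $\hat\theta$ be the maximizer over $\Theta$ of $\frac1n\sum_{i=1}^n l_i(\theta)$.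 **Censoring subsampling.** Let $\tilde\pi_i>0$ ($C_i=1$), with $\sum_{C_i=1}\tilde\pi_i=1$ whenever some $C_i=1$; the $\tilde\pi_i$ may depend on $\mathcal D_n$. All $n_0$ uncensored observations are kept, and given $\mathcal D_n$ one draws independently, with replacement, $r-n_0$ indices $J_1,\dots,J_{r-n_0}$ of censored observations, index $i$ having probability $\tilde\pi_i$. The estimator $\tilde\theta_c$ is any maximizer over $\Theta$ of $$l_c^*(\theta)=\sum_{C_i=0}l_i(\theta)+\sum_{j=1}^{r-n_0}\frac{1}{(r-n_0)\tilde\pi_{J_j}}\,l_{J_j}(\theta).$$ **Assumptions.** 1. $\Theta$ is compact, $\hat\theta$ is the unique maximizer with probability tending to one, and $\mathbb E|l(\boldsymbol x,\theta)|<\infty$, $\mathbb E\{l^2(\boldsymbol x,\theta)\}<\infty$ for all $\theta\in\Theta$. 2. For all $\theta\in\Theta$, $-\mathbb E\{\ddot l(\boldsymbol x,\theta)\}$ is positive definite and $\mathbb E\{\ddot l_{(jk)}^2(\boldsymbol x,\theta)\}<\infty$ for all $j,k$; and there is $\psi$ with $\mathbb E\{\psi^2(\boldsymbol x)\}<\infty$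 and $|\ddot l_{(jk)}(\boldsymbol x,\theta_1)-\ddot l_{(jk)}(\boldsymbol x,\theta_2)|\le\psi(\boldsymbol x)\|\theta_1-\theta_2\|$ for all $j,k$ and $\theta_1,\theta_2\in\Theta$. 3. $\Lambda(\theta)=\mathbb E\{\dot l(\boldsymbol x,\theta)^2\}$ exists and is positive definite for all $\theta\in\Theta$, and there is $\delta>0$ such that $\frac1n\sum_{i=1}^n\|\dot l_i(\theta)\|^4=O_p(1)$ for every $\Theta$-valued statistic $\theta=\theta(\mathcal D_n)$ with $\|\theta-\hat\theta\|<\delta$. 4. $\max_{i:\,C_i=1}(n\tilde\pi_i)^{-1}=O_p(1)$. Put $$M_g=\frac1n\sum_{i=1}^n\ddot l_i(\hat\theta),\quad \Lambda_c=\frac1{n^2}\sum_{C_i=1}\frac1{\tilde\pi_i}\dot l_i(\hat\theta)^2-\Big[\frac1n\sum_{C_i=1}\dot l_i(\hat\theta)\Big]^2,\quad V_c=M_g^{-1}\Lambda_cM_g^{-1},$$ where $\dot l_i(\hat\theta)=\partial_\theta\{\log[1-F(t_i;\theta)]-\log[1-F(t_{il};\theta)]\}|_{\theta=\hat\theta}$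 for the censored observations $i$, and assume that $V_c^{-1/2}$ exists asymptotically in the sense that the smallest eigenvalue of $\Lambda_c$ is bounded away from $0$ in probability. **Theorem.** Under these assumptions, as $n,r\to\infty$ with $n_0/r\to0$ in probability, $$\sqrt r\,V_c^{-1/2}(\tilde\theta_c-\hat\theta)\xrightarrow{d}N(0,I)\quad\text{conditionally on }\mathcal D_n,\text{ in probability},$$ that is, $\mathbb E\big[g\big(\sqrt r\,V_c^{-1/2}(\tilde\theta_c-\hat\theta)\big)\,\big|\,\mathcal D_n\big]\to\mathbb E\,g(Z)$ in probability, $Z\sim N(0,I)$, for every bounded continuous $g:\mathbb R^d\to\mathbb R$. -/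

import Mathlib

open MeasureTheory ProbabilityTheory Filter Topology

noncomputable section

namespace CensSub

/-- The parameter space `ℝ^d` with its Euclidean norm. -/
abbrev Param (d : ℕ) : Type := EuclideanSpace ℝ (Fin d)

/-- One observation `(t, C, t_l)`: observed time, censoring indicator (`true` = right-censored),
left-truncation time (`0` if there is no truncation). -/
abbrev Obs : Type := ℝ × Bool × ℝ

/-- The observed failure or censoring time. -/
def Obs.time (x : Obs) : ℝ := x.1

/-- The observation is right-censored. -/
abbrev Obs.Censored (x : Obs) : Prop := x.2.1 = true

/-- The left-truncation time. -/
def Obs.trunc (x : Obs) : ℝ := x.2.2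

/-- `f` is a probability density of a nonnegative random variable. -/
structure IsLifetimeDensity (f : ℝ → ℝ) : Prop where
  measurable : Measurable f
  nonneg : ∀ t, 0 ≤ f t
  eq_zero : ∀ t, t < 0 → f t = 0
  lintegral_eq_one : ∫⁻ t, ENNReal.ofReal (f t) = 1

/-- The distribution function of the density `f`. -/
def cdfOf (f : ℝ → ℝ) (t : ℝ) : ℝ := ∫ s in Set.Iic t, f s

variable {d : ℕ}

/-- The log-likelihood `l(x, θ)` of one observation, for the family of densities `f θ`:
`(1 - C) log f(t; θ) + C log (1 - F(t; θ)) - log (1 - F(t_l; θ))`. -/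
def logLik (f : Param d → ℝ → ℝ) (x : Obs) (θ : Param d) : ℝ :=
  (if x.Censored then Real.log (1 - cdfOf (f θ) x.time) else Real.log (f θ x.time))
    - Real.log (1 - cdfOf (f θ) x.trunc)

/-- The score `∂l(x, θ)/∂θ`. For a censored `x` it is the gradient in `θ` of
`log (1 - F(t; θ)) - log (1 - F(t_l; θ))`. -/
def score (f : Param d → ℝ → ℝ) (x : Obs) (θ : Param d) : Param d :=
  gradient (logLik f x) θ

/-- The Hessian matrix `∂²l(x, θ)/∂θ_j∂θ_k`. -/
def hess (f : Param d → ℝ → ℝ) (x : Obs) (θ : Param d) : Matrix (Fin d) (Fin d) ℝ :=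
  Matrix.of fun j k =>
    fderiv ℝ (fderiv ℝ (logLik f x)) θ (EuclideanSpace.single j 1) (EuclideanSpace.single k 1)

/-- The convention `v² = v vᵀ` for a column vector `v`. -/
def outer (v : Param d) : Matrix (Fin d) (Fin d) ℝ := Matrix.of fun j k => v j * v k

/-! ### Quantities computed from a data set `x = (x_1, …, x_n)` -/

variable {n : ℕ}

/-- The number `n₀` of uncensored observations. -/
def numUncensored (x : Fin n → Obs) : ℕ := (Finset.univ.filter fun i => ¬ (x i).Censored).card

/-- The full-data log-likelihood `l_f(θ) = (1/n) ∑ l_i(θ)`. -/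
def fullLogLik (f : Param d → ℝ → ℝ) (x : Fin n → Obs) (θ : Param d) : ℝ :=
  (1 / (n : ℝ)) * ∑ i, logLik f (x i) θ

/-- `θ` is the unique maximizer of the full-data log-likelihood over `Θ`. -/
def IsUniqueMLE (f : Param d → ℝ → ℝ) (Θ : Set (Param d)) (x : Fin n → Obs) (θ : Param d) : Prop :=
  θ ∈ Θ ∧ ∀ θ' ∈ Θ, θ' ≠ θ → fullLogLik f x θ' < fullLogLik f x θ

/-- `p` is a system of censoring-subsampling probabilities for the data `x`: positive on the
censored observations and of total mass one there (if there are any). The values of `p` at the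
uncensored observations, all of which are kept, play no role. -/
structure IsSubsamplingProb (x : Fin n → Obs) (p : Fin n → ℝ) : Prop where
  pos : ∀ i, (x i).Censored → 0 < p i
  sum_eq_one : (∃ i, (x i).Censored) → ∑ i with (x i).Censored, p i = 1

/-- The law of one draw: the index `i` of a censored observation has probability `p i`. -/
def drawOne (x : Fin n → Obs) (p : Fin n → ℝ) : Measure (Fin n) :=
  ∑ i with (x i).Censored, ENNReal.ofReal (p i) • Measure.dirac i

/-- The conditional law, given the data `x`, of the indices of `m` censored observations drawn
independently with replacement with probabilities `p`. -/
def drawLaw (x : Fin n → Obs) (p : Fin n → ℝ) (m : ℕ) : Measure (Fin m → Fin n) :=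
  Measure.pi fun _ => drawOne x p

/-- The weighted log-likelihood `l_c^*(θ)` of the subsample that consists of all uncensored
observations (weight `1`) and of the `m` drawn ones, with indices `J` (weights `1 / (m p_i)`). -/
def subLogLik (f : Param d → ℝ → ℝ) (x : Fin n → Obs) (p : Fin n → ℝ) {m : ℕ} (J : Fin m → Fin n)
    (θ : Param d) : ℝ :=
  (∑ i with ¬ (x i).Censored, logLik f (x i) θ)
    + ∑ j, (1 / ((m : ℝ) * p (J j))) * logLik f (x (J j)) θ

/-- `M_g = (1/n) ∑_i l̈_i(θ)`. -/
def Mg (f : Param d → ℝ → ℝ) (x : Fin n → Obs) (θ : Param d) : Matrix (Fin d) (Fin d) ℝ :=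
  (1 / (n : ℝ)) • ∑ i, hess f (x i) θ

/-- `Λ_c = (1/n²) ∑_{C_i = 1} (1/p_i) l̇_i(θ)² - [(1/n) ∑_{C_i = 1} l̇_i(θ)]²`. -/
def Lc (f : Param d → ℝ → ℝ) (x : Fin n → Obs) (p : Fin n → ℝ) (θ : Param d) :
    Matrix (Fin d) (Fin d) ℝ :=
  (1 / (n : ℝ) ^ 2) • (∑ i with (x i).Censored, (1 / p i) • outer (score f (x i) θ))
    - outer ((1 / (n : ℝ)) • ∑ i with (x i).Censored, score f (x i) θ)

/-- `V_c = M_g⁻¹ Λ_c M_g⁻¹`. -/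
def Vc (f : Param d → ℝ → ℝ) (x : Fin n → Obs) (p : Fin n → ℝ) (θ : Param d) :
    Matrix (Fin d) (Fin d) ℝ :=
  (Mg f x θ)⁻¹ * Lc f x p θ * (Mg f x θ)⁻¹

/-- The inverse square root `V^{-1/2}` of a positive definite matrix (functional calculus). -/
def invSqrt (V : Matrix (Fin d) (Fin d) ℝ) : Matrix (Fin d) (Fin d) ℝ :=
  cfc (fun s : ℝ => (Real.sqrt s)⁻¹) V

/-- The normalized error `√r V_c^{-1/2} (θ' - θ)`. -/
def normalizedError (f : Param d → ℝ → ℝ) (x : Fin n → Obs) (p : Fin n → ℝ) (r : ℕ)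
    (θ θ' : Param d) : Param d :=
  Real.sqrt r • Matrix.toEuclideanLin (invSqrt (Vc f x p θ)) (θ' - θ)

/-- `max_{C_i = 1} (n p_i)⁻¹` (and `0` if nothing is censored). -/
def maxInvProb (x : Fin n → Obs) (p : Fin n → ℝ) : ℝ :=
  ⨆ i, if (x i).Censored then ((n : ℝ) * p i)⁻¹ else 0

/-- The data set that consists of the first `n` observations of the sequence `X`. -/
def data {Ω : Type*} (X : ℕ → Ω → Obs) (n : ℕ) (ω : Ω) : Fin n → Obs := fun i => X i ω

/-! ### Stochastic boundedness and the assumptions -/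

/-- `Y_k = O_p(1)` as `k → ∞`. -/
def BddInProb {Ω : Type*} [MeasurableSpace Ω] (μ : Measure Ω) (Y : ℕ → Ω → ℝ) : Prop :=
  ∀ ε : ℝ, 0 < ε → ∃ K : ℝ, ∀ᶠ k in atTop, μ {ω | K < |Y k ω|} ≤ ENNReal.ofReal ε

/-- The random symmetric matrices `A_k` are bounded below in probability by a positive multiple
of the identity. -/
def PosDefInProb {Ω : Type*} [MeasurableSpace Ω] (μ : Measure Ω)
    (A : ℕ → Ω → Matrix (Fin d) (Fin d) ℝ) : Prop :=
  ∀ ε : ℝ, 0 < ε → ∃ c : ℝ, 0 < c ∧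
    ∀ᶠ k in atTop, μ {ω | ¬ (A k ω - c • (1 : Matrix (Fin d) (Fin d) ℝ)).PosSemidef}
      ≤ ENNReal.ofReal ε

/-- Standing conventions on the parametric family `f`, the parameter set `Θ`, the law `P` of one
observation and the true value `θ₀`: every `f θ` is a lifetime density, the log-likelihood is
finite and twice continuously differentiable, `Θ` is convex, and `θ₀` is an interior
point of `Θ` that maximizes the expected log-likelihood. -/
structure StandingSetup (f : Param d → ℝ → ℝ) (Θ : Set (Param d)) (P : Measure Obs)
    (θ₀ : Param d) : Prop where
  density : ∀ θ ∈ Θ, IsLifetimeDensity (f θ)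
  likelihood_pos : ∀ᵐ x ∂P, ∀ θ ∈ Θ,
    (if x.Censored then cdfOf (f θ) x.time < 1 else 0 < f θ x.time) ∧ cdfOf (f θ) x.trunc < 1
  smooth : ∀ᵐ x ∂P, ∀ θ ∈ Θ, ContDiffAt ℝ 2 (logLik f x) θ
  convex : Convex ℝ Θ
  interior : θ₀ ∈ interior Θ
  maximizes : ∀ θ ∈ Θ, ∫ x, logLik f x θ ∂P ≤ ∫ x, logLik f x θ₀ ∂P

/-- `Θ` is compact and the log-likelihood has first and second moments. -/
structure MomentCondition (f : Param d → ℝ → ℝ) (Θ : Set (Param d)) (P : Measure Obs) : Prop where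
  compact : IsCompact Θ
  integrable : ∀ θ ∈ Θ, Integrable (fun x => logLik f x θ) P
  memLp : ∀ θ ∈ Θ, MemLp (fun x => logLik f x θ) 2 P

/-- `-E l̈(x, θ)` is positive definite, the entries of `l̈` have second moments and are Lipschitz
in `θ` with a square-integrable constant `ψ(x)`. -/
structure HessianCondition (f : Param d → ℝ → ℝ) (Θ : Set (Param d)) (P : Measure Obs) :
    Prop where
  memLp : ∀ θ ∈ Θ, ∀ j k, MemLp (fun x => hess f x θ j k) 2 P
  posDef : ∀ θ ∈ Θ, (-(Matrix.of fun j k => ∫ x, hess f x θ j k ∂P)).PosDef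
  lipschitz : ∃ ψ : Obs → ℝ, MemLp ψ 2 P ∧ ∀ᵐ x ∂P, ∀ θ₁ ∈ Θ, ∀ θ₂ ∈ Θ, ∀ j k,
    |hess f x θ₁ j k - hess f x θ₂ j k| ≤ ψ x * ‖θ₁ - θ₂‖

/-- `Λ(θ) = E{l̇(x, θ)²}` exists and is positive definite. -/
structure ScoreCondition (f : Param d → ℝ → ℝ) (Θ : Set (Param d)) (P : Measure Obs) : Prop where
  integrable : ∀ θ ∈ Θ, ∀ j k, Integrable (fun x => outer (score f x θ) j k) P
  posDef : ∀ θ ∈ Θ, (Matrix.of fun j k => ∫ x, outer (score f x θ) j k ∂P).PosDef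

/-- `(1/n) ∑ ‖l̇_i(θ)‖⁴ = O_p(1)` for all `θ ∈ Θ` with `‖θ - θ̂‖ < δ`. As `θ̂` is random, so is
`θ`: it runs through all `Θ`-valued statistics `T` that stay within distance `δ` of `θ̂`. -/
def FourthMomentNear {Ω : Type*} [MeasurableSpace Ω] (μ : Measure Ω) (X : ℕ → Ω → Obs)
    (f : Param d → ℝ → ℝ) (Θ : Set (Param d)) (n : ℕ → ℕ)
    (θhat : (k : ℕ) → (Fin (n k) → Obs) → Param d) : Prop :=
  ∃ δ : ℝ, 0 < δ ∧ ∀ T : (k : ℕ) → (Fin (n k) → Obs) → Param d,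
    (∀ k, Measurable (T k)) → (∀ k x, T k x ∈ Θ ∧ ‖T k x - θhat k x‖ < δ) →
      BddInProb μ fun k ω =>
        (1 / (n k : ℝ)) * ∑ i : Fin (n k), ‖score f (data X (n k) ω i) (T k (data X (n k) ω))‖ ^ 4

end CensSub

end

open MeasureTheory ProbabilityTheory Filter Topology CensSub

open MeasureTheory ProbabilityTheory Filter Topology CensSub

namespace CensSub

/-! Given the data, the subsample is an i.i.d. sample from a finite space. Put m = r - n₀, A =
V_c^{-1/2} M_g⁻¹, and let S be the gradient of l_c^*/n at θ̂. The uncensored terms do not depend on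
the draws; charged in equal parts to the m draws, they turn S into a mean of m i.i.d. vectors
(`sum_drawWeight_mul`). Since θ̂ solves the likelihood equation, these vectors are centred and have
covariance exactly Λ_c (`integral_drawValue_sq`). The bounds on (n p_i)⁻¹ and on the fourth powers
of the scores control their fourth moments, so √m A S is asymptotically standard normal by a central
limit theorem for triangular arrays (`tendsto_integral_exp_drawLaw`).

For most draws the weighted log-likelihood is strongly concave. This forces ‖θ̃ - θ̂‖ to be of the
order of ‖S‖, and linearizing the first order condition makes S + M_g(θ̃ - θ̂) of smaller order
(`IsRegular.norm_score_add_Mg_le`). Hence √r V_c^{-1/2}(θ̃ - θ̂) differs from -√m A S by a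
negligible term, because r/m → 1.

The randomness of the data is kept apart from that of the draws. `IsRegular` lists deterministic
inequalities with fixed constants. Along any sequence of regular data sets the limit theorem holds
(`tendsto_integral_of_isRegular`), and an argument by contradiction makes it uniform over all
regular data sets with n₀/r small and r large (`exists_forall_isRegular`). It remains to see that
the data are regular with probability close to one (`exists_eventually_isRegular`). Finitely many
weak laws suffice for the Hessians and for θ̂: the Lipschitz condition carries Hessian bounds from a
finite net to all of Θ, and the mean log-likelihood at θ₀ and at the points θ₀ ± t e_j already
forces θ̂ close to θ₀, by concavity. No uniform law for the log-likelihood and no differentiation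
under the integral sign is needed. -/

/-! ### Characteristic functions and the central limit theorem for draws from finite spaces -/

lemma norm_pow_sub_pow_le_mul {a b : ℂ} (ha : ‖a‖ ≤ 1) (hb : ‖b‖ ≤ 1) (m : ℕ) :
    ‖a ^ m - b ^ m‖ ≤ m * ‖a - b‖ := by
  induction m with
  | zero => simp
  | succ m ih =>
    have h : a ^ (m + 1) - b ^ (m + 1) = a ^ m * (a - b) + (a ^ m - b ^ m) * b := by ring
    rw [h]
    refine (norm_add_le _ _).trans ?_
    rw [norm_mul, norm_mul, norm_pow]
    have h1 : ‖a‖ ^ m ≤ 1 := pow_le_one₀ (norm_nonneg _) ha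
    have h2 : ‖a‖ ^ m * ‖a - b‖ ≤ 1 * ‖a - b‖ := by gcongr
    have h3 : ‖a ^ m - b ^ m‖ * ‖b‖ ≤ (m * ‖a - b‖) * 1 := by gcongr
    push_cast
    linarith

/-- For |x| ≤ 1 this is the tail of the exponential series; for |x| ≥ 1 every term is at most a
multiple of |x|³. The constant 4 is generous and serves both ranges. -/
lemma norm_exp_I_sub_taylor_two (x : ℝ) :
    ‖Complex.exp (x * Complex.I) - (1 + x * Complex.I - (x : ℂ) ^ 2 / 2)‖ ≤ 4 * |x| ^ 3 := by
  rcases le_total |x| 1 with hx | hx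
  · have hz : ‖(x * Complex.I : ℂ)‖ ≤ 1 := by simpa using hx
    have h := Complex.exp_bound hz (n := 3) (by norm_num)
    have h2 : ∑ m ∈ Finset.range 3, (x * Complex.I : ℂ) ^ m / (m.factorial : ℂ)
        = 1 + x * Complex.I - (x : ℂ) ^ 2 / 2 := by
      simp [Finset.sum_range_succ, mul_pow, Nat.factorial]
      ring
    rw [h2] at h
    refine h.trans ?_
    have : ‖(x * Complex.I : ℂ)‖ = |x| := by simp
    rw [this]
    norm_num [Nat.factorial]
    nlinarith [pow_nonneg (abs_nonneg x) 3]
  · have h1 : ‖Complex.exp (x * Complex.I)‖ = 1 := Complex.norm_exp_ofReal_mul_I x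
    have h2 : ‖(1 + x * Complex.I - (x : ℂ) ^ 2 / 2)‖ ≤ 1 + |x| + |x| ^ 2 / 2 := by
      refine (norm_sub_le _ _).trans ?_
      refine add_le_add ((norm_add_le _ _).trans ?_) ?_
      · simp
      · simp
    have h3 := norm_sub_le (Complex.exp (x * Complex.I)) (1 + x * Complex.I - (x : ℂ) ^ 2 / 2)
    have h4 : |x| ^ 2 ≤ |x| ^ 3 := pow_le_pow_right₀ hx (by norm_num)
    have h5 : |x| ≤ |x| ^ 2 := by nlinarith
    linarith

/-- Lets a fourth moment bound the cubic Taylor error. -/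
lemma abs_pow_three_le (x : ℝ) : |x| ^ 3 ≤ 1 + x ^ 4 := by
  have h : x ^ 4 = |x| ^ 4 := by
    rw [← Even.pow_abs (by decide : Even 4) x]
  rw [h]
  have := abs_nonneg x
  nlinarith [sq_nonneg (|x| ^ 2 - 1), sq_nonneg (|x| ^ 2 - |x|), sq_nonneg (|x| - 1), sq_nonneg |x|,
    sq_nonneg (|x|^2)]

section FiniteSpace

variable {α : Type*} [Finite α] [MeasurableSpace α] [DiscreteMeasurableSpace α]

/-- Second order expansion of the characteristic function of a centred variable. -/
lemma norm_integral_exp_sub_le (ν : Measure α) [IsProbabilityMeasure ν] (u : α → ℝ) {σ K s : ℝ}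
    (h0 : ∫ a, u a ∂ν = 0) (h2 : ∫ a, u a ^ 2 ∂ν = σ) (h4 : ∫ a, u a ^ 4 ∂ν ≤ K) (hs : 0 ≤ s) :
    ‖∫ a, Complex.exp ((s * u a : ℝ) * Complex.I) ∂ν - ((1 - σ * s ^ 2 / 2 : ℝ) : ℂ)‖
      ≤ 4 * s ^ 3 * (1 + K) := by
  have hint : ∀ {F : Type} [NormedAddCommGroup F] (f : α → F), Integrable f ν :=
    fun f => Integrable.of_finite
  have e1 : ((1 - σ * s ^ 2 / 2 : ℝ) : ℂ)
      = ∫ a, (1 + ((s * u a : ℝ) : ℂ) * Complex.I - ((s * u a : ℝ) : ℂ) ^ 2 / 2) ∂ν := by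
    rw [integral_sub (hint _) (hint _), integral_add (hint _) (hint _), integral_mul_const,
      integral_div, integral_complex_ofReal, integral_const_mul, h0]
    have : ∫ a, ((s * u a : ℝ) : ℂ) ^ 2 ∂ν = ((s ^ 2 * σ : ℝ) : ℂ) := by
      rw [← h2, ← integral_const_mul, ← integral_complex_ofReal]
      congr 1; ext a; push_cast; ring
    rw [this]
    simp
    ring
  rw [e1, ← integral_sub (hint _) (hint _)]
  refine (norm_integral_le_integral_norm _).trans ?_
  have e2 : ∫ a, (4 * s ^ 3 * (1 + u a ^ 4)) ∂ν ≤ 4 * s ^ 3 * (1 + K) := by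
    rw [integral_const_mul, integral_add (hint _) (hint _)]
    simp
    gcongr
  refine le_trans (integral_mono (hint _) (hint _) fun a => ?_) e2
  refine (norm_exp_I_sub_taylor_two _).trans ?_
  rw [abs_mul, abs_of_nonneg hs, mul_pow]
  have := abs_pow_three_le (u a)
  have h3 : 0 ≤ s ^ 3 := by positivity
  nlinarith

omit [Finite α] [DiscreteMeasurableSpace α] in
lemma integral_pi_exp_sum (ν : Measure α) [IsProbabilityMeasure ν] (u : α → ℝ) (m : ℕ) (s : ℝ) :
    ∫ J : Fin m → α, Complex.exp ((s * ∑ j, u (J j) : ℝ) * Complex.I) ∂(Measure.pi fun _ => ν)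
      = (∫ a, Complex.exp ((s * u a : ℝ) * Complex.I) ∂ν) ^ m := by
  have h := integral_fintype_prod_eq_pow (ι := Fin m) (μ := ν)
    (fun a => Complex.exp ((s * u a : ℝ) * Complex.I))
  rw [Fintype.card_fin] at h
  rw [← h]
  congr 1
  ext J
  rw [← Complex.exp_sum]
  congr 1
  push_cast
  rw [Finset.mul_sum, Finset.sum_mul]

/-- Chebyshev's inequality for the mean of independent draws. -/
lemma measureReal_pi_mean_ge_le (ν : Measure α) [IsProbabilityMeasure ν] (u : α → ℝ) {m : ℕ}
    (hm : 0 < m) {η : ℝ} (hη : 0 < η) :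
    (Measure.pi fun _ : Fin m => ν).real
        {J | η ≤ |(1 / (m : ℝ)) * ∑ j, u (J j) - ∫ a, u a ∂ν|}
      ≤ (∫ a, u a ^ 2 ∂ν) / (m * η ^ 2) := by
  have hm' : (0 : ℝ) < m := by exact_mod_cast hm
  set π := Measure.pi fun _ : Fin m => ν
  have hL : ∀ f : α → ℝ, MemLp f 2 ν := fun f => MemLp.of_discrete
  have hmean : ∫ J, (∑ j, u (J j)) ∂π = m * ∫ a, u a ∂ν := by
    rw [integral_finsetSum _ fun i _ => Integrable.of_finite]
    have : ∀ j : Fin m, ∫ J, u (J j) ∂π = ∫ a, u a ∂ν := fun j => by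
      have h := (measurePreserving_eval (fun _ : Fin m => ν) j).map_eq
      conv_rhs => rw [← h, integral_map (measurable_pi_apply j).aemeasurable
        (by exact AEStronglyMeasurable.of_discrete)]
    simp [this]
  have hvar : variance (fun J : Fin m → α => ∑ j, u (J j)) π ≤ m * ∫ a, u a ^ 2 ∂ν := by
    have h := variance_sum_pi (μ := fun _ : Fin m => ν) (X := fun _ => u) (fun _ => hL u)
    have e : (∑ i : Fin m, fun ω : Fin m → α => u (ω i)) = fun J => ∑ j, u (J j) := by
      ext J; simp
    rw [e] at h
    rw [h]
    simp only [Finset.sum_const, Finset.card_univ, Fintype.card_fin, nsmul_eq_mul]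
    gcongr
    exact variance_le_expectation_sq (by exact AEStronglyMeasurable.of_discrete)
  have hc := meas_ge_le_variance_div_sq (μ := π) (X := fun J : Fin m → α => ∑ j, u (J j))
    MemLp.of_discrete (c := m * η) (by positivity)
  have hset : {J : Fin m → α | η ≤ |(1 / (m : ℝ)) * ∑ j, u (J j) - ∫ a, u a ∂ν|}
      = {J | m * η ≤ |∑ j, u (J j) - ∫ J, (∑ j, u (J j)) ∂π|} := by
    ext J
    simp only [Set.mem_ofPred_eq, hmean]
    have : ∑ j, u (J j) - m * ∫ a, u a ∂ν = m * ((1 / (m : ℝ)) * ∑ j, u (J j) - ∫ a, u a ∂ν) := by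
      field_simp
    rw [this, abs_mul, abs_of_pos hm', mul_le_mul_iff_right₀ hm']
  rw [hset, measureReal_def]
  refine (ENNReal.toReal_mono ENNReal.ofReal_ne_top hc).trans ?_
  rw [ENNReal.toReal_ofReal (div_nonneg (variance_nonneg _ _) (by positivity))]
  calc _ ≤ (m * ∫ a, u a ^ 2 ∂ν) / (m * η) ^ 2 := by gcongr
    _ = _ := by field_simp

end FiniteSpace

lemma tendsto_one_sub_div_pow {m : ℕ → ℕ} (hm : Tendsto m atTop atTop) (σ : ℝ) :
    Tendsto (fun q => (1 - σ * (1 / m q) / 2 : ℝ) ^ m q) atTop (𝓝 (Real.exp (-σ / 2))) := by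
  have h := (Real.tendsto_one_add_div_pow_exp (-σ / 2)).comp hm
  refine h.congr fun q => ?_
  simp only [Function.comp]
  congr 1
  ring

/-- Central limit theorem for triangular arrays of independent draws from finite spaces, in terms
of characteristic functions. -/
lemma tendsto_integral_exp_pi {α : ℕ → Type*} [∀ q, Finite (α q)] [∀ q, MeasurableSpace (α q)]
    [∀ q, DiscreteMeasurableSpace (α q)] (ν : ∀ q, Measure (α q)) [∀ q, IsProbabilityMeasure (ν q)]
    {m : ℕ → ℕ} (hm : Tendsto m atTop atTop) (u : ∀ q, α q → ℝ) {σ K : ℝ}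
    (h0 : ∀ q, ∫ a, u q a ∂(ν q) = 0) (h2 : ∀ q, ∫ a, u q a ^ 2 ∂(ν q) = σ)
    (h4 : ∀ q, ∫ a, u q a ^ 4 ∂(ν q) ≤ K) :
    Tendsto (fun q => ∫ J : Fin (m q) → α q,
        Complex.exp (((Real.sqrt (m q))⁻¹ * ∑ j, u q (J j) : ℝ) * Complex.I)
          ∂(Measure.pi fun _ => ν q)) atTop (𝓝 (Real.exp (-σ / 2) : ℂ)) := by
  have hσ : 0 ≤ σ := by rw [← h2 0]; exact integral_nonneg fun a => sq_nonneg _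
  have hK : 0 ≤ K := le_trans (integral_nonneg fun a => by positivity) (h4 0)
  have hmR : Tendsto (fun q => (m q : ℝ)) atTop atTop := tendsto_natCast_atTop_atTop.comp hm
  have hb := (Complex.continuous_ofReal.tendsto _).comp (tendsto_one_sub_div_pow hm σ)
  have hd : Tendsto (fun q => 4 * (1 + K) * (Real.sqrt (m q))⁻¹) atTop (𝓝 0) := by
    have := (Real.tendsto_sqrt_atTop.comp hmR).inv_tendsto_atTop.const_mul (4 * (1 + K))
    simpa using this
  refine tendsto_of_tendsto_of_dist hb ?_
  refine squeeze_zero' (Eventually.of_forall fun q => dist_nonneg) ?_ hd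
  -- The condition σ ≤ m puts 1 - σ/(2m) into [-1, 1], as the comparison of m-th powers requires.
  filter_upwards [hmR.eventually_ge_atTop (max 1 σ)] with q hq
  have hm1 : (1 : ℝ) ≤ m q := (le_max_left _ _).trans hq
  have hmσ : σ ≤ m q := (le_max_right _ _).trans hq
  have hm0 : (0 : ℝ) < m q := by linarith
  simp only [Function.comp]
  rw [dist_comm, dist_eq_norm, integral_pi_exp_sum, Complex.ofReal_pow]
  set s := (Real.sqrt (m q))⁻¹
  have hs0 : 0 ≤ s := by positivity
  have hs2 : s ^ 2 = 1 / m q := by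
    simp only [s, inv_pow, Real.sq_sqrt hm0.le, one_div]
  rw [← hs2]
  refine (norm_pow_sub_pow_le_mul ?_ ?_ _).trans ?_
  · refine (norm_integral_le_integral_norm _).trans ?_
    have : ∀ a, ‖Complex.exp ((s * u q a : ℝ) * Complex.I)‖ = 1 := fun a =>
      Complex.norm_exp_ofReal_mul_I _
    simp_rw [this]
    simp
  · rw [Complex.norm_real, Real.norm_eq_abs, abs_le, hs2]
    have : σ * (1 / m q) ≤ 1 := by rw [mul_one_div, div_le_one hm0]; exact hmσ
    have : 0 ≤ σ * (1 / m q) := by positivity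
    constructor <;> linarith
  · have := norm_integral_exp_sub_le (ν q) (u q) (h0 q) (h2 q) (h4 q) hs0
    -- As m s² = 1, the m one-draw errors of order s³ add up to order s = m^{-1/2}.
    calc _ ≤ (m q : ℝ) * (4 * s ^ 3 * (1 + K)) := by gcongr
      _ = 4 * (1 + K) * s * (m q * s ^ 2) := by ring
      _ = _ := by rw [hs2, mul_one_div_cancel hm0.ne', mul_one]

/-- Asymptotically equivalent sequences have the same weak limit; the first one is described by its
characteristic functions. -/
lemma tendsto_integral_of_tendsto_integral_exp {E : Type*} [NormedAddCommGroup E]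
    [InnerProductSpace ℝ E] [FiniteDimensional ℝ E] [MeasurableSpace E] [BorelSpace E]
    {β : ℕ → Type*} [∀ q, Finite (β q)] [∀ q, MeasurableSpace (β q)]
    [∀ q, DiscreteMeasurableSpace (β q)] (ν : ∀ q, Measure (β q)) [∀ q, IsProbabilityMeasure (ν q)]
    (Y W : ∀ q, β q → E)
    (hW : ∀ t : E, Tendsto (fun q => ∫ b, Complex.exp ((inner ℝ (W q b) t : ℝ) * Complex.I) ∂(ν q))
      atTop (𝓝 (Real.exp (-‖t‖ ^ 2 / 2) : ℂ)))
    (hYW : ∀ δ : ℝ, 0 < δ → Tendsto (fun q => (ν q).real {b | δ < ‖Y q b - W q b‖}) atTop (𝓝 0))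
    (g : BoundedContinuousFunction E ℝ) :
    Tendsto (fun q => ∫ b, g (Y q b) ∂(ν q)) atTop (𝓝 (∫ z, g z ∂(stdGaussian E))) := by
  have hYm : ∀ q, Measurable (Y q) := fun q => measurable_of_finite _
  let L : ℕ → ProbabilityMeasure E := fun q =>
    ⟨(ν q).map (Y q), Measure.isProbabilityMeasure_map (hYm q).aemeasurable⟩
  let G : ProbabilityMeasure E := ⟨stdGaussian E, inferInstance⟩
  have hchar : ∀ t : E, Tendsto (fun q => charFun (L q : Measure E) t) atTop
      (𝓝 (charFun (G : Measure E) t)) := by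
    intro t
    have hG : charFun (G : Measure E) t = (Real.exp (-‖t‖ ^ 2 / 2) : ℂ) := by
      simp [G, charFun_stdGaussian]
    have hL : ∀ q, charFun (L q : Measure E) t
        = ∫ b, Complex.exp ((inner ℝ (Y q b) t : ℝ) * Complex.I) ∂(ν q) := by
      intro q
      simp only [charFun_apply, L, ProbabilityMeasure.coe_mk]
      rw [integral_map (hYm q).aemeasurable (by fun_prop)]
    rw [hG]
    simp_rw [hL]
    refine tendsto_of_tendsto_of_dist (hW t) ?_
    rw [Metric.tendsto_atTop]
    intro ε hε
    -- Where Y and W are δ-close, the two exponentials differ by at most δ‖t‖ ≤ ε/4; elsewhere by at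
    -- most 2, on a set of measure below ε/4. The added 1 covers t = 0.
    set δ := ε / (4 * (‖t‖ + 1)) with hδ
    have ht : 0 < ‖t‖ + 1 := by positivity
    have hδ0 : 0 < δ := by positivity
    obtain ⟨N, hN⟩ := (Metric.tendsto_atTop.1 (hYW δ hδ0)) (ε / 4) (by positivity)
    refine ⟨N, fun q hq => ?_⟩
    have hq := hN q hq
    rw [Real.dist_eq, sub_zero, abs_of_nonneg measureReal_nonneg] at hq
    rw [Real.dist_eq, sub_zero, abs_of_nonneg dist_nonneg, dist_eq_norm,
      ← integral_sub Integrable.of_finite Integrable.of_finite]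
    refine (norm_integral_le_integral_norm _).trans_lt ?_
    set B := {b | δ < ‖Y q b - W q b‖}
    have hbound : ∀ b, ‖Complex.exp ((inner ℝ (W q b) t : ℝ) * Complex.I)
        - Complex.exp ((inner ℝ (Y q b) t : ℝ) * Complex.I)‖
        ≤ δ * ‖t‖ + B.indicator (fun _ => 2) b := by
      intro b
      by_cases hb : b ∈ B
      · rw [Set.indicator_of_mem hb]
        have h1 := norm_sub_le (Complex.exp ((inner ℝ (W q b) t : ℝ) * Complex.I))
          (Complex.exp ((inner ℝ (Y q b) t : ℝ) * Complex.I))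
        rw [Complex.norm_exp_ofReal_mul_I, Complex.norm_exp_ofReal_mul_I] at h1
        have : 0 ≤ δ * ‖t‖ := by positivity
        linarith
      · rw [Set.indicator_of_notMem hb, add_zero]
        have hb' : ‖Y q b - W q b‖ ≤ δ := not_lt.1 hb
        have h1 : ‖Complex.exp ((inner ℝ (W q b) t : ℝ) * Complex.I)
            - Complex.exp ((inner ℝ (Y q b) t : ℝ) * Complex.I)‖
            ≤ |inner ℝ (W q b) t - inner ℝ (Y q b) t| := by
          have e : Complex.exp ((inner ℝ (W q b) t : ℝ) * Complex.I)
            - Complex.exp ((inner ℝ (Y q b) t : ℝ) * Complex.I)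
            = Complex.exp ((inner ℝ (Y q b) t : ℝ) * Complex.I) *
              (Complex.exp (Complex.I * (inner ℝ (W q b) t - inner ℝ (Y q b) t : ℝ)) - 1) := by
            rw [mul_sub, ← Complex.exp_add, mul_one]
            congr 2
            push_cast
            ring
          rw [e, norm_mul, Complex.norm_exp_ofReal_mul_I, one_mul]
          exact Real.norm_exp_I_mul_ofReal_sub_one_le
        refine h1.trans ?_
        rw [← inner_sub_left]
        refine (abs_real_inner_le_norm _ _).trans ?_
        rw [norm_sub_rev]
        gcongr
    calc _ ≤ ∫ b, (δ * ‖t‖ + B.indicator (fun _ => 2) b) ∂(ν q) :=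
          integral_mono Integrable.of_finite Integrable.of_finite hbound
      _ = δ * ‖t‖ + (ν q).real B * 2 := by
          rw [integral_add Integrable.of_finite Integrable.of_finite,
            integral_indicator (MeasurableSet.of_discrete)]
          simp
      _ < ε := by
          have : δ * ‖t‖ ≤ ε / 4 := by
            rw [hδ, div_mul_eq_mul_div, div_le_div_iff₀ (by positivity) (by positivity)]
            nlinarith
          linarith
  have hlim := ProbabilityMeasure.tendsto_iff_forall_integral_tendsto.1
    (ProbabilityMeasure.tendsto_of_tendsto_charFun (μ := L) (μ₀ := G) hchar) g
  refine hlim.congr fun q => ?_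
  simp only [L, ProbabilityMeasure.coe_mk]
  rw [integral_map (hYm q).aemeasurable (by fun_prop)]

/-! ### Weighted subsample means and their conditional moments -/

section Draws

variable {n : ℕ} (x : Fin n → Obs) (p : Fin n → ℝ)

/-- The weight of observation `i` in the normalized subsample log-likelihood. -/
noncomputable def drawWeight {m : ℕ} (J : Fin m → Fin n) (i : Fin n) : ℝ :=
  (1 / (n : ℝ)) * if (x i).Censored then ∑ j, if J j = i then 1 / ((m : ℝ) * p i) else 0 else 1

/-- The contribution of a draw with index `i` to the weighted mean of `h`. -/
noncomputable def drawValue (h : Fin n → ℝ) (i : Fin n) : ℝ :=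
  h i / (n * p i) + (1 / (n : ℝ)) * ∑ i with ¬ (x i).Censored, h i

variable {x p}

lemma drawWeight_nonneg (hp : IsSubsamplingProb x p) {m : ℕ} (J : Fin m → Fin n) (i : Fin n) :
    0 ≤ drawWeight x p J i := by
  unfold drawWeight
  refine mul_nonneg (by positivity) ?_
  split_ifs with h
  · refine Finset.sum_nonneg fun j _ => ?_
    have := hp.pos i h
    split_ifs <;> positivity
  · norm_num

/-- Exchanges summation over observations and over draws. Draws must hit censored indices, because
`drawWeight` counts no draws at an uncensored one. -/
lemma sum_drawWeight_mul_aux {m : ℕ} {J : Fin m → Fin n} (hJ : ∀ j, (x (J j)).Censored)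
    (h : Fin n → ℝ) :
    ∑ i, drawWeight x p J i * h i
      = (1 / (n : ℝ)) * ((∑ i with ¬ (x i).Censored, h i)
        + ∑ j, (1 / ((m : ℝ) * p (J j))) * h (J j)) := by
  have e : ∀ i, drawWeight x p J i * h i = (1 / (n : ℝ)) * ((if ¬ (x i).Censored then h i else 0)
      + ∑ j, if J j = i then (1 / ((m : ℝ) * p (J j))) * h (J j) else 0) := by
    intro i
    unfold drawWeight
    rw [mul_assoc]
    congr 1
    by_cases hi : (x i).Censored
    · rw [if_pos hi, if_neg (not_not.2 hi), zero_add, Finset.sum_mul]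
      refine Finset.sum_congr rfl fun j _ => ?_
      by_cases hj : J j = i
      · rw [if_pos hj, if_pos hj, hj]
      · rw [if_neg hj, if_neg hj, zero_mul]
    · rw [if_neg hi, if_pos hi, one_mul]
      have : ∑ j, (if J j = i then (1 / ((m : ℝ) * p (J j))) * h (J j) else 0) = 0 :=
        Finset.sum_eq_zero fun j _ => if_neg fun hj => hi (by rw [← hj]; exact hJ j)
      rw [this, add_zero]
  simp_rw [e]
  rw [← Finset.mul_sum, Finset.sum_add_distrib, Finset.sum_comm, Finset.sum_filter]
  simp

/-- The uncensored mean is a constant, so each draw may carry it inside `drawValue`; the weighted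
mean becomes an ordinary mean of i.i.d. variables. -/
lemma sum_drawWeight_mul {m : ℕ} (hm : 0 < m) {J : Fin m → Fin n}
    (hJ : ∀ j, (x (J j)).Censored) (h : Fin n → ℝ) :
    ∑ i, drawWeight x p J i * h i = (1 / (m : ℝ)) * ∑ j, drawValue x p h (J j) := by
  have hm' : (m : ℝ) ≠ 0 := by exact_mod_cast hm.ne'
  rw [sum_drawWeight_mul_aux hJ]
  unfold drawValue
  rw [Finset.sum_add_distrib, Finset.sum_const, Finset.card_univ, Fintype.card_fin, nsmul_eq_mul,
    mul_add, mul_add, ← mul_assoc (1 / (m : ℝ)) (m : ℝ), one_div_mul_cancel hm', one_mul, add_comm]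
  congr 1
  rw [Finset.mul_sum, Finset.mul_sum]
  refine Finset.sum_congr rfl fun j _ => ?_
  field_simp

lemma subLogLik_eq_sum_drawWeight {d : ℕ} (f : Param d → ℝ → ℝ) (hn : 0 < n) {m : ℕ}
    {J : Fin m → Fin n} (hJ : ∀ j, (x (J j)).Censored) (θ : Param d) :
    subLogLik f x p J θ = n * ∑ i, drawWeight x p J i * logLik f (x i) θ := by
  have hn' : (n : ℝ) ≠ 0 := by exact_mod_cast hn.ne'
  rw [sum_drawWeight_mul_aux hJ, ← mul_assoc, mul_one_div_cancel hn', one_mul]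
  rfl

lemma integral_drawOne {F : Type*} [NormedAddCommGroup F] [NormedSpace ℝ F] [CompleteSpace F]
    (hp : IsSubsamplingProb x p) (h : Fin n → F) :
    ∫ i, h i ∂(drawOne x p) = ∑ i with (x i).Censored, p i • h i := by
  unfold drawOne
  rw [integral_finsetSum_measure]
  · refine Finset.sum_congr rfl fun i hi => ?_
    rw [integral_smul_measure, integral_dirac,
      ENNReal.toReal_ofReal (hp.pos i (Finset.mem_filter.1 hi).2).le]
  · intro i _
    exact Integrable.smul_measure Integrable.of_finite ENNReal.ofReal_ne_top

lemma isProbabilityMeasure_drawOne (hp : IsSubsamplingProb x p) (hC : ∃ i, (x i).Censored) :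
    IsProbabilityMeasure (drawOne x p) := by
  constructor
  unfold drawOne
  rw [Measure.finsetSum_apply]
  simp only [Measure.smul_apply, measure_univ, smul_eq_mul, mul_one]
  rw [← ENNReal.ofReal_sum_of_nonneg, hp.sum_eq_one hC, ENNReal.ofReal_one]
  exact fun i hi => (hp.pos i (Finset.mem_filter.1 hi).2).le

lemma ae_drawLaw_censored (m : ℕ) [IsProbabilityMeasure (drawOne x p)] :
    ∀ᵐ J ∂(drawLaw x p m), ∀ j, (x (J j)).Censored := by
  rw [ae_all_iff]
  intro j
  have h1 : ∀ᵐ i ∂(drawOne x p), (x i).Censored := by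
    rw [ae_iff]
    unfold drawOne
    rw [Measure.finsetSum_apply]
    refine Finset.sum_eq_zero fun i hi => ?_
    have := (Finset.mem_filter.1 hi).2
    simp [this]
  exact (measurePreserving_eval (fun _ : Fin m => drawOne x p) j).quasiMeasurePreserving.ae h1

lemma inv_le_maxInvProb {i : Fin n} (hi : (x i).Censored) :
    ((n : ℝ) * p i)⁻¹ ≤ maxInvProb x p := by
  have := le_ciSup (f := fun i => if (x i).Censored then ((n : ℝ) * p i)⁻¹ else 0)
    (Set.finite_range _).bddAbove i
  rwa [if_pos hi] at this

variable {K : ℝ}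

/-- The probability of drawing i cancels one of the two factors 1/p_i; the other one gives (n p_i)⁻¹
≤ K. For fourth powers three such factors remain, hence K³. -/
lemma integral_sq_div_le (hp : IsSubsamplingProb x p) (hK : maxInvProb x p ≤ K) (hK0 : 0 ≤ K)
    (h : Fin n → ℝ) :
    ∫ i, (h i / (n * p i)) ^ 2 ∂(drawOne x p) ≤ K * ((1 / (n : ℝ)) * ∑ i, h i ^ 2) := by
  rw [integral_drawOne hp, Finset.mul_sum, Finset.mul_sum]
  refine le_trans (Finset.sum_le_sum (g := fun i => K * ((1 / (n : ℝ)) * h i ^ 2))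
    fun i hi => ?_) (Finset.sum_le_sum_of_subset_of_nonneg (Finset.filter_subset _ _)
      fun i _ _ => by positivity)
  have hi' := (Finset.mem_filter.1 hi).2
  have hpi := hp.pos i hi'
  have hn : (0 : ℝ) < n := by
    have := i.pos
    exact_mod_cast this
  have hk := (inv_le_maxInvProb (p := p) hi').trans hK
  calc p i • (h i / (n * p i)) ^ 2 = (n * p i)⁻¹ * ((1 / (n : ℝ)) * h i ^ 2) := by
        simp only [smul_eq_mul]; field_simp
    _ ≤ _ := by gcongr

lemma integral_pow_four_div_le (hp : IsSubsamplingProb x p) (hK : maxInvProb x p ≤ K)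
    (hK0 : 0 ≤ K) (h : Fin n → ℝ) :
    ∫ i, (h i / (n * p i)) ^ 4 ∂(drawOne x p) ≤ K ^ 3 * ((1 / (n : ℝ)) * ∑ i, h i ^ 4) := by
  rw [integral_drawOne hp, Finset.mul_sum, Finset.mul_sum]
  refine le_trans (Finset.sum_le_sum (g := fun i => K ^ 3 * ((1 / (n : ℝ)) * h i ^ 4))
    fun i hi => ?_) (Finset.sum_le_sum_of_subset_of_nonneg (Finset.filter_subset _ _)
      fun i _ _ => by positivity)
  have hi' := (Finset.mem_filter.1 hi).2
  have hpi := hp.pos i hi'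
  have hn : (0 : ℝ) < n := by
    have := i.pos
    exact_mod_cast this
  have hk := (inv_le_maxInvProb (p := p) hi').trans hK
  calc p i • (h i / (n * p i)) ^ 4 = ((n * p i)⁻¹) ^ 3 * ((1 / (n : ℝ)) * h i ^ 4) := by
        simp only [smul_eq_mul]; field_simp
    _ ≤ _ := by gcongr

lemma integral_div_drawOne (hp : IsSubsamplingProb x p) (h : Fin n → ℝ) :
    ∫ i, h i / (n * p i) ∂(drawOne x p) = (1 / (n : ℝ)) * ∑ i with (x i).Censored, h i := by
  rw [integral_drawOne hp, Finset.mul_sum]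
  refine Finset.sum_congr rfl fun i hi => ?_
  have hpi := hp.pos i (Finset.mem_filter.1 hi).2
  simp only [smul_eq_mul]
  field_simp

lemma integral_drawValue [IsProbabilityMeasure (drawOne x p)] (hp : IsSubsamplingProb x p)
    (h : Fin n → ℝ) :
    ∫ i, drawValue x p h i ∂(drawOne x p) = (1 / (n : ℝ)) * ∑ i, h i := by
  unfold drawValue
  rw [integral_add Integrable.of_finite Integrable.of_finite, integral_div_drawOne hp,
    integral_const, ← Finset.sum_filter_add_sum_filter_not Finset.univ (fun i => (x i).Censored) h]
  simp
  ring

/-- When h sums to zero, the uncensored mean is minus the censored mean, which is the expectation of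
h/(np) under one draw. So `drawValue` is h/(np) centred, and its second moment is a variance: with h
a coordinate of the scores at θ̂ this is the quadratic form of Λ_c. -/
lemma integral_drawValue_sq [IsProbabilityMeasure (drawOne x p)] (hp : IsSubsamplingProb x p)
    {h : Fin n → ℝ} (h0 : ∑ i, h i = 0) :
    ∫ i, drawValue x p h i ^ 2 ∂(drawOne x p)
      = (1 / (n : ℝ) ^ 2) * (∑ i with (x i).Censored, (1 / p i) * h i ^ 2)
        - ((1 / (n : ℝ)) * ∑ i with (x i).Censored, h i) ^ 2 := by
  have hs := Finset.sum_filter_add_sum_filter_not Finset.univ (fun i => (x i).Censored) h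
  rw [h0] at hs
  set c := ∑ i with (x i).Censored, h i with hc
  have hv : ∀ i, drawValue x p h i = h i / (n * p i) - (1 / (n : ℝ)) * c := by
    intro i
    unfold drawValue
    have : ∑ i with ¬ (x i).Censored, h i = -c := by linarith
    rw [this]
    ring
  have e : ∀ i, drawValue x p h i ^ 2 = (h i / (n * p i)) ^ 2
      - 2 * ((1 / (n : ℝ)) * c) * (h i / (n * p i)) + ((1 / (n : ℝ)) * c) ^ 2 := by
    intro i; rw [hv]; ring
  simp_rw [e]
  rw [integral_add Integrable.of_finite Integrable.of_finite,
    integral_sub Integrable.of_finite Integrable.of_finite, integral_const_mul,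
    integral_div_drawOne hp, ← hc, integral_const, integral_drawOne hp]
  have : ∑ i with (x i).Censored, p i • (h i / (n * p i)) ^ 2
      = (1 / (n : ℝ) ^ 2) * (∑ i with (x i).Censored, (1 / p i) * h i ^ 2) := by
    rw [Finset.mul_sum]
    refine Finset.sum_congr rfl fun i hi => ?_
    have hpi := hp.pos i (Finset.mem_filter.1 hi).2
    simp only [smul_eq_mul]
    field_simp
  rw [this]
  simp
  ring

/-- Cauchy–Schwarz twice; s has at most n elements. -/
lemma mean_pow_four_le (s : Finset (Fin n)) (h : Fin n → ℝ) :
    ((1 / (n : ℝ)) * ∑ i ∈ s, h i) ^ 4 ≤ (1 / (n : ℝ)) * ∑ i, h i ^ 4 := by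
  rcases Nat.eq_zero_or_pos n with rfl | hn
  · simp
  have hn' : (0 : ℝ) < n := by exact_mod_cast hn
  have hs : (s.card : ℝ) ≤ n := by
    have := s.card_le_univ
    rw [Fintype.card_fin] at this
    exact_mod_cast this
  have h1 : (∑ i ∈ s, h i) ^ 2 ≤ n * ∑ i ∈ s, h i ^ 2 :=
    sq_sum_le_card_mul_sum_sq.trans (by gcongr)
  have h2 : (∑ i ∈ s, h i ^ 2) ^ 2 ≤ n * ∑ i ∈ s, (h i ^ 2) ^ 2 :=
    sq_sum_le_card_mul_sum_sq.trans (by gcongr)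
  have h3 : ∑ i ∈ s, (h i ^ 2) ^ 2 ≤ ∑ i, h i ^ 4 := by
    refine (Finset.sum_le_sum_of_subset_of_nonneg (Finset.subset_univ _)
      fun i _ _ => by positivity).trans (le_of_eq ?_)
    exact Finset.sum_congr rfl fun i _ => by ring
  calc ((1 / (n : ℝ)) * ∑ i ∈ s, h i) ^ 4 = (1 / (n : ℝ)) ^ 4 * ((∑ i ∈ s, h i) ^ 2) ^ 2 := by ring
    _ ≤ (1 / (n : ℝ)) ^ 4 * (n * ∑ i ∈ s, h i ^ 2) ^ 2 := by gcongr
    _ = (1 / (n : ℝ)) ^ 2 * (∑ i ∈ s, h i ^ 2) ^ 2 := by field_simp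
    _ ≤ (1 / (n : ℝ)) ^ 2 * (n * ∑ i, h i ^ 4) := by gcongr; exact h2.trans (by gcongr)
    _ = _ := by field_simp

lemma integral_drawValue_pow_four_le [IsProbabilityMeasure (drawOne x p)]
    (hp : IsSubsamplingProb x p) (hK : maxInvProb x p ≤ K) (hK0 : 0 ≤ K) (h : Fin n → ℝ) :
    ∫ i, drawValue x p h i ^ 4 ∂(drawOne x p)
      ≤ 8 * (K ^ 3 + 1) * ((1 / (n : ℝ)) * ∑ i, h i ^ 4) := by
  set c := (1 / (n : ℝ)) * ∑ i with ¬ (x i).Censored, h i with hc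
  have e : ∀ i, drawValue x p h i ^ 4 ≤ 8 * (h i / (n * p i)) ^ 4 + 8 * c ^ 4 := by
    intro i
    unfold drawValue
    rw [← hc]
    generalize h i / (n * p i) = a
    have := (by decide : Even 4).add_pow_le (a := a) (b := c)
    norm_num at this
    linarith
  refine (integral_mono Integrable.of_finite Integrable.of_finite e).trans ?_
  rw [integral_add Integrable.of_finite Integrable.of_finite, integral_const_mul, integral_const]
  have h1 := integral_pow_four_div_le hp hK hK0 h
  have h2 := mean_pow_four_le (Finset.univ.filter fun i => ¬ (x i).Censored) h
  rw [← hc] at h2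
  simp only [probReal_univ, one_smul]
  linarith

/-- Conditionally on the data, the subsample mean of `h` concentrates at its full data mean. -/
lemma drawLaw_real_ge_le [IsProbabilityMeasure (drawOne x p)] (hp : IsSubsamplingProb x p)
    (hK : maxInvProb x p ≤ K) (hK0 : 0 ≤ K) (h : Fin n → ℝ) {m : ℕ} (hm : 0 < m)
    {η : ℝ} (hη : 0 < η) :
    (drawLaw x p m).real
        {J | η ≤ |∑ i, drawWeight x p J i * h i - (1 / (n : ℝ)) * ∑ i, h i|}
      ≤ K * ((1 / (n : ℝ)) * ∑ i, h i ^ 2) / (m * η ^ 2) := by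
  have h1 := measureReal_pi_mean_ge_le (drawOne x p) (fun i => h i / (n * p i)) hm hη
  have h2 := integral_sq_div_le hp hK hK0 h
  have hm' : (0 : ℝ) < m := by exact_mod_cast hm
  refine le_trans (le_of_eq ?_) (h1.trans (by gcongr))
  unfold drawLaw
  refine measureReal_congr ?_
  filter_upwards [ae_drawLaw_censored (x := x) (p := p) m] with J hJ
  -- The uncensored part is common to both means and cancels; only the sampling fluctuation of
  -- h/(np) is left.
  have : ∑ i, drawWeight x p J i * h i - (1 / (n : ℝ)) * ∑ i, h i
      = (1 / (m : ℝ)) * ∑ j, h (J j) / (n * p (J j)) - ∫ i, h i / (n * p i) ∂(drawOne x p) := by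
    rw [sum_drawWeight_mul hm hJ, integral_div_drawOne hp,
      ← Finset.sum_filter_add_sum_filter_not Finset.univ (fun i => (x i).Censored) h]
    unfold drawValue
    rw [Finset.sum_add_distrib, Finset.sum_const, Finset.card_univ, Fintype.card_fin, nsmul_eq_mul]
    field_simp
    ring
  change (η ≤ |_|) = (η ≤ |_|)
  rw [this]

end Draws

/-- Central limit theorem for weighted subsample means of vectors. -/
lemma tendsto_integral_exp_drawLaw {E : Type*} [NormedAddCommGroup E] [InnerProductSpace ℝ E]
    {n m : ℕ → ℕ} (x : ∀ q, Fin (n q) → Obs) (p : ∀ q, Fin (n q) → ℝ)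
    (hp : ∀ q, IsSubsamplingProb (x q) (p q)) (hC : ∀ q, ∃ i, (x q i).Censored)
    (hm : Tendsto m atTop atTop) (hm0 : ∀ q, 0 < m q) {K : ℝ} (hK0 : 0 ≤ K)
    (hK : ∀ q, maxInvProb (x q) (p q) ≤ K)
    (b : ∀ q, Fin (n q) → E) (h0 : ∀ q, ∑ i, b q i = 0)
    (hcov : ∀ q t, (1 / (n q : ℝ) ^ 2)
        * (∑ i with (x q i).Censored, (1 / p q i) * (inner ℝ (b q i) t) ^ 2)
        - ((1 / (n q : ℝ)) * ∑ i with (x q i).Censored, inner ℝ (b q i) t) ^ 2 = ‖t‖ ^ 2)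
    (h4 : ∀ q, (1 / (n q : ℝ)) * ∑ i, ‖b q i‖ ^ 4 ≤ K) (t : E) :
    Tendsto (fun q => ∫ J, Complex.exp
        ((inner ℝ (Real.sqrt (m q) • ∑ i, drawWeight (x q) (p q) J i • b q i) t : ℝ) * Complex.I)
          ∂(drawLaw (x q) (p q) (m q))) atTop (𝓝 (Real.exp (-‖t‖ ^ 2 / 2) : ℂ)) := by
  have hprob : ∀ q, IsProbabilityMeasure (drawOne (x q) (p q)) := fun q =>
    isProbabilityMeasure_drawOne (hp q) (hC q)
  have h0' : ∀ q, ∑ i, inner ℝ (b q i) t = 0 := fun q => by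
    rw [← sum_inner, h0, inner_zero_left]
  have key := tendsto_integral_exp_pi (fun q => drawOne (x q) (p q)) hm
    (fun q => drawValue (x q) (p q) fun i => inner ℝ (b q i) t)
    (σ := ‖t‖ ^ 2) (K := 8 * (K ^ 3 + 1) * (K * ‖t‖ ^ 4))
    (fun q => by rw [integral_drawValue (hp q), h0', mul_zero])
    (fun q => by rw [integral_drawValue_sq (hp q) (h0' q), hcov])
    (fun q => by
      refine (integral_drawValue_pow_four_le (hp q) (hK q) hK0 _).trans ?_
      refine mul_le_mul_of_nonneg_left ?_ (by positivity)
      refine le_trans ?_ (mul_le_mul_of_nonneg_right (h4 q) (by positivity : 0 ≤ ‖t‖ ^ 4))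
      rw [mul_assoc, Finset.sum_mul]
      gcongr with i _
      rw [← mul_pow, ← Even.pow_abs (by decide : Even 4) (inner ℝ (b q i) t)]
      gcongr
      exact abs_real_inner_le_norm _ _)
  refine key.congr fun q => ?_
  refine integral_congr_ae ?_
  filter_upwards [ae_drawLaw_censored (x := x q) (p := p q) (m q)] with J hJ
  congr 3
  have hm' : (0 : ℝ) < m q := by exact_mod_cast hm0 q
  rw [real_inner_smul_left, sum_inner]
  simp_rw [real_inner_smul_left]
  rw [sum_drawWeight_mul (hm0 q) hJ, ← mul_assoc]
  congr 1
  rw [mul_one_div, Real.sqrt_div_self', one_div]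

/-! ### Strongly concave functions and linearization at a maximizer -/

section Calculus

variable {E : Type*} [NormedAddCommGroup E] [NormedSpace ℝ E]

lemma differentiableAt_fderiv {L : E → ℝ} {θ : E} (h : ContDiffAt ℝ 2 L θ) :
    DifferentiableAt ℝ (fderiv ℝ L) θ :=
  (h.fderiv_right (m := 1) (by norm_num)).differentiableAt (by norm_num)

/-- Quadratic upper bound for a function whose second derivative is bounded above on a convex
set. -/
lemma le_add_of_fderiv_fderiv_le {Θ : Set E} (hΘ : Convex ℝ Θ) {L : E → ℝ}
    (hL : ∀ θ ∈ Θ, ContDiffAt ℝ 2 L θ) {κ : ℝ}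
    (hκ : ∀ θ ∈ Θ, ∀ v, fderiv ℝ (fderiv ℝ L) θ v v ≤ κ * ‖v‖ ^ 2) {a b : E} (ha : a ∈ Θ)
    (hb : b ∈ Θ) : L b ≤ L a + fderiv ℝ L a (b - a) + κ / 2 * ‖b - a‖ ^ 2 := by
  set v := b - a with hv
  set γ : ℝ → E := fun t => a + t • v with hγ
  have hγm : ∀ t ∈ Set.Icc (0 : ℝ) 1, γ t ∈ Θ := fun t ht => by
    have := hΘ.add_smul_sub_mem ha hb ht
    simpa [hγ, hv] using this
  have hγd : ∀ t, HasDerivAt γ v t := fun t => by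
    have := ((hasDerivAt_id t).smul_const v).const_add a
    simpa [hγ] using this
  have hφ : ∀ t ∈ Set.Icc (0 : ℝ) 1, HasDerivAt (fun t => L (γ t)) (fderiv ℝ L (γ t) v) t :=
    fun t ht => (((hL _ (hγm t ht)).differentiableAt (by norm_num)).hasFDerivAt).comp_hasDerivAt t
      (hγd t)
  have hφ' : ∀ t ∈ Set.Icc (0 : ℝ) 1, HasDerivAt (fun t => fderiv ℝ L (γ t) v)
      (fderiv ℝ (fderiv ℝ L) (γ t) v v) t := fun t ht => by
    have h1 := ((differentiableAt_fderiv (hL _ (hγm t ht))).hasFDerivAt).comp_hasDerivAt t (hγd t)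
    have h2 := h1.clm_apply (hasDerivAt_const t v)
    simpa using h2
  -- The second derivative bound is integrated twice along the segment, each time as antitonicity of
  -- a function minus its claimed bound: here for the slope, below for the values.
  have h1 : ∀ t ∈ Set.Icc (0 : ℝ) 1, fderiv ℝ L (γ t) v ≤ fderiv ℝ L a v + κ * ‖v‖ ^ 2 * t := by
    have hanti : AntitoneOn (fun t => fderiv ℝ L (γ t) v - κ * ‖v‖ ^ 2 * t) (Set.Icc 0 1) := by
      have hd : ∀ t ∈ Set.Icc (0 : ℝ) 1,
          HasDerivAt (fun t => fderiv ℝ L (γ t) v - κ * ‖v‖ ^ 2 * t)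
            (fderiv ℝ (fderiv ℝ L) (γ t) v v - κ * ‖v‖ ^ 2) t := fun t ht => by
        exact ((hφ' t ht).sub ((hasDerivAt_id t).const_mul (κ * ‖v‖ ^ 2))).congr_deriv (by simp)
      refine antitoneOn_of_deriv_nonpos (convex_Icc 0 1)
        (fun t ht => (hd t ht).continuousAt.continuousWithinAt)
        (fun t ht => (hd t (interior_subset ht)).differentiableAt.differentiableWithinAt)
        (fun t ht => ?_)
      rw [(hd t (interior_subset ht)).deriv]
      exact sub_nonpos.2 (hκ _ (hγm t (interior_subset ht)) v)
    intro t ht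
    have := hanti (Set.left_mem_Icc.2 zero_le_one) ht ht.1
    simp only [hγ, zero_smul, add_zero, mul_zero, sub_zero] at this
    linarith
  have hanti : AntitoneOn
      (fun t => L (γ t) - t * fderiv ℝ L a v - κ / 2 * ‖v‖ ^ 2 * t ^ 2) (Set.Icc 0 1) := by
    have hd : ∀ t ∈ Set.Icc (0 : ℝ) 1,
        HasDerivAt (fun t => L (γ t) - t * fderiv ℝ L a v - κ / 2 * ‖v‖ ^ 2 * t ^ 2)
          (fderiv ℝ L (γ t) v - fderiv ℝ L a v - κ / 2 * ‖v‖ ^ 2 * (2 * t)) t := fun t ht => by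
      exact (((hφ t ht).sub ((hasDerivAt_id t).mul_const (fderiv ℝ L a v))).sub
        (((hasDerivAt_id t).pow 2).const_mul (κ / 2 * ‖v‖ ^ 2))).congr_deriv (by simp)
    refine antitoneOn_of_deriv_nonpos (convex_Icc 0 1)
      (fun t ht => (hd t ht).continuousAt.continuousWithinAt)
      (fun t ht => (hd t (interior_subset ht)).differentiableAt.differentiableWithinAt)
      (fun t ht => ?_)
    rw [(hd t (interior_subset ht)).deriv]
    have := h1 t (interior_subset ht)
    linarith
  have := hanti (Set.left_mem_Icc.2 zero_le_one) (Set.right_mem_Icc.2 zero_le_one) zero_le_one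
  have hb' : γ 1 = b := by simp [hγ, hv]
  have ha' : γ 0 = a := by simp [hγ]
  simp only [hb', ha'] at this
  linarith

/-- Linearization of the first order condition at the maximizer `θs` of a strongly concave
function, around a point `θh` at which the derivative is small. -/
lemma norm_fderiv_add_le_of_isMaxOn {Θ : Set E} (hΘ : Convex ℝ Θ) {L : E → ℝ}
    (hL : ∀ θ ∈ Θ, ContDiffAt ℝ 2 L θ) {c Ψ η ρ s : ℝ} (hc : 0 < c) (hη : 0 ≤ η) (hΨ : 0 ≤ Ψ)
    (hconc : ∀ θ ∈ Θ, ∀ v, fderiv ℝ (fderiv ℝ L) θ v v ≤ -c * ‖v‖ ^ 2)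
    {θh θs : E} (hball : Metric.ball θh ρ ⊆ Θ) (hρ : 0 < ρ)
    (hlip : ∀ θ ∈ Θ, ‖fderiv ℝ (fderiv ℝ L) θ - fderiv ℝ (fderiv ℝ L) θh‖ ≤ Ψ * ‖θ - θh‖)
    {M : E →L[ℝ] E →L[ℝ] ℝ} (hM : ‖fderiv ℝ (fderiv ℝ L) θh - M‖ ≤ η)
    (hθs : θs ∈ Θ) (hmax : IsMaxOn L Θ θs) (hs : ‖fderiv ℝ L θh‖ ≤ s) (hsρ : 2 / c * s < ρ) :
    ‖fderiv ℝ L θh + M (θs - θh)‖ ≤ (η + Ψ * (2 / c * s)) * (2 / c * s) := by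
  have hθh : θh ∈ Θ := hball (Metric.mem_ball_self hρ)
  set v := θs - θh with hv
  have h1 := le_add_of_fderiv_fderiv_le hΘ hL hconc hθh hθs
  have h2 : L θh ≤ L θs := hmax hθh
  have h3 : fderiv ℝ L θh v ≤ s * ‖v‖ :=
    (le_abs_self _).trans (((fderiv ℝ L θh).le_opNorm v).trans (by gcongr))
  -- In the quadratic upper bound L θh ≤ L θs cancels the values and leaves (c/2)‖v‖² ≤ s‖v‖.
  have hvs : ‖v‖ ≤ 2 / c * s := by
    have h4 : c / 2 * ‖v‖ ^ 2 ≤ s * ‖v‖ := by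
      rw [← hv] at h1
      linarith
    rcases (norm_nonneg v).eq_or_lt with h0 | h0
    · rw [← h0]
      have : 0 ≤ s := (norm_nonneg _).trans hs
      positivity
    · have h5 : c / 2 * ‖v‖ ≤ s := by
        have : (c / 2 * ‖v‖) * ‖v‖ ≤ s * ‖v‖ := by linarith
        exact le_of_mul_le_mul_right this h0
      rw [div_mul_eq_mul_div, le_div_iff₀ hc]
      linarith
  -- The smallness of s keeps θs inside the ball, hence interior to Θ, so the derivative vanishes
  -- there.
  have hnhds : Θ ∈ 𝓝 θs := by
    refine Filter.mem_of_superset (Metric.isOpen_ball.mem_nhds ?_) hball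
    rw [Metric.mem_ball, dist_eq_norm]
    exact hvs.trans_lt hsρ
  have hcrit : fderiv ℝ L θs = 0 := (hmax.isLocalMax hnhds).fderiv_eq_zero
  -- Within this ball the second derivative stays within Ψ‖v‖ of its value at θh, so the mean value
  -- inequality has an error quadratic in ‖v‖.
  have hconv : Convex ℝ (Θ ∩ Metric.closedBall θh ‖v‖) := hΘ.inter (convex_closedBall _ _)
  have h6 := hconv.norm_image_sub_le_of_norm_fderiv_le' (𝕜 := ℝ) (f := fderiv ℝ L)
    (φ := fderiv ℝ (fderiv ℝ L) θh) (C := Ψ * ‖v‖) (x := θh) (y := θs)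
    (fun θ hθ => differentiableAt_fderiv (hL θ hθ.1))
    (fun θ hθ => (hlip θ hθ.1).trans (by
      have := hθ.2
      rw [Metric.mem_closedBall, dist_eq_norm] at this
      gcongr))
    ⟨hθh, by simp⟩ ⟨hθs, by simp [hv, dist_eq_norm]⟩
  rw [hcrit, ← hv] at h6
  have e : fderiv ℝ L θh + M v = -(0 - fderiv ℝ L θh - fderiv ℝ (fderiv ℝ L) θh v)
      - (fderiv ℝ (fderiv ℝ L) θh - M) v := by
    simp only [sub_apply]
    abel
  rw [e]
  refine (norm_sub_le _ _).trans ?_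
  rw [norm_neg]
  have h7 : ‖(fderiv ℝ (fderiv ℝ L) θh - M) v‖ ≤ η * ‖v‖ :=
    (ContinuousLinearMap.le_opNorm _ _).trans (by gcongr)
  calc _ ≤ Ψ * ‖v‖ * ‖v‖ + η * ‖v‖ := add_le_add h6 h7
    _ = (η + Ψ * ‖v‖) * ‖v‖ := by ring
    _ ≤ _ := by
      have : 0 ≤ 2 / c * s := (norm_nonneg _).trans hvs
      gcongr

variable {ι : Type*} [Fintype ι]

lemma contDiffAt_sum_mul {ℓ : ι → E → ℝ} {θ : E} (h : ∀ i, ContDiffAt ℝ 2 (ℓ i) θ) (w : ι → ℝ) :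
    ContDiffAt ℝ 2 (fun θ => ∑ i, w i * ℓ i θ) θ :=
  ContDiffAt.sum fun i _ => contDiffAt_const.mul (h i)

lemma fderiv_sum_mul {ℓ : ι → E → ℝ} {θ : E} (h : ∀ i, DifferentiableAt ℝ (ℓ i) θ) (w : ι → ℝ) :
    fderiv ℝ (fun θ => ∑ i, w i * ℓ i θ) θ = ∑ i, w i • fderiv ℝ (ℓ i) θ := by
  refine HasFDerivAt.fderiv (HasFDerivAt.fun_sum fun i _ => ?_)
  exact (h i).hasFDerivAt.const_mul (w i)

/-- To be differentiated again, the formula for the first derivative must hold on a neighbourhood of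
θ; C² regularity at θ supplies one. -/
lemma fderiv_fderiv_sum_mul {ℓ : ι → E → ℝ} {θ : E} (h : ∀ i, ContDiffAt ℝ 2 (ℓ i) θ)
    (w : ι → ℝ) :
    fderiv ℝ (fderiv ℝ (fun θ => ∑ i, w i * ℓ i θ)) θ
      = ∑ i, w i • fderiv ℝ (fderiv ℝ (ℓ i)) θ := by
  have hev : fderiv ℝ (fun θ => ∑ i, w i * ℓ i θ) =ᶠ[𝓝 θ] fun θ => ∑ i, w i • fderiv ℝ (ℓ i) θ := by
    have : ∀ᶠ θ' in 𝓝 θ, ∀ i, DifferentiableAt ℝ (ℓ i) θ' := by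
      rw [eventually_all]
      intro i
      filter_upwards [(h i).eventually (by norm_num)] with θ' hθ'
      exact hθ'.differentiableAt (by norm_num)
    filter_upwards [this] with θ' hθ'
    exact fderiv_sum_mul hθ' w
  rw [hev.fderiv_eq]
  refine HasFDerivAt.fderiv (HasFDerivAt.fun_sum fun i _ => ?_)
  exact (differentiableAt_fderiv (h i)).hasFDerivAt.const_smul (w i)

end Calculus

/-! ### Bilinear forms, matrices and standardization -/

section Bilinear

variable {d : ℕ}

lemma bilin_eq_sum (B : Param d →L[ℝ] Param d →L[ℝ] ℝ) (v w : Param d) :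
    B v w = ∑ j, ∑ k, v j * w k * B (EuclideanSpace.single j 1) (EuclideanSpace.single k 1) := by
  have hrep : ∀ v : Param d, v = ∑ j, v j • EuclideanSpace.single j (1 : ℝ) := fun v => by
    have := (EuclideanSpace.basisFun (Fin d) ℝ).sum_repr v
    simpa using this.symm
  conv_lhs => rw [hrep v, hrep w]
  simp only [map_sum, map_smul, sum_apply, smul_apply,
    smul_eq_mul, Finset.mul_sum]
  rw [Finset.sum_comm]
  refine Finset.sum_congr rfl fun j _ => Finset.sum_congr rfl fun k _ => by ring

lemma bilin_norm_le (B : Param d →L[ℝ] Param d →L[ℝ] ℝ) {K : ℝ} (hK : 0 ≤ K)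
    (h : ∀ j k, |B (EuclideanSpace.single j 1) (EuclideanSpace.single k 1)| ≤ K) :
    ‖B‖ ≤ d ^ 2 * K := by
  refine ContinuousLinearMap.opNorm_le_bound₂ _ (by positivity) fun v w => ?_
  rw [bilin_eq_sum, Real.norm_eq_abs]
  refine (Finset.abs_sum_le_sum_abs _ _).trans ?_
  have : ∀ j, |∑ k, v j * w k * B (EuclideanSpace.single j 1) (EuclideanSpace.single k 1)|
      ≤ ∑ _k : Fin d, ‖v‖ * ‖w‖ * K := fun j => by
    refine (Finset.abs_sum_le_sum_abs _ _).trans (Finset.sum_le_sum fun k _ => ?_)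
    rw [abs_mul, abs_mul]
    have h1 : |v j| ≤ ‖v‖ := by simpa using PiLp.norm_apply_le v j
    have h2 : |w k| ≤ ‖w‖ := by simpa using PiLp.norm_apply_le w k
    have := h j k
    gcongr
  refine (Finset.sum_le_sum fun j _ => this j).trans (le_of_eq ?_)
  simp
  ring

lemma euclidean_norm_le {v : Param d} {K : ℝ} (hK : 0 ≤ K) (h : ∀ j, |v j| ≤ K) :
    ‖v‖ ≤ d * K := by
  rw [EuclideanSpace.norm_eq]
  refine Real.sqrt_le_iff.2 ⟨by positivity, ?_⟩
  have h1 : ∑ i, ‖v i‖ ^ 2 ≤ ∑ _i : Fin d, K ^ 2 := Finset.sum_le_sum fun i _ => by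
    have := h i
    rw [Real.norm_eq_abs]
    gcongr
  refine h1.trans ?_
  rcases Nat.eq_zero_or_pos d with rfl | hd
  · simp
  have : (1 : ℝ) ≤ d := by exact_mod_cast hd
  simp
  nlinarith [sq_nonneg K, mul_nonneg (sub_nonneg.2 this) (sq_nonneg K)]

end Bilinear

variable {d : ℕ}

lemma invSqrt_isHermitian (V : Matrix (Fin d) (Fin d) ℝ) : (invSqrt V).IsHermitian :=
  cfc_predicate (p := IsSelfAdjoint) _ V

/-- On the spectrum s^{-1/2} · s · s^{-1/2} = 1. Positivity of the spectrum also gives the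
continuity that the functional calculus asks for. -/
lemma invSqrt_mul_mul_invSqrt {V : Matrix (Fin d) (Fin d) ℝ} (hV : V.PosDef) :
    invSqrt V * V * invSqrt V = 1 := by
  have hsa : IsSelfAdjoint V := hV.isHermitian
  have hpos : ∀ s ∈ spectrum ℝ V, 0 < s := by
    intro s hs
    rw [hV.isHermitian.spectrum_real_eq_range_eigenvalues] at hs
    obtain ⟨i, rfl⟩ := hs
    exact hV.eigenvalues_pos i
  have hcont : ContinuousOn (fun s : ℝ => (Real.sqrt s)⁻¹) (spectrum ℝ V) :=
    Real.continuous_sqrt.continuousOn.inv₀ fun s hs => (Real.sqrt_pos.2 (hpos s hs)).ne'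
  have h1 : invSqrt V * V * invSqrt V
      = cfc (fun s : ℝ => (Real.sqrt s)⁻¹ * s * (Real.sqrt s)⁻¹) V := by
    conv_lhs => rw [← cfc_id' ℝ V]
    unfold invSqrt
    rw [cfc_id' ℝ V, cfc_mul (fun s : ℝ => (Real.sqrt s)⁻¹ * s) (fun s => (Real.sqrt s)⁻¹) V
      (hcont.mul continuousOn_id) hcont, cfc_mul (fun s : ℝ => (Real.sqrt s)⁻¹) (fun s => s) V
      hcont continuousOn_id, cfc_id' ℝ V]
  rw [h1, cfc_congr (g := fun _ => (1 : ℝ)), cfc_const_one ℝ V]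
  intro s hs
  have := hpos s hs
  have h2 := Real.sq_sqrt this.le
  have h3 := Real.sqrt_pos.2 this
  simp only
  field_simp
  exact h2.symm

/-- `V^{-1/2} M⁻¹` for `V = M⁻¹ Λ M⁻¹` standardizes `Λ`. -/
lemma standardize_mul {M Λ : Matrix (Fin d) (Fin d) ℝ} (hM : (-M).PosDef) (hΛ : Λ.PosDef) :
    invSqrt (M⁻¹ * Λ * M⁻¹) * M⁻¹ * Λ * (invSqrt (M⁻¹ * Λ * M⁻¹) * M⁻¹).transpose = 1 := by
  have hMu : IsUnit M := by simpa using hM.isUnit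
  have hMh : M.IsHermitian := by simpa using hM.isHermitian.neg
  have hMi : (M⁻¹).conjTranspose = M⁻¹ := hMh.inv.eq
  have hV : (M⁻¹ * Λ * M⁻¹).PosDef := by
    have := hΛ.conjTranspose_mul_mul_same (B := M⁻¹)
      (Matrix.mulVec_injective_iff_isUnit.2 (by simpa using hMu))
    rwa [hMi] at this
  have hQ := invSqrt_mul_mul_invSqrt hV
  have hQh := (invSqrt_isHermitian (M⁻¹ * Λ * M⁻¹)).eq
  rw [← Matrix.conjTranspose_eq_transpose_of_trivial, Matrix.conjTranspose_mul, hMi, hQh]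
  simpa [Matrix.mul_assoc] using hQ

lemma inner_toEuclideanLin_transpose (A : Matrix (Fin d) (Fin d) ℝ) (v w : Param d) :
    inner ℝ (Matrix.toEuclideanLin A v) w = inner ℝ v (Matrix.toEuclideanLin A.transpose w) := by
  rw [← Matrix.conjTranspose_eq_transpose_of_trivial, Matrix.toEuclideanLin_conjTranspose_eq_adjoint,
    LinearMap.adjoint_inner_right]

lemma inner_toEuclideanLin (A : Matrix (Fin d) (Fin d) ℝ) (v w : Param d) :
    inner ℝ v (Matrix.toEuclideanLin A w) = ∑ j, ∑ k, v j * A j k * w k := by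
  simp only [PiLp.inner_apply, Matrix.toLpLin_apply, Matrix.mulVec, dotProduct]
  refine Finset.sum_congr rfl fun j _ => ?_
  simp [Finset.sum_mul]
  refine Finset.sum_congr rfl fun k _ => by ring

lemma le_inner_of_posSemidef_sub {Λ : Matrix (Fin d) (Fin d) ℝ} {c : ℝ}
    (h : (Λ - c • (1 : Matrix (Fin d) (Fin d) ℝ)).PosSemidef) (w : Param d) :
    c * ‖w‖ ^ 2 ≤ inner ℝ w (Matrix.toEuclideanLin Λ w) := by
  have h1 := h.dotProduct_mulVec_nonneg w.ofLp
  have h2 : star w.ofLp ⬝ᵥ ((Λ - c • (1 : Matrix (Fin d) (Fin d) ℝ)).mulVec w.ofLp)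
      = inner ℝ w (Matrix.toEuclideanLin Λ w) - c * ‖w‖ ^ 2 := by
    have hn : ‖w‖ ^ 2 = ∑ j, w j * w j := by
      rw [EuclideanSpace.norm_sq_eq]
      simp [sq]
    rw [hn, Matrix.sub_mulVec, Matrix.smul_mulVec, Matrix.one_mulVec,
      dotProduct_sub, dotProduct_smul]
    simp [PiLp.inner_apply, Matrix.toLpLin_apply, dotProduct, mul_comm]
  linarith

lemma posDef_of_posSemidef_sub {Λ : Matrix (Fin d) (Fin d) ℝ} {c : ℝ} (hc : 0 < c)
    (h : (Λ - c • (1 : Matrix (Fin d) (Fin d) ℝ)).PosSemidef) : Λ.PosDef := by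
  have := (Matrix.PosDef.one (n := Fin d) (R := ℝ)).smul hc
  simpa using this.add_posSemidef h

section Standardize

variable {A Λ : Matrix (Fin d) (Fin d) ℝ} {c : ℝ}

lemma inner_transpose_standardize (hA : A * Λ * A.transpose = 1) (t : Param d) :
    inner ℝ (Matrix.toEuclideanLin A.transpose t)
      (Matrix.toEuclideanLin Λ (Matrix.toEuclideanLin A.transpose t)) = ‖t‖ ^ 2 := by
  rw [real_inner_comm, ← inner_toEuclideanLin_transpose, real_inner_comm]
  have : Matrix.toEuclideanLin A (Matrix.toEuclideanLin Λ (Matrix.toEuclideanLin A.transpose t))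
      = t := by
    simp only [Matrix.toLpLin_apply, Matrix.mulVec_mulVec]
    rw [← Matrix.mul_assoc, hA]
    simp
  rw [this, real_inner_self_eq_norm_sq]

/-- c‖Aᵀt‖² ≤ ⟨Aᵀt, ΛAᵀt⟩ = ‖t‖². The lower bound on Λ alone controls A; no bound on M_g or V_c
enters. -/
lemma norm_transpose_standardize_le (hA : A * Λ * A.transpose = 1) (hc : 0 < c)
    (h : (Λ - c • (1 : Matrix (Fin d) (Fin d) ℝ)).PosSemidef) (t : Param d) :
    ‖Matrix.toEuclideanLin A.transpose t‖ ≤ (Real.sqrt c)⁻¹ * ‖t‖ := by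
  have h1 := le_inner_of_posSemidef_sub h (Matrix.toEuclideanLin A.transpose t)
  rw [inner_transpose_standardize hA] at h1
  have hs := Real.sqrt_pos.2 hc
  have h2 : (Real.sqrt c * ‖Matrix.toEuclideanLin A.transpose t‖) ^ 2 ≤ ‖t‖ ^ 2 := by
    rw [mul_pow, Real.sq_sqrt hc.le]
    exact h1
  have h3 := (pow_le_pow_iff_left₀ (by positivity) (norm_nonneg _) (by norm_num)).1 h2
  rw [inv_mul_eq_div, le_div_iff₀ hs, mul_comm]
  exact h3

/-- A and its transpose have the same operator norm. -/
lemma norm_standardize_le (hA : A * Λ * A.transpose = 1) (hc : 0 < c)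
    (h : (Λ - c • (1 : Matrix (Fin d) (Fin d) ℝ)).PosSemidef) (v : Param d) :
    ‖Matrix.toEuclideanLin A v‖ ≤ (Real.sqrt c)⁻¹ * ‖v‖ := by
  set u := Matrix.toEuclideanLin A v with hu
  have h1 : ‖u‖ ^ 2 ≤ ‖v‖ * ((Real.sqrt c)⁻¹ * ‖u‖) := by
    rw [← real_inner_self_eq_norm_sq]
    conv_lhs => rw [hu, inner_toEuclideanLin_transpose]
    refine (real_inner_le_norm _ _).trans ?_
    gcongr
    exact norm_transpose_standardize_le hA hc h u
  rcases (norm_nonneg u).eq_or_lt with h0 | h0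
  · rw [← h0]; positivity
  · have : ‖u‖ * ‖u‖ ≤ ((Real.sqrt c)⁻¹ * ‖v‖) * ‖u‖ := by nlinarith
    exact le_of_mul_le_mul_right this h0

end Standardize

/-- The quadratic form of `Λ_c`. -/
lemma inner_Lc {n : ℕ} (f : Param d → ℝ → ℝ) (x : Fin n → Obs) (p : Fin n → ℝ) (θ w : Param d) :
    inner ℝ w (Matrix.toEuclideanLin (Lc f x p θ) w)
      = (1 / (n : ℝ) ^ 2)
          * (∑ i with (x i).Censored, (1 / p i) * (inner ℝ (score f (x i) θ) w) ^ 2)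
        - ((1 / (n : ℝ)) * ∑ i with (x i).Censored, inner ℝ (score f (x i) θ) w) ^ 2 := by
  have hsq : ∀ s : Param d, (inner ℝ s w) ^ 2 = ∑ j, ∑ k, w j * (s j * s k) * w k := fun s => by
    rw [sq, PiLp.inner_apply, Finset.sum_mul_sum]
    refine Finset.sum_congr rfl fun j _ => Finset.sum_congr rfl fun k _ => ?_
    simp
    ring
  have h2 : (1 / (n : ℝ)) * ∑ i with (x i).Censored, inner ℝ (score f (x i) θ) w
      = inner ℝ ((1 / (n : ℝ)) • ∑ i with (x i).Censored, score f (x i) θ) w := by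
    rw [real_inner_smul_left, sum_inner]
  rw [h2, hsq, inner_toEuclideanLin]
  simp_rw [hsq]
  have h3 : (1 / (n : ℝ) ^ 2) * (∑ i with (x i).Censored, (1 / p i) *
      ∑ j, ∑ k, w j * (score f (x i) θ j * score f (x i) θ k) * w k)
      = ∑ j, ∑ k, w j * ((1 / (n : ℝ) ^ 2) * ∑ i with (x i).Censored,
        (1 / p i) * (score f (x i) θ j * score f (x i) θ k)) * w k := by
    simp_rw [Finset.mul_sum, Finset.sum_mul]
    rw [Finset.sum_comm]
    refine Finset.sum_congr rfl fun j _ => ?_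
    rw [Finset.sum_comm]
    refine Finset.sum_congr rfl fun k _ => ?_
    refine Finset.sum_congr rfl fun i _ => ?_
    ring
  rw [h3, ← Finset.sum_sub_distrib]
  refine Finset.sum_congr rfl fun j _ => ?_
  rw [← Finset.sum_sub_distrib]
  refine Finset.sum_congr rfl fun k _ => ?_
  simp only [Lc, outer, Matrix.sub_apply, Matrix.smul_apply, Matrix.sum_apply, Matrix.of_apply,
    smul_eq_mul]
  ring

/-! ### Regular data sets and the linearized likelihood equation -/

/-- A data set with subsampling probabilities `p`, full-data estimator `θh` and subsample estimator
`θs` that is regular with constants `K`, `c`, `ρ`. -/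
structure IsRegular (f : Param d → ℝ → ℝ) (Θ : Set (Param d)) (ψ : Obs → ℝ) (K c ρ : ℝ) {n : ℕ}
    (x : Fin n → Obs) (p : Fin n → ℝ) (θh : Param d) {m : ℕ} (θs : (Fin m → Fin n) → Param d) :
    Prop where
  convex : Convex ℝ Θ
  prob : IsSubsamplingProb x p
  smooth : ∀ i, ∀ θ ∈ Θ, ContDiffAt ℝ 2 (logLik f (x i)) θ
  lipschitz : ∀ i, ∀ θ₁ ∈ Θ, ∀ θ₂ ∈ Θ, ∀ j k,
    |hess f (x i) θ₁ j k - hess f (x i) θ₂ j k| ≤ ψ (x i) * ‖θ₁ - θ₂‖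
  concave : ∀ θ ∈ Θ, ∀ v, ∑ i, (1 / (n : ℝ)) * fderiv ℝ (fderiv ℝ (logLik f (x i))) θ v v
    ≤ -c * ‖v‖ ^ 2
  ball : Metric.ball θh ρ ⊆ Θ
  crit : ∑ i, score f (x i) θh = 0
  hess_sq : ∀ θ ∈ Θ, ∀ j k, (1 / (n : ℝ)) * ∑ i, hess f (x i) θ j k ^ 2 ≤ K
  lip_sq : (1 / (n : ℝ)) * ∑ i, ψ (x i) ^ 2 ≤ K
  score_four : (1 / (n : ℝ)) * ∑ i, ‖score f (x i) θh‖ ^ 4 ≤ K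
  inv_prob : maxInvProb x p ≤ K
  nondeg : (Lc f x p θh - c • (1 : Matrix (Fin d) (Fin d) ℝ)).PosSemidef
  isMax : ∀ J : Fin m → Fin n, (∀ j, (x (J j)).Censored) →
    θs J ∈ Θ ∧ IsMaxOn (subLogLik f x p J) Θ (θs J)

lemma Lc_eq_zero_of_not_censored (f : Param d → ℝ → ℝ) {n : ℕ} {x : Fin n → Obs} (p : Fin n → ℝ)
    (θ : Param d) (h : ¬ ∃ i, (x i).Censored) : Lc f x p θ = 0 := by
  have : (Finset.univ.filter fun i => (x i).Censored) = ∅ := by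
    ext i
    simp only [Finset.mem_filter, Finset.mem_univ, true_and, Finset.notMem_empty, iff_false]
    exact fun hi => h ⟨i, hi⟩
  unfold Lc
  rw [this]
  ext j k
  simp [outer]

lemma fderiv_fderiv_sum_apply_single {f : Param d → ℝ → ℝ} {n : ℕ} {x : Fin n → Obs} {θ : Param d}
    (h : ∀ i, ContDiffAt ℝ 2 (logLik f (x i)) θ) (w : Fin n → ℝ) (j k : Fin d) :
    fderiv ℝ (fderiv ℝ fun θ => ∑ i, w i * logLik f (x i) θ) θ (EuclideanSpace.single j 1)
      (EuclideanSpace.single k 1) = ∑ i, w i * hess f (x i) θ j k := by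
  rw [fderiv_fderiv_sum_mul h]
  simp [hess, sum_apply, smul_apply]

lemma fderiv_apply_eq_inner_score (f : Param d → ℝ → ℝ) (x : Obs) (θ v : Param d) :
    fderiv ℝ (logLik f x) θ v = inner ℝ (score f x θ) v := by
  unfold score gradient
  rw [InnerProductSpace.toDual_symm_apply]

lemma hess_symm {f : Param d → ℝ → ℝ} {x : Obs} {θ : Param d}
    (h : ContDiffAt ℝ 2 (logLik f x) θ) (j k : Fin d) : hess f x θ j k = hess f x θ k j := by
  have := h.isSymmSndFDerivAt (by simp)
  exact this.eq _ _

namespace IsRegular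

variable {f : Param d → ℝ → ℝ} {Θ : Set (Param d)} {ψ : Obs → ℝ} {K c ρ : ℝ} {n : ℕ}
  {x : Fin n → Obs} {p : Fin n → ℝ} {θh : Param d} {m : ℕ} {θs : (Fin m → Fin n) → Param d}

/-- With no censored observation Λ_c = 0, which cannot dominate a positive multiple of the identity
in positive dimension. Without one, `drawOne` would not be a probability measure. -/
lemma exists_censored (h : IsRegular f Θ ψ K c ρ x p θh θs) (hd : 0 < d) (hc : 0 < c) :
    ∃ i, (x i).Censored := by
  by_contra hx
  have h1 := h.nondeg
  rw [Lc_eq_zero_of_not_censored f p θh hx] at h1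
  have h2 := le_inner_of_posSemidef_sub h1 (EuclideanSpace.single ⟨0, hd⟩ 1)
  simp at h2
  linarith

lemma nonneg (h : IsRegular f Θ ψ K c ρ x p θh θs) : 0 ≤ K :=
  le_trans (mul_nonneg (by positivity) (Finset.sum_nonneg fun _ _ => sq_nonneg _)) h.lip_sq

lemma bilin_Mg (h : IsRegular f Θ ψ K c ρ x p θh θs) {θ : Param d} (hθ : θ ∈ Θ) (v w : Param d) :
    (∑ i, (1 / (n : ℝ)) • fderiv ℝ (fderiv ℝ (logLik f (x i))) θ) v w
      = inner ℝ (Matrix.toEuclideanLin (Mg f x θ) v) w := by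
  rw [bilin_eq_sum, inner_toEuclideanLin_transpose, inner_toEuclideanLin]
  refine Finset.sum_congr rfl fun j _ => Finset.sum_congr rfl fun k _ => ?_
  have : (∑ i, (1 / (n : ℝ)) • fderiv ℝ (fderiv ℝ (logLik f (x i))) θ)
      (EuclideanSpace.single j 1) (EuclideanSpace.single k 1) = Mg f x θ k j := by
    rw [← fderiv_fderiv_sum_mul (fun i => h.smooth i θ hθ) (fun _ => 1 / (n : ℝ)),
      fderiv_fderiv_sum_apply_single (fun i => h.smooth i θ hθ)]
    simp only [Mg, Matrix.smul_apply, Matrix.sum_apply, smul_eq_mul, Finset.mul_sum]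
    exact Finset.sum_congr rfl fun i _ => by rw [hess_symm (h.smooth i θ hθ)]
  rw [this, Matrix.transpose_apply]
  ring

lemma neg_Mg_posDef (h : IsRegular f Θ ψ K c ρ x p θh θs) (hc : 0 < c) {θ : Param d}
    (hθ : θ ∈ Θ) : (-Mg f x θ).PosDef := by
  refine Matrix.PosDef.of_dotProduct_mulVec_pos ?_ fun v hv => ?_
  · ext j k
    simp only [Matrix.conjTranspose_apply, Matrix.neg_apply, star_trivial, neg_inj, Mg,
      Matrix.smul_apply, Matrix.sum_apply]
    congr 1
    exact Finset.sum_congr rfl fun i _ => hess_symm (h.smooth i θ hθ) _ _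
  · have h1 := h.concave θ hθ (WithLp.toLp 2 v)
    have h2 := h.bilin_Mg hθ (WithLp.toLp 2 v) (WithLp.toLp 2 v)
    simp only [sum_apply, smul_apply, smul_eq_mul] at h2
    rw [h2] at h1
    have h3 : star v ⬝ᵥ (-Mg f x θ).mulVec v
        = -inner ℝ (Matrix.toEuclideanLin (Mg f x θ) (WithLp.toLp 2 v)) (WithLp.toLp 2 v) := by
      simp [PiLp.inner_apply, Matrix.toLpLin_apply, Matrix.neg_mulVec, dotProduct]
    have h4 : 0 < ‖(WithLp.toLp 2 v : Param d)‖ := by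
      rw [norm_pos_iff]
      intro h0
      exact hv (by simpa using h0)
    rw [h3]
    nlinarith [pow_pos h4 2]

/-- The pointwise bound y ≤ 1 + y² replaces Cauchy–Schwarz here, and again for the scores and
Hessians, at the price of an added 1. -/
lemma mean_lip_le (h : IsRegular f Θ ψ K c ρ x p θh θs) :
    (1 / (n : ℝ)) * ∑ i, ψ (x i) ≤ 1 + K := by
  rcases Nat.eq_zero_or_pos n with rfl | hn
  · have := h.nonneg
    simp; linarith
  have hn' : (0 : ℝ) < n := by exact_mod_cast hn
  have : (1 / (n : ℝ)) * ∑ i, ψ (x i) ≤ (1 / (n : ℝ)) * ∑ i, (1 + ψ (x i) ^ 2) := by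
    gcongr with i
    nlinarith [sq_nonneg (ψ (x i) - 1), sq_nonneg (ψ (x i))]
  refine this.trans ?_
  rw [Finset.sum_add_distrib, mul_add]
  simp only [Finset.sum_const, Finset.card_univ, Fintype.card_fin, nsmul_eq_mul, mul_one]
  rw [one_div_mul_cancel hn'.ne']
  linarith [h.lip_sq]

lemma mean_score_sq_le (h : IsRegular f Θ ψ K c ρ x p θh θs) (j : Fin d) :
    (1 / (n : ℝ)) * ∑ i, (score f (x i) θh j) ^ 2 ≤ 1 + K := by
  rcases Nat.eq_zero_or_pos n with rfl | hn
  · have := h.nonneg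
    simp; linarith
  have hn' : (0 : ℝ) < n := by exact_mod_cast hn
  have : (1 / (n : ℝ)) * ∑ i, (score f (x i) θh j) ^ 2
      ≤ (1 / (n : ℝ)) * ∑ i, (1 + ‖score f (x i) θh‖ ^ 4) := by
    gcongr with i
    have h1 : |score f (x i) θh j| ≤ ‖score f (x i) θh‖ := by
      simpa using PiLp.norm_apply_le (score f (x i) θh) j
    have h2 : score f (x i) θh j ^ 2 ≤ ‖score f (x i) θh‖ ^ 2 := by
      rw [← sq_abs]; gcongr
    nlinarith [sq_nonneg (‖score f (x i) θh‖ ^ 2 - 1), sq_nonneg (‖score f (x i) θh‖ ^ 2)]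
  refine this.trans ?_
  rw [Finset.sum_add_distrib, mul_add]
  simp only [Finset.sum_const, Finset.card_univ, Fintype.card_fin, nsmul_eq_mul, mul_one]
  rw [one_div_mul_cancel hn'.ne']
  linarith [h.score_four]

/-- On the event that the subsample Hessians, scores and Lipschitz constants are close to their
full-data counterparts, the subsample estimator satisfies the linearized likelihood equation. -/
lemma norm_score_add_Mg_le (h : IsRegular f Θ ψ K c ρ x p θh θs) (hn : 0 < n) (hc : 0 < c)
    (hρ : 0 < ρ)
    (T : Finset (Param d)) {mesh η s : ℝ} (hTΘ : ∀ θ ∈ T, θ ∈ Θ)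
    (hT : ∀ θ ∈ Θ, ∃ a ∈ T, ‖θ - a‖ ≤ mesh) (hmesh : d ^ 2 * ((2 + K) * mesh) ≤ c / 4)
    (hη0 : 0 ≤ η) (hη : d ^ 2 * η ≤ c / 4) (hsρ : 4 / c * (d * s) < ρ) (hs0 : 0 ≤ s)
    {J : Fin m → Fin n} (hJ : ∀ j, (x (J j)).Censored)
    (hJhess : ∀ a ∈ insert θh T, ∀ j k, |∑ i, drawWeight x p J i * hess f (x i) a j k
      - (1 / (n : ℝ)) * ∑ i, hess f (x i) a j k| ≤ η)
    (hJlip : |∑ i, drawWeight x p J i * ψ (x i) - (1 / (n : ℝ)) * ∑ i, ψ (x i)| ≤ 1)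
    (hJscore : ∀ j, |∑ i, drawWeight x p J i * score f (x i) θh j| ≤ s) :
    ‖∑ i, drawWeight x p J i • score f (x i) θh‖ ≤ d * s ∧
    ‖∑ i, drawWeight x p J i • score f (x i) θh
        + Matrix.toEuclideanLin (Mg f x θh) (θs J - θh)‖
      ≤ (d ^ 2 * η + d ^ 2 * (2 + K) * (4 / c * (d * s))) * (4 / c * (d * s)) := by
  set w := drawWeight x p J with hw
  have hw0 : ∀ i, 0 ≤ w i := drawWeight_nonneg h.prob J
  have hK := h.nonneg
  set L : Param d → ℝ := fun θ => ∑ i, w i * logLik f (x i) θ with hLdef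
  have hθh : θh ∈ Θ := h.ball (Metric.mem_ball_self hρ)
  obtain ⟨hθs, hmax⟩ := h.isMax J hJ
  have hn' : (0 : ℝ) < n := by exact_mod_cast hn
  have hmaxL : IsMaxOn L Θ (θs J) := by
    intro θ hθ
    have h1 : subLogLik f x p J θ ≤ subLogLik f x p J (θs J) := hmax hθ
    rw [subLogLik_eq_sum_drawWeight f hn hJ, subLogLik_eq_sum_drawWeight f hn hJ] at h1
    exact le_of_mul_le_mul_left h1 hn'
  have hL : ∀ θ ∈ Θ, ContDiffAt ℝ 2 L θ := fun θ hθ =>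
    contDiffAt_sum_mul (fun i => h.smooth i θ hθ) w
  set S := ∑ i, w i • score f (x i) θh with hS
  have hSnorm : ‖S‖ ≤ d * s := by
    refine euclidean_norm_le hs0 fun j => ?_
    have := hJscore j
    simpa [hS] using this
  refine ⟨hSnorm, ?_⟩
  have hDL : ∀ v, fderiv ℝ L θh v = inner ℝ S v := fun v => by
    rw [hLdef, fderiv_sum_mul fun i => (h.smooth i θh hθh).differentiableAt (by norm_num)]
    simp only [sum_apply, smul_apply, smul_eq_mul, fderiv_apply_eq_inner_score, hS, sum_inner,
      real_inner_smul_left]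
  have hDLnorm : ‖fderiv ℝ L θh‖ ≤ d * s := by
    refine ContinuousLinearMap.opNorm_le_bound _ (by positivity) fun v => ?_
    rw [hDL]
    exact (abs_real_inner_le_norm _ _).trans (by gcongr)
  have hwψ : ∑ i, w i * ψ (x i) ≤ 2 + K := by
    have := (abs_le.1 hJlip).2
    linarith [h.mean_lip_le]
  have hentry : ∀ θ₁ ∈ Θ, ∀ θ₂ ∈ Θ, ∀ j k,
      |∑ i, w i * hess f (x i) θ₁ j k - ∑ i, w i * hess f (x i) θ₂ j k|
        ≤ (2 + K) * ‖θ₁ - θ₂‖ := by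
    intro θ₁ h₁ θ₂ h₂ j k
    rw [← Finset.sum_sub_distrib]
    refine (Finset.abs_sum_le_sum_abs _ _).trans ?_
    refine le_trans ?_ (mul_le_mul_of_nonneg_right hwψ (norm_nonneg _))
    rw [Finset.sum_mul]
    refine Finset.sum_le_sum fun i _ => ?_
    rw [← mul_sub, abs_mul, abs_of_nonneg (hw0 i), mul_assoc]
    exact mul_le_mul_of_nonneg_left (h.lipschitz i θ₁ h₁ θ₂ h₂ j k) (hw0 i)
  have hlip : ∀ θ₁ ∈ Θ, ∀ θ₂ ∈ Θ, ‖fderiv ℝ (fderiv ℝ L) θ₁ - fderiv ℝ (fderiv ℝ L) θ₂‖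
      ≤ d ^ 2 * (2 + K) * ‖θ₁ - θ₂‖ := by
    intro θ₁ h₁ θ₂ h₂
    rw [mul_assoc]
    refine bilin_norm_le _ (by positivity) fun j k => ?_
    simp only [sub_apply]
    rw [hLdef, fderiv_fderiv_sum_apply_single (fun i => h.smooth i θ₁ h₁),
      fderiv_fderiv_sum_apply_single (fun i => h.smooth i θ₂ h₂)]
    exact hentry θ₁ h₁ θ₂ h₂ j k
  set H : Param d → Param d →L[ℝ] Param d →L[ℝ] ℝ := fun θ =>
    ∑ i, (1 / (n : ℝ)) • fderiv ℝ (fderiv ℝ (logLik f (x i))) θ with hH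
  have hnet : ∀ a ∈ insert θh T, ‖fderiv ℝ (fderiv ℝ L) a - H a‖ ≤ d ^ 2 * η := by
    intro a ha
    have haΘ : a ∈ Θ := by
      rcases Finset.mem_insert.1 ha with rfl | ha
      · exact hθh
      · exact hTΘ a ha
    refine bilin_norm_le _ hη0 fun j k => ?_
    simp only [sub_apply]
    rw [hLdef, fderiv_fderiv_sum_apply_single (fun i => h.smooth i a haΘ), hH]
    simp only []
    rw [← fderiv_fderiv_sum_mul (fun i => h.smooth i a haΘ) (fun _ => 1 / (n : ℝ)),
      fderiv_fderiv_sum_apply_single (fun i => h.smooth i a haΘ), ← Finset.mul_sum]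
    exact hJhess a ha j k
  -- From the full-data concavity constant c one loses c/4 in passing to the nearest net point and
  -- c/4 in passing from the subsample Hessian to the full-data one.
  have hconc : ∀ θ ∈ Θ, ∀ v, fderiv ℝ (fderiv ℝ L) θ v v ≤ -(c / 2) * ‖v‖ ^ 2 := by
    intro θ hθ v
    obtain ⟨a, haT, ha⟩ := hT θ hθ
    have haΘ := hTΘ a haT
    have h1 : ‖fderiv ℝ (fderiv ℝ L) θ - H a‖ ≤ c / 2 := by
      have e : fderiv ℝ (fderiv ℝ L) θ - H a = (fderiv ℝ (fderiv ℝ L) θ - fderiv ℝ (fderiv ℝ L) a)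
        + (fderiv ℝ (fderiv ℝ L) a - H a) := by abel
      rw [e]
      refine le_trans (norm_add_le (fderiv ℝ (fderiv ℝ L) θ - fderiv ℝ (fderiv ℝ L) a)
        (fderiv ℝ (fderiv ℝ L) a - H a)) ?_
      have h2 := hnet a (Finset.mem_insert_of_mem haT)
      have h3 := hlip θ hθ a haΘ
      have h4 : d ^ 2 * (2 + K) * ‖θ - a‖ ≤ d ^ 2 * ((2 + K) * mesh) := by
        rw [mul_assoc]; gcongr
      linarith
    have h2 : (fderiv ℝ (fderiv ℝ L) θ - H a) v v ≤ c / 2 * ‖v‖ ^ 2 := by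
      refine (Real.le_norm_self _).trans ?_
      refine (ContinuousLinearMap.le_opNorm₂ _ _ _).trans ?_
      rw [mul_assoc, sq]
      gcongr
    have h3 := h.concave a haΘ v
    have h4 : H a v v = ∑ i, (1 / (n : ℝ)) * fderiv ℝ (fderiv ℝ (logLik f (x i))) a v v := by
      simp [hH, sum_apply, smul_apply]
    simp only [sub_apply] at h2
    linarith
  have e4 : 2 / (c / 2) = 4 / c := by field_simp; norm_num
  have key := norm_fderiv_add_le_of_isMaxOn h.convex hL (c := c / 2)
    (Ψ := d ^ 2 * (2 + K)) (η := d ^ 2 * η) (s := d * s) (by positivity) (by positivity)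
    (by positivity) hconc h.ball hρ (fun θ hθ => hlip θ hθ θh hθh)
    (hnet θh (Finset.mem_insert_self _ _)) hθs hmaxL hDLnorm (by rw [e4]; exact hsρ)
  rw [e4] at key
  refine le_trans ?_ key
  -- The estimate is known for the functional that R represents; testing it on R itself transfers it
  -- to the vector.
  set R := S + Matrix.toEuclideanLin (Mg f x θh) (θs J - θh) with hR
  have hRv : ∀ v, inner ℝ R v = (fderiv ℝ L θh + H θh (θs J - θh)) v := fun v => by
    rw [hR, inner_add_left, ← h.bilin_Mg hθh, add_apply, hDL]
  have h1 : ‖R‖ * ‖R‖ ≤ ‖fderiv ℝ L θh + H θh (θs J - θh)‖ * ‖R‖ := by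
    rw [← real_inner_self_eq_norm_mul_norm, hRv]
    exact (Real.le_norm_self _).trans (ContinuousLinearMap.le_opNorm _ _)
  rcases (norm_nonneg R).eq_or_lt with h0 | h0
  · rw [← h0]; exact norm_nonneg _
  · exact le_of_mul_le_mul_right h1 h0

end IsRegular

/-! ### Exceptional draws and comparison with the linear part -/

/-- A union bound for finitely many subsample means. -/
lemma drawLaw_real_exists_le {ι : Type*} [Fintype ι] {n : ℕ} {x : Fin n → Obs} {p : Fin n → ℝ}
    {K : ℝ} [IsProbabilityMeasure (drawOne x p)] (hp : IsSubsamplingProb x p)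
    (hK : maxInvProb x p ≤ K) (hK0 : 0 ≤ K) (h : ι → Fin n → ℝ) {K' : ℝ}
    (hK' : ∀ a, (1 / (n : ℝ)) * ∑ i, h a i ^ 2 ≤ K') {m : ℕ} (hm : 0 < m) {η : ℝ} (hη : 0 < η) :
    (drawLaw x p m).real
        {J | ∃ a, η ≤ |∑ i, drawWeight x p J i * h a i - (1 / (n : ℝ)) * ∑ i, h a i|}
      ≤ Fintype.card ι * (K * K' / (m * η ^ 2)) := by
  have : {J : Fin m → Fin n |
        ∃ a, η ≤ |∑ i, drawWeight x p J i * h a i - (1 / (n : ℝ)) * ∑ i, h a i|}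
      = ⋃ a ∈ (Finset.univ : Finset ι),
        {J | η ≤ |∑ i, drawWeight x p J i * h a i - (1 / (n : ℝ)) * ∑ i, h a i|} := by
    ext J; simp
  rw [this]
  refine (measureReal_biUnion_finset_le _ _).trans ?_
  have hm' : (0 : ℝ) < m := by exact_mod_cast hm
  refine (Finset.sum_le_sum (g := fun _ => K * K' / (m * η ^ 2)) fun a _ => ?_).trans ?_
  · refine (drawLaw_real_ge_le hp hK hK0 (h a) hm hη).trans ?_
    have := hK' a
    gcongr
  · simp

/-- The standardizing matrix `V_c^{-1/2} M_g⁻¹`. -/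
noncomputable def stdMatrix (f : Param d → ℝ → ℝ) {n : ℕ} (x : Fin n → Obs) (p : Fin n → ℝ)
    (θ : Param d) : Matrix (Fin d) (Fin d) ℝ :=
  invSqrt (Vc f x p θ) * (Mg f x θ)⁻¹

/-- The index sets of draws for which the subsample Hessians, Lipschitz constants and scores are
close to their full-data counterparts. -/
def goodDraws (f : Param d → ℝ → ℝ) (ψ : Obs → ℝ) {n : ℕ} (x : Fin n → Obs) (p : Fin n → ℝ)
    (θh : Param d) (T : Finset (Param d)) (η s : ℝ) (m : ℕ) : Set (Fin m → Fin n) :=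
  {J | (∀ j, (x (J j)).Censored) ∧
    (∀ a ∈ insert θh T, ∀ j k, |∑ i, drawWeight x p J i * hess f (x i) a j k
      - (1 / (n : ℝ)) * ∑ i, hess f (x i) a j k| ≤ η) ∧
    |∑ i, drawWeight x p J i * ψ (x i) - (1 / (n : ℝ)) * ∑ i, ψ (x i)| ≤ 1 ∧
    ∀ j, |∑ i, drawWeight x p J i * score f (x i) θh j| ≤ s}

namespace IsRegular

variable {f : Param d → ℝ → ℝ} {Θ : Set (Param d)} {ψ : Obs → ℝ} {K c ρ : ℝ} {n : ℕ}
  {x : Fin n → Obs} {p : Fin n → ℝ} {θh : Param d} {m : ℕ} {θs : (Fin m → Fin n) → Param d}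

lemma stdMatrix_mul (h : IsRegular f Θ ψ K c ρ x p θh θs) (hc : 0 < c) (hρ : 0 < ρ) :
    stdMatrix f x p θh * Lc f x p θh * (stdMatrix f x p θh).transpose = 1 :=
  standardize_mul (h.neg_Mg_posDef hc (h.ball (Metric.mem_ball_self hρ)))
    (posDef_of_posSemidef_sub hc h.nondeg)

/-- With v = θ̃ - θ̂ and V_c^{-1/2} = A M_g, the difference equals A(√r (S + M_g v) - (√r - √m) S),
and A has norm at most c^{-1/2}. The first term is the linearization error, the second the cost of
normalizing by √r although only m draws are random. -/
lemma norm_normalizedError_sub_le (h : IsRegular f Θ ψ K c ρ x p θh θs) (hc : 0 < c)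
    (hρ : 0 < ρ) {r : ℕ} (hmr : m ≤ r) (J : Fin m → Fin n) :
    ‖normalizedError f x p r θh (θs J) - Real.sqrt m • ∑ i, drawWeight x p J i •
        (-Matrix.toEuclideanLin (stdMatrix f x p θh) (score f (x i) θh))‖
      ≤ (Real.sqrt c)⁻¹ * (Real.sqrt r * ‖∑ i, drawWeight x p J i • score f (x i) θh
          + Matrix.toEuclideanLin (Mg f x θh) (θs J - θh)‖
        + (Real.sqrt r - Real.sqrt m) * ‖∑ i, drawWeight x p J i • score f (x i) θh‖) := by
  set A := stdMatrix f x p θh with hA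
  set S := ∑ i, drawWeight x p J i • score f (x i) θh with hS
  set v := θs J - θh with hv
  have hMu : IsUnit (Mg f x θh) := by
    simpa using (h.neg_Mg_posDef hc (h.ball (Metric.mem_ball_self hρ))).isUnit
  have hQ : Matrix.toEuclideanLin (invSqrt (Vc f x p θh)) v
      = Matrix.toEuclideanLin A (Matrix.toEuclideanLin (Mg f x θh) v) := by
    simp only [Matrix.toLpLin_apply, Matrix.mulVec_mulVec, hA, stdMatrix]
    rw [Matrix.mul_assoc, Matrix.nonsing_inv_mul _ ((Matrix.isUnit_iff_isUnit_det _).1 hMu),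
      Matrix.mul_one]
  have hW : ∑ i, drawWeight x p J i • (-Matrix.toEuclideanLin A (score f (x i) θh))
      = -Matrix.toEuclideanLin A S := by
    rw [hS, map_sum, ← Finset.sum_neg_distrib]
    exact Finset.sum_congr rfl fun i _ => by rw [map_smul, smul_neg]
  have e : normalizedError f x p r θh (θs J) - Real.sqrt m • ∑ i, drawWeight x p J i •
        (-Matrix.toEuclideanLin A (score f (x i) θh))
      = Matrix.toEuclideanLin A (Real.sqrt r • (S + Matrix.toEuclideanLin (Mg f x θh) v)
        - (Real.sqrt r - Real.sqrt m) • S) := by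
    rw [hW]
    unfold normalizedError
    rw [← hv, hQ]
    generalize Matrix.toEuclideanLin (Mg f x θh) v = u
    simp only [map_sub, map_smul, map_add]
    module
  rw [e]
  refine (norm_standardize_le (h.stdMatrix_mul hc hρ) hc h.nondeg _).trans ?_
  have hsq : 0 ≤ Real.sqrt r - Real.sqrt m := by
    rw [sub_nonneg]
    exact Real.sqrt_le_sqrt (by exact_mod_cast hmr)
  refine mul_le_mul_of_nonneg_left ((norm_sub_le _ _).trans (le_of_eq ?_)) (by positivity)
  rw [norm_smul, norm_smul, Real.norm_of_nonneg (Real.sqrt_nonneg _), Real.norm_of_nonneg hsq]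

/-- Chebyshev and a union bound. A Hessian deviation of β² has probability at most K²/(mβ⁴) ≤ K²β⁴
because β⁸m ≥ 1. A score deviation of 1/(β√m), a large multiple of the natural scale when β is
small, has probability of order β². -/
lemma drawLaw_real_compl_goodDraws_le (h : IsRegular f Θ ψ K c ρ x p θh θs) (hd : 0 < d)
    (hc : 0 < c) (hρ : 0 < ρ) (T : Finset (Param d)) (hTΘ : ∀ θ ∈ T, θ ∈ Θ) (hm : 0 < m) {β : ℝ}
    (hβ0 : 0 < β) (hβ1 : β ≤ 1) (hβm : 1 ≤ β ^ 8 * m) :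
    (drawLaw x p m).real
        (goodDraws f ψ x p θh T (β ^ 2) (1 / (β * Real.sqrt m)) m)ᶜ
      ≤ ((T.card + 1) * d ^ 2 * (K * K) + K * K + d * (K * (1 + K))) * β ^ 2 := by
  have hK := h.nonneg
  have hm' : (0 : ℝ) < m := by exact_mod_cast hm
  have hθh : θh ∈ Θ := h.ball (Metric.mem_ball_self hρ)
  have hprob := isProbabilityMeasure_drawOne h.prob (h.exists_censored hd hc)
  have hminv : 1 / (m : ℝ) ≤ β ^ 8 := by rw [div_le_iff₀ hm']; exact hβm
  have hTi : ∀ a ∈ insert θh T, a ∈ Θ := by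
    intro a ha
    rcases Finset.mem_insert.1 ha with rfl | ha
    · exact hθh
    · exact hTΘ a ha
  have b1 := drawLaw_real_exists_le (ι := {a // a ∈ insert θh T} × Fin d × Fin d) h.prob
    h.inv_prob hK (fun a i => hess f (x i) a.1 a.2.1 a.2.2)
    (fun a => h.hess_sq a.1 (hTi _ a.1.2) a.2.1 a.2.2) hm (η := β ^ 2) (by positivity)
  have b2 := drawLaw_real_exists_le (ι := Unit) h.prob
    h.inv_prob hK (fun _ i => ψ (x i)) (fun _ => h.lip_sq) hm (η := 1) (by positivity)
  have b3 := drawLaw_real_exists_le (ι := Fin d) h.prob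
    h.inv_prob hK (fun j i => score f (x i) θh j) (fun j => h.mean_score_sq_le j) hm
    (η := 1 / (β * Real.sqrt m)) (by positivity)
  have hsc : ∀ j, ∑ i, score f (x i) θh j = 0 := fun j => by
    have := congrArg (fun v : Param d => v j) h.crit
    simpa using this
  -- By the likelihood equation the full-data score mean is zero, so the deviation is the weighted
  -- score itself.
  simp_rw [hsc, mul_zero, sub_zero] at b3
  set B1 := {J : Fin m → Fin n | ∃ a : {a // a ∈ insert θh T} × Fin d × Fin d, β ^ 2 ≤
    |∑ i, drawWeight x p J i * hess f (x i) a.1 a.2.1 a.2.2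
      - (1 / (n : ℝ)) * ∑ i, hess f (x i) a.1 a.2.1 a.2.2|}
  set B2 := {J : Fin m → Fin n | ∃ _ : Unit, 1 ≤
    |∑ i, drawWeight x p J i * ψ (x i) - (1 / (n : ℝ)) * ∑ i, ψ (x i)|}
  set B3 := {J : Fin m → Fin n | ∃ j, 1 / (β * Real.sqrt m) ≤
    |∑ i, drawWeight x p J i * score f (x i) θh j|}
  have hprobL : IsProbabilityMeasure (drawLaw x p m) := by unfold drawLaw; infer_instance
  have hsub : (drawLaw x p m).real
        (goodDraws f ψ x p θh T (β ^ 2) (1 / (β * Real.sqrt m)) m)ᶜ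
      ≤ (drawLaw x p m).real (B1 ∪ B2 ∪ B3) := by
    rw [measureReal_def, measureReal_def]
    refine ENNReal.toReal_mono (measure_ne_top _ _) (measure_mono_ae ?_)
    filter_upwards [ae_drawLaw_censored (x := x) (p := p) m] with J hJ hJb
    by_contra hcon
    have hcon : J ∉ B1 ∪ B2 ∪ B3 := hcon
    simp only [Set.mem_union, not_or] at hcon
    refine hJb ⟨hJ, fun a ha j k => ?_, ?_, fun j => ?_⟩
    · by_contra hh
      exact hcon.1.1 ⟨(⟨a, ha⟩, j, k), (not_le.1 hh).le⟩
    · by_contra hh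
      exact hcon.1.2 ⟨(), (not_le.1 hh).le⟩
    · by_contra hh
      exact hcon.2 ⟨j, (not_le.1 hh).le⟩
  have hu1 := measureReal_union_le (μ := drawLaw x p m) (B1 ∪ B2) B3
  have hu2 := measureReal_union_le (μ := drawLaw x p m) B1 B2
  have hβ2 : β ^ 2 ≤ 1 := pow_le_one₀ hβ0.le hβ1
  have hβ4 : β ^ 4 ≤ β ^ 2 := pow_le_pow_of_le_one hβ0.le hβ1 (by norm_num)
  have hβ8 : β ^ 8 ≤ β ^ 2 := pow_le_pow_of_le_one hβ0.le hβ1 (by norm_num)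
  have c1 : (drawLaw x p m).real B1 ≤ (T.card + 1) * d ^ 2 * (K * K) * β ^ 2 := by
    refine b1.trans ?_
    have hcard : (Fintype.card ({a // a ∈ insert θh T} × Fin d × Fin d) : ℝ)
        ≤ (T.card + 1) * d ^ 2 := by
      rw [Fintype.card_prod, Fintype.card_prod, Fintype.card_fin, Fintype.card_coe]
      push_cast
      rw [sq]
      gcongr
      exact_mod_cast Finset.card_insert_le _ _
    have h1 : K * K / (m * (β ^ 2) ^ 2) ≤ K * K * β ^ 2 := by
      have : K * K / (m * (β ^ 2) ^ 2) = K * K * ((1 / m) / β ^ 4) := by field_simp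
      rw [this]
      gcongr
      refine le_trans ?_ hβ4
      rw [div_le_iff₀ (by positivity)]
      calc _ ≤ _ := hminv
        _ = _ := by ring
    calc _ ≤ ((T.card + 1) * d ^ 2 : ℝ) * (K * K * β ^ 2) := by gcongr
      _ = _ := by ring
  have c2 : (drawLaw x p m).real B2 ≤ K * K * β ^ 2 := by
    refine b2.trans ?_
    simp only [Fintype.card_unit, Nat.cast_one, one_mul, one_pow, mul_one]
    rw [div_eq_mul_one_div]
    gcongr
    exact hminv.trans hβ8
  have c3 : (drawLaw x p m).real B3 ≤ d * (K * (1 + K)) * β ^ 2 := by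
    refine b3.trans (le_of_eq ?_)
    rw [Fintype.card_fin, div_pow, mul_pow, Real.sq_sqrt hm'.le]
    field_simp
  linarith

end IsRegular

/-! ### The conditional limit theorem for regular data sets, and its uniformity -/

lemma exists_finset_net {Θ : Set (Param d)} (hΘ : IsCompact Θ) {ε : ℝ} (hε : 0 < ε) :
    ∃ T : Finset (Param d), (∀ θ ∈ T, θ ∈ Θ) ∧ ∀ θ ∈ Θ, ∃ a ∈ T, ‖θ - a‖ ≤ ε := by
  obtain ⟨t, ht, hfin, hcov⟩ := hΘ.finite_cover_balls hε
  refine ⟨hfin.toFinset, fun θ hθ => ht (by simpa using hθ), fun θ hθ => ?_⟩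
  obtain ⟨a, ha, hθa⟩ := Set.mem_iUnion₂.1 (hcov hθ)
  refine ⟨a, by simpa using ha, ?_⟩
  rw [Metric.mem_ball, dist_eq_norm] at hθa
  exact hθa.le

/-- Conditional asymptotic normality along a sequence of regular data sets. -/
theorem tendsto_integral_of_isRegular (hd : 0 < d) {f : Param d → ℝ → ℝ} {Θ : Set (Param d)}
    (hΘ : IsCompact Θ) {ψ : Obs → ℝ} {K c ρ : ℝ} (hc : 0 < c) (hρ : 0 < ρ) {n m r : ℕ → ℕ}
    {x : ∀ q, Fin (n q) → Obs} {p : ∀ q, Fin (n q) → ℝ} {θh : ℕ → Param d}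
    {θs : ∀ q, (Fin (m q) → Fin (n q)) → Param d}
    (h : ∀ q, IsRegular f Θ ψ K c ρ (x q) (p q) (θh q) (θs q))
    (hm0 : ∀ q, 0 < m q) (hm : Tendsto m atTop atTop) (hmr : ∀ q, m q ≤ r q)
    (hrm : Tendsto (fun q => (r q : ℝ) / m q) atTop (𝓝 1))
    (g : BoundedContinuousFunction (Param d) ℝ) :
    Tendsto (fun q => ∫ J, g (normalizedError f (x q) (p q) (r q) (θh q) (θs q J))
      ∂(drawLaw (x q) (p q) (m q))) atTop (𝓝 (∫ z, g z ∂(stdGaussian (Param d)))) := by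
  have hK : 0 ≤ K := (h 0).nonneg
  have hC : ∀ q, ∃ i, (x q i).Censored := fun q => (h q).exists_censored hd hc
  have hn : ∀ q, 0 < n q := fun q => (hC q).choose.pos
  have hprob : ∀ q, IsProbabilityMeasure (drawOne (x q) (p q)) := fun q =>
    isProbabilityMeasure_drawOne (h q).prob (hC q)
  have hprobL : ∀ q, IsProbabilityMeasure (drawLaw (x q) (p q) (m q)) := fun q => by
    unfold drawLaw; infer_instance
  have hmR : Tendsto (fun q => (m q : ℝ)) atTop atTop := tendsto_natCast_atTop_atTop.comp hm
  have hmpos : ∀ q, (0 : ℝ) < m q := fun q => by exact_mod_cast hm0 q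
  set A := fun q => stdMatrix f (x q) (p q) (θh q) with hA
  have hAmul : ∀ q, A q * Lc f (x q) (p q) (θh q) * (A q).transpose = 1 := fun q =>
    (h q).stdMatrix_mul hc hρ
  set b : ∀ q, Fin (n q) → Param d := fun q i =>
    -Matrix.toEuclideanLin (A q) (score f (x q i) (θh q)) with hb
  set W : ∀ q, (Fin (m q) → Fin (n q)) → Param d := fun q J =>
    Real.sqrt (m q) • ∑ i, drawWeight (x q) (p q) J i • b q i with hW
  have hsc := Real.sqrt_pos.2 hc
  -- the central limit theorem for the linear part
  set K1 := max K (((Real.sqrt c)⁻¹) ^ 4 * K) with hK1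
  have hclt := tendsto_integral_exp_drawLaw x p (fun q => (h q).prob) hC hm hm0 (K := K1)
    (hK.trans (le_max_left _ _)) (fun q => (h q).inv_prob.trans (le_max_left _ _)) b
    (fun q => by
      simp only [hb, Finset.sum_neg_distrib, ← map_sum, (h q).crit, map_zero, neg_zero])
    (fun q t => by
      simp only [hb, inner_neg_left, neg_sq, Finset.sum_neg_distrib, mul_neg,
        inner_toEuclideanLin_transpose]
      rw [← inner_Lc f (x q) (p q) (θh q), inner_transpose_standardize (hAmul q)])
    (fun q => by
      refine le_trans ?_ (le_max_right K _)
      refine le_trans ?_ (mul_le_mul_of_nonneg_left (h q).score_four (by positivity))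
      rw [mul_left_comm]
      refine mul_le_mul_of_nonneg_left ?_ (by positivity)
      rw [Finset.mul_sum]
      refine Finset.sum_le_sum fun i _ => ?_
      simp only [hb, norm_neg]
      rw [← mul_pow]
      gcongr
      exact norm_standardize_le (hAmul q) hc (h q).nondeg _)
  -- a rate
  set ε : ℕ → ℝ := fun q => Real.sqrt (r q / m q) - 1 with hε
  have hε0 : ∀ q, 0 ≤ ε q := fun q => by
    have : (1 : ℝ) ≤ r q / m q := by
      rw [le_div_iff₀ (hmpos q), one_mul]
      exact_mod_cast hmr q
    have := Real.one_le_sqrt.2 this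
    simp only [hε]
    linarith
  have hεlim : Tendsto ε atTop (𝓝 0) := by
    have := (Real.continuous_sqrt.tendsto 1).comp hrm
    simpa [hε] using this.sub_const 1
  -- With √r = (1 + ε)√m, the choice β² = ε + m^{-1/4} gives the three properties used below: β → 0,
  -- ε ≤ β² and β⁸m ≥ 1.
  set β : ℕ → ℝ := fun q => Real.sqrt (ε q + (Real.sqrt (Real.sqrt (m q)))⁻¹) with hβ
  have hβpos : ∀ q, 0 < β q := fun q => by
    have := hmpos q
    have := hε0 q
    exact Real.sqrt_pos.2 (by positivity)
  have hβsq : ∀ q, β q ^ 2 = ε q + (Real.sqrt (Real.sqrt (m q)))⁻¹ := fun q =>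
    Real.sq_sqrt (by have := hε0 q; positivity)
  have hβε : ∀ q, ε q ≤ β q ^ 2 := fun q => by
    rw [hβsq]
    have : 0 ≤ (Real.sqrt (Real.sqrt (m q)))⁻¹ := by positivity
    linarith
  have hβm : ∀ q, 1 ≤ β q ^ 8 * m q := fun q => by
    have h1 : (Real.sqrt (Real.sqrt (m q)))⁻¹ ≤ β q ^ 2 := by
      rw [hβsq]; linarith [hε0 q]
    have h2 : ((Real.sqrt (Real.sqrt (m q)))⁻¹) ^ 4 ≤ (β q ^ 2) ^ 4 := by gcongr
    have h3 : (Real.sqrt (Real.sqrt (m q))) ^ 4 = m q := by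
      rw [show (4 : ℕ) = 2 * 2 by norm_num, pow_mul, Real.sq_sqrt (Real.sqrt_nonneg _),
        Real.sq_sqrt (hmpos q).le]
    rw [inv_pow, h3, ← pow_mul] at h2
    calc (1 : ℝ) = (m q : ℝ)⁻¹ * m q := (inv_mul_cancel₀ (hmpos q).ne').symm
      _ ≤ _ := by have := hmpos q; gcongr
  have hβlim : Tendsto β atTop (𝓝 0) := by
    have h1 : Tendsto (fun q => (Real.sqrt (Real.sqrt (m q)))⁻¹) atTop (𝓝 0) :=
      ((Real.tendsto_sqrt_atTop.comp (Real.tendsto_sqrt_atTop.comp hmR))).inv_tendsto_atTop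
    have h2 := (Real.continuous_sqrt.tendsto _).comp (hεlim.add h1)
    simpa [Function.comp_def] using h2
  -- the net
  obtain ⟨T, hTΘ, hT⟩ := exists_finset_net hΘ (ε := c / 4 / (d ^ 2 * (2 + K))) (by positivity)
  have hmesh : (d : ℝ) ^ 2 * ((2 + K) * (c / 4 / (d ^ 2 * (2 + K)))) ≤ c / 4 := by
    refine le_of_eq ?_
    field_simp
  set D : ℝ := 4 / c * d with hD
  have hD0 : 0 ≤ D := by positivity
  -- the remainder bound
  set rem : ℕ → ℝ := fun q => (Real.sqrt c)⁻¹ *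
    ((1 + ε q) * ((d ^ 2 * β q + d ^ 2 * (2 + K) * D * β q ^ 2) * D) + d * β q) with hrem
  have hremlim : Tendsto rem atTop (𝓝 0) := by
    have h1 : Tendsto (fun q => (d ^ 2 * β q + d ^ 2 * (2 + K) * D * β q ^ 2) * D) atTop
        (𝓝 ((d ^ 2 * 0 + d ^ 2 * (2 + K) * D * 0 ^ 2) * D)) :=
      ((hβlim.const_mul _).add ((hβlim.pow 2).const_mul _)).mul_const _
    have h2 := (((hεlim.const_add 1).mul h1).add (hβlim.const_mul (d : ℝ))).const_mul
      (Real.sqrt c)⁻¹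
    simpa [hrem] using h2
  refine tendsto_integral_of_tendsto_integral_exp (fun q => drawLaw (x q) (p q) (m q))
    (fun q J => normalizedError f (x q) (p q) (r q) (θh q) (θs q J)) W hclt (fun δ hδ => ?_) g
  set C : ℝ := (T.card + 1) * d ^ 2 * (K * K) + K * K + d * (K * (1 + K)) with hCdef
  have hlim : Tendsto (fun q => C * β q ^ 2) atTop (𝓝 0) := by
    simpa using (hβlim.pow 2).const_mul C
  refine squeeze_zero' (Eventually.of_forall fun q => measureReal_nonneg) ?_ hlim
  have ev1 : ∀ᶠ q in atTop, d ^ 2 * β q ^ 2 < c / 4 := by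
    have : Tendsto (fun q => d ^ 2 * β q ^ 2) atTop (𝓝 0) := by
      simpa using (hβlim.pow 2).const_mul ((d : ℝ) ^ 2)
    exact this.eventually_lt_const (by positivity)
  have ev2 : ∀ᶠ q in atTop, D * β q ^ 3 < ρ := by
    have : Tendsto (fun q => D * β q ^ 3) atTop (𝓝 0) := by
      simpa using (hβlim.pow 3).const_mul D
    exact this.eventually_lt_const hρ
  filter_upwards [ev1, ev2, hβlim.eventually_lt_const one_pos, hremlim.eventually_lt_const hδ] with
    q h1 h2 h3 h4
  refine le_trans ?_ ((h q).drawLaw_real_compl_goodDraws_le hd hc hρ T hTΘ (hm0 q) (hβpos q) h3.le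
    (hβm q))
  refine measureReal_mono fun J hJ hgood => ?_
  obtain ⟨g1, g2, g3, g4⟩ := hgood
  have hmq := hmpos q
  have hsm := Real.sqrt_pos.2 hmq
  have hβq := hβpos q
  -- Equivalent to m^{-1/2} ≤ β⁴, the square root of β⁸m ≥ 1.
  have hs0 : 1 / (β q * Real.sqrt (m q)) ≤ β q ^ 3 := by
    rw [div_le_iff₀ (by positivity)]
    have : 1 ≤ β q ^ 4 * Real.sqrt (m q) := by
      have e : (β q ^ 4 * Real.sqrt (m q)) ^ 2 = β q ^ 8 * m q := by
        rw [mul_pow, Real.sq_sqrt hmq.le]; ring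
      have h5 : (1 : ℝ) ^ 2 ≤ (β q ^ 4 * Real.sqrt (m q)) ^ 2 := by
        rw [e, one_pow]; exact hβm q
      exact (pow_le_pow_iff_left₀ zero_le_one (by positivity) (by norm_num)).1 h5
    linarith [this]
  set s := 1 / (β q * Real.sqrt (m q)) with hs
  have hs00 : 0 ≤ s := by positivity
  obtain ⟨k1, k2⟩ := (h q).norm_score_add_Mg_le (hn q) hc hρ T hTΘ hT hmesh (by positivity) h1.le
    (s := s) (by
      refine lt_of_le_of_lt ?_ h2
      rw [← mul_assoc]
      gcongr) hs00 g1 g2 g3 g4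
  have hYW := (h q).norm_normalizedError_sub_le hc hρ (hmr q) J
  have hsr : Real.sqrt (r q) = (1 + ε q) * Real.sqrt (m q) := by
    simp only [hε]
    rw [add_sub_cancel, Real.sqrt_div (by positivity), div_mul_cancel₀ _ hsm.ne']
  have hsmul : Real.sqrt (m q) * s = 1 / β q := by
    rw [hs]; field_simp
  -- A good draw has deviation at most `rem q` < δ, so every draw with a larger deviation is among
  -- those already counted.
  refine absurd (lt_of_lt_of_le hJ (hYW.trans ?_)) (not_lt.2 h4.le)
  simp only [hrem]
  refine mul_le_mul_of_nonneg_left ?_ (by positivity)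
  have hεq := hε0 q
  refine add_le_add ?_ ?_
  · rw [hsr, mul_assoc]
    refine mul_le_mul_of_nonneg_left ?_ (by positivity)
    -- Since √m · s = 1/β, one power of β is lost; the tolerance β² for the Hessians and the bound s
    -- ≤ β³ leave terms of order β and β².
    calc Real.sqrt (m q) * _ ≤ Real.sqrt (m q) * ((d ^ 2 * β q ^ 2 + d ^ 2 * (2 + K)
          * (4 / c * (d * s))) * (4 / c * (d * s))) := by gcongr
      _ = (d ^ 2 * β q ^ 2 + d ^ 2 * (2 + K) * D * s) * D * (Real.sqrt (m q) * s) := by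
          rw [hD]; ring
      _ ≤ (d ^ 2 * β q ^ 2 + d ^ 2 * (2 + K) * D * β q ^ 3) * D * (Real.sqrt (m q) * s) := by
          gcongr
      _ = _ := by rw [hsmul]; field_simp
  · have e : Real.sqrt (r q) - Real.sqrt (m q) = ε q * Real.sqrt (m q) := by rw [hsr]; ring
    rw [e]
    calc ε q * Real.sqrt (m q) * _ ≤ β q ^ 2 * Real.sqrt (m q) * (d * s) := by
          have := hβε q
          gcongr
      _ = β q ^ 2 * d * (Real.sqrt (m q) * s) := by ring
      _ = _ := by rw [hsmul]; field_simp

/-- The regularity of the subsample experiment bounds the conditional expectation uniformly. -/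
lemma exists_forall_isRegular (hd : 0 < d) {f : Param d → ℝ → ℝ} {Θ : Set (Param d)}
    (hΘ : IsCompact Θ) {ψ : Obs → ℝ} {K c ρ : ℝ} (hc : 0 < c) (hρ : 0 < ρ)
    (g : BoundedContinuousFunction (Param d) ℝ) {ε : ℝ} (hε : 0 < ε) :
    ∃ η : ℝ, 0 < η ∧ ∀ (n : ℕ) (x : Fin n → Obs) (p : Fin n → ℝ) (θh : Param d) (r : ℕ)
      (θs : (Fin (r - numUncensored x) → Fin n) → Param d),
      IsRegular f Θ ψ K c ρ x p θh θs → (numUncensored x : ℝ) / r < η → 1 / η ≤ r →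
      |∫ J, g (normalizedError f x p r θh (θs J)) ∂(drawLaw x p (r - numUncensored x))
        - ∫ z, g z ∂(stdGaussian (Param d))| < ε := by
  -- If no η worked, counterexamples for η = 1/(q + 2) would form a sequence of regular data sets
  -- violating the sequential theorem.
  by_contra! hcon
  have hcon' : ∀ q : ℕ, _ := fun q => hcon (1 / (q + 2)) (by positivity)
  choose n x p θh r θs hreg hn0 hr hfar using hcon'
  have hr' : ∀ q : ℕ, (q : ℝ) + 2 ≤ r q := fun q => by
    have := hr q
    rwa [one_div_one_div] at this
  have hrpos : ∀ q, (0 : ℝ) < r q := fun q => by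
    have := hr' q
    have : (0 : ℝ) ≤ q := by positivity
    linarith [hr' q]
  -- The shift by 2 gives n₀ ≤ r/2, so the truncated subtraction r - n₀ is a genuine one and m ≥
  -- r/2.
  have hlt : ∀ q, (numUncensored (x q) : ℝ) ≤ r q / 2 := fun q => by
    have h1 := hn0 q
    rw [div_lt_iff₀ (hrpos q)] at h1
    have h2 : 1 / ((q : ℝ) + 2) ≤ 1 / 2 := by
      apply one_div_le_one_div_of_le two_pos
      have : (0 : ℝ) ≤ q := by positivity
      linarith
    nlinarith [hrpos q]
  set m : ℕ → ℕ := fun q => r q - numUncensored (x q) with hm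
  have hle : ∀ q, numUncensored (x q) ≤ r q := fun q => by
    have h1 := hlt q
    have h2 := hrpos q
    have : (numUncensored (x q) : ℝ) ≤ r q := by linarith
    exact_mod_cast this
  have hmcast : ∀ q, (m q : ℝ) = r q - numUncensored (x q) := fun q => by
    simp only [hm]; rw [Nat.cast_sub (hle q)]
  have hmge : ∀ q, (r q : ℝ) / 2 ≤ m q := fun q => by rw [hmcast]; linarith [hlt q]
  have hm0 : ∀ q, 0 < m q := fun q => by
    have h1 := hmge q
    have h2 := hrpos q
    have : (0 : ℝ) < m q := by linarith
    exact_mod_cast this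
  have hqlim : Tendsto (fun q : ℕ => (q : ℝ)) atTop atTop := tendsto_natCast_atTop_atTop
  have hmlim : Tendsto m atTop atTop := by
    refine tendsto_natCast_atTop_iff (R := ℝ).1 ?_
    refine tendsto_atTop_mono (f := fun q : ℕ => (q : ℝ) / 2) (fun q => ?_)
      (hqlim.atTop_div_const two_pos)
    have := hmge q
    have := hr' q
    linarith
  have hratio : Tendsto (fun q => (r q : ℝ) / m q) atTop (𝓝 1) := by
    have h1 : Tendsto (fun q => (numUncensored (x q) : ℝ) / r q) atTop (𝓝 0) := by
      refine squeeze_zero (fun q => by positivity) (fun q => (hn0 q).le) ?_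
      exact tendsto_const_nhds.div_atTop (tendsto_atTop_add_const_right _ _ hqlim)
    have h2 : Tendsto (fun q => (1 - (numUncensored (x q) : ℝ) / r q)⁻¹) atTop (𝓝 1) := by
      have := (h1.const_sub 1).inv₀ (by norm_num)
      simpa using this
    refine h2.congr fun q => ?_
    have h3 := hrpos q
    rw [hmcast, one_sub_div h3.ne', inv_div]
  have key := tendsto_integral_of_isRegular hd hΘ hc hρ hreg hm0 hmlim
    (fun q => Nat.sub_le _ _) hratio g
  obtain ⟨N, hN⟩ := Metric.tendsto_atTop.1 key ε hε
  have := hN N le_rfl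
  rw [Real.dist_eq] at this
  exact absurd (hfar N) (not_le.2 this)

/-! ### Weak laws for empirical means -/

section LawOfLargeNumbers

variable {P : Measure Obs} {Ω : Type*} [MeasurableSpace Ω] {μ : Measure Ω}
  [IsProbabilityMeasure μ] {X : ℕ → Ω → Obs}

/-- Weak law of large numbers along a sequence of sample sizes. -/
lemma tendsto_measure_mean_sub_ge (hXm : ∀ i, Measurable (X i)) (hXlaw : ∀ i, μ.map (X i) = P)
    (hXindep : iIndepFun X μ) {n : ℕ → ℕ} (hn : Tendsto n atTop atTop) {h : Obs → ℝ}
    (hint : Integrable h P) {η : ℝ} (hη : 0 < η) :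
    Tendsto (fun k => μ {ω | η ≤ |(1 / (n k : ℝ)) * ∑ i, h (data X (n k) ω i) - ∫ x, h x ∂P|})
      atTop (𝓝 0) := by
  -- h is only almost everywhere measurable; a measurable version keeps the variables h'(X_i)
  -- measurable and independent, and almost surely agrees with h along the whole sequence.
  set h' := hint.1.mk h with hh'
  have hmeas : Measurable h' := hint.1.stronglyMeasurable_mk.measurable
  have hae : h =ᵐ[P] h' := hint.1.ae_eq_mk
  have hint' : Integrable h' P := hint.congr hae
  have hall : ∀ᵐ ω ∂μ, ∀ i, h (X i ω) = h' (X i ω) := by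
    rw [ae_all_iff]
    intro i
    have h1 : ∀ᵐ y ∂(μ.map (X i)), h y = h' y := by rw [hXlaw]; exact hae
    exact ae_of_ae_map (hXm i).aemeasurable h1
  have hslln := strong_law_ae_real (μ := μ) (fun i ω => h' (X i ω))
    (by
      have : Integrable h' (μ.map (X 0)) := by rwa [hXlaw]
      exact this.comp_measurable (hXm 0))
    (fun i j hij => (hXindep.indepFun hij).comp hmeas hmeas)
    (fun i => by
      have : IdentDistrib (X i) (X 0) μ μ :=
        ⟨(hXm i).aemeasurable, (hXm 0).aemeasurable, by rw [hXlaw, hXlaw]⟩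
      exact this.comp hmeas)
  have hexp : ∫ ω, h' (X 0 ω) ∂μ = ∫ x, h x ∂P := by
    rw [integral_congr_ae hae, ← hXlaw 0, integral_map (hXm 0).aemeasurable]
    exact hmeas.aestronglyMeasurable
  rw [hexp] at hslln
  have htim := tendstoInMeasure_of_tendsto_ae (μ := μ)
    (f := fun k ω => (∑ i ∈ Finset.range (n k), h' (X i ω)) / (n k : ℝ))
    (g := fun _ => ∫ x, h x ∂P)
    (fun k => by
      refine Measurable.aestronglyMeasurable ?_
      exact (Finset.measurable_fun_sum _ fun i _ => hmeas.comp (hXm i)).div_const _)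
    (by
      filter_upwards [hslln] with ω hω
      exact hω.comp hn)
  rw [tendstoInMeasure_iff_dist] at htim
  refine tendsto_of_tendsto_of_tendsto_of_le_of_le tendsto_const_nhds (htim η hη)
    (fun _ => zero_le) fun k => ?_
  refine measure_mono_ae ?_
  filter_upwards [hall] with ω hω hmem
  have hmem : η ≤ |(1 / (n k : ℝ)) * ∑ i : Fin (n k), h (data X (n k) ω i) - ∫ x, h x ∂P| := hmem
  change η ≤ dist _ _
  rw [Real.dist_eq, Finset.sum_range]
  refine hmem.trans (le_of_eq ?_)
  rw [one_div, inv_mul_eq_div]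
  congr 3
  exact Finset.sum_congr rfl fun i _ => hω i

lemma tendsto_measure_exists_mean_sub_ge (hXm : ∀ i, Measurable (X i))
    (hXlaw : ∀ i, μ.map (X i) = P) (hXindep : iIndepFun X μ) {n : ℕ → ℕ}
    (hn : Tendsto n atTop atTop) {F : Set (Obs → ℝ)} (hF : F.Finite)
    (hint : ∀ h ∈ F, Integrable h P) {η : ℝ} (hη : 0 < η) :
    Tendsto (fun k => μ {ω | ∃ h ∈ F,
      η ≤ |(1 / (n k : ℝ)) * ∑ i, h (data X (n k) ω i) - ∫ x, h x ∂P|}) atTop (𝓝 0) := by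
  have hsum : Tendsto (fun k => ∑ h ∈ hF.toFinset,
      μ {ω | η ≤ |(1 / (n k : ℝ)) * ∑ i, h (data X (n k) ω i) - ∫ x, h x ∂P|}) atTop
      (𝓝 (∑ _h ∈ hF.toFinset, 0)) :=
    tendsto_finsetSum _ fun h hh => tendsto_measure_mean_sub_ge hXm hXlaw hXindep hn
      (hint h (hF.mem_toFinset.1 hh)) hη
  rw [Finset.sum_const_zero] at hsum
  refine tendsto_of_tendsto_of_tendsto_of_le_of_le tendsto_const_nhds hsum
    (fun _ => zero_le) fun k => ?_
  refine le_trans (measure_mono fun ω hω => ?_) (measure_biUnion_finset_le hF.toFinset _)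
  obtain ⟨h, hh, hω⟩ := hω
  exact Set.mem_iUnion₂.2 ⟨h, hF.mem_toFinset.2 hh, hω⟩

omit [IsProbabilityMeasure μ] in
lemma ae_forall_data (hXm : ∀ i, Measurable (X i)) (hXlaw : ∀ i, μ.map (X i) = P)
    {Q : Obs → Prop} (hQ : ∀ᵐ x ∂P, Q x) : ∀ᵐ ω ∂μ, ∀ i, Q (X i ω) := by
  rw [ae_all_iff]
  intro i
  have h1 : ∀ᵐ y ∂(μ.map (X i)), Q y := by rw [hXlaw]; exact hQ
  exact ae_of_ae_map (hXm i).aemeasurable h1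

end LawOfLargeNumbers

/-! ### Concavity of the full-data likelihood and location of its maximizer -/

/-- The expected Hessian is uniformly negative definite on the compact parameter set. -/
lemma exists_expected_hess_le {f : Param d → ℝ → ℝ} {Θ : Set (Param d)}
    (hΘ : IsCompact Θ) {P : Measure Obs} [IsProbabilityMeasure P] (hH : HessianCondition f Θ P) :
    ∃ c : ℝ, 0 < c ∧ ∀ θ ∈ Θ, ∀ v : Param d,
      ∑ j, ∑ k, v j * v k * ∫ x, hess f x θ j k ∂P ≤ -c * ‖v‖ ^ 2 := by
  obtain ⟨ψ, hψ, hlip⟩ := hH.lipschitz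
  have hψi : Integrable ψ P := hψ.integrable one_le_two
  have hint : ∀ θ ∈ Θ, ∀ j k, Integrable (fun x => hess f x θ j k) P := fun θ hθ j k =>
    (hH.memLp θ hθ j k).integrable one_le_two
  -- The expected entries inherit the Lipschitz condition, with constant E|ψ|.
  have hG : ∀ j k, ContinuousOn (fun θ => ∫ x, hess f x θ j k ∂P) Θ := by
    intro j k
    have hL : LipschitzOnWith (∫ x, |ψ x| ∂P).toNNReal (fun θ => ∫ x, hess f x θ j k ∂P) Θ := by
      refine LipschitzOnWith.of_dist_le_mul fun θ₁ h₁ θ₂ h₂ => ?_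
      rw [Real.coe_toNNReal _ (integral_nonneg fun _ => abs_nonneg _), Real.dist_eq, dist_eq_norm,
        ← integral_sub (hint θ₁ h₁ j k) (hint θ₂ h₂ j k), ← integral_mul_const]
      refine (abs_integral_le_integral_abs).trans (integral_mono_ae ?_ ?_ ?_)
      · exact ((hint θ₁ h₁ j k).sub (hint θ₂ h₂ j k)).abs
      · exact hψi.abs.mul_const _
      · filter_upwards [hlip] with x hx
        refine (hx θ₁ h₁ θ₂ h₂ j k).trans ?_
        gcongr
        exact le_abs_self _
    exact hL.continuousOn
  have hcont : ContinuousOn (fun z : Param d × Param d =>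
      -∑ j, ∑ k, z.2 j * z.2 k * ∫ x, hess f x z.1 j k ∂P) (Θ ×ˢ Metric.sphere 0 1) := by
    refine ContinuousOn.neg (continuousOn_finsetSum _ fun j _ => continuousOn_finsetSum _
      fun k _ => ContinuousOn.mul (by fun_prop) ?_)
    exact (hG j k).comp continuousOn_fst fun z hz => hz.1
  have hpos : ∀ z ∈ Θ ×ˢ Metric.sphere (0 : Param d) 1,
      0 < -∑ j, ∑ k, z.2 j * z.2 k * ∫ x, hess f x z.1 j k ∂P := by
    rintro ⟨θ, v⟩ ⟨hθ, hv⟩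
    have hv0 : v.ofLp ≠ 0 := by
      intro h0
      have : v = 0 := by ext i; simpa using congrFun h0 i
      simp [this] at hv
    have := (hH.posDef θ hθ).dotProduct_mulVec_pos hv0
    refine lt_of_lt_of_eq this ?_
    simp only [dotProduct, Matrix.mulVec, Matrix.neg_apply, Matrix.of_apply, Finset.mul_sum,
      ← Finset.sum_neg_distrib, Pi.star_apply, star_trivial]
    exact Finset.sum_congr rfl fun j _ => Finset.sum_congr rfl fun k _ => by ring
  -- Compactness of Θ × sphere turns pointwise positivity into one constant; homogeneity then covers
  -- all v.
  obtain ⟨c, hc, hcle⟩ := (hΘ.prod (isCompact_sphere 0 1)).exists_forall_le' hcont hpos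
  refine ⟨c, hc, fun θ hθ v => ?_⟩
  rcases eq_or_ne v 0 with rfl | hv
  · simp
  have hv' : ‖v‖ ≠ 0 := norm_ne_zero_iff.2 hv
  have h1 := hcle (θ, ‖v‖⁻¹ • v) ⟨hθ, by
    rw [mem_sphere_zero_iff_norm, norm_smul, norm_inv, norm_norm, inv_mul_cancel₀ hv']⟩
  have h2 : ∑ j, ∑ k, v j * v k * ∫ x, hess f x θ j k ∂P
      = ‖v‖ ^ 2 * ∑ j, ∑ k, (‖v‖⁻¹ • v) j * (‖v‖⁻¹ • v) k * ∫ x, hess f x θ j k ∂P := by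
    simp_rw [Finset.mul_sum]
    refine Finset.sum_congr rfl fun j _ => Finset.sum_congr rfl fun k _ => ?_
    simp only [PiLp.smul_apply, smul_eq_mul]
    field_simp
  rw [h2]
  nlinarith [sq_nonneg ‖v‖]

lemma abs_quad_le {b : Fin d → Fin d → ℝ} {B : ℝ} (hb : ∀ j k, |b j k| ≤ B)
    (v : Param d) : |∑ j, ∑ k, v j * v k * b j k| ≤ d ^ 2 * B * ‖v‖ ^ 2 := by
  refine (Finset.abs_sum_le_sum_abs _ _).trans ?_
  have : ∀ j, |∑ k, v j * v k * b j k| ≤ ∑ _k : Fin d, ‖v‖ * ‖v‖ * B := fun j => by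
    refine (Finset.abs_sum_le_sum_abs _ _).trans (Finset.sum_le_sum fun k _ => ?_)
    rw [abs_mul, abs_mul]
    have h1 : |v j| ≤ ‖v‖ := by simpa using PiLp.norm_apply_le v j
    have h2 : |v k| ≤ ‖v‖ := by simpa using PiLp.norm_apply_le v k
    have := hb j k
    gcongr
  refine (Finset.sum_le_sum fun j _ => this j).trans (le_of_eq ?_)
  simp
  ring

lemma sum_fderiv_fderiv_eq_quad (f : Param d → ℝ → ℝ) {n : ℕ} (x : Fin n → Obs) (θ v : Param d) :
    ∑ i, (1 / (n : ℝ)) * fderiv ℝ (fderiv ℝ (logLik f (x i))) θ v v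
      = ∑ j, ∑ k, v j * v k * ((1 / (n : ℝ)) * ∑ i, hess f (x i) θ j k) := by
  simp_rw [fun i => bilin_eq_sum (fderiv ℝ (fderiv ℝ (logLik f (x i))) θ) v v, Finset.mul_sum]
  rw [Finset.sum_comm]
  refine Finset.sum_congr rfl fun j _ => ?_
  rw [Finset.sum_comm]
  refine Finset.sum_congr rfl fun k _ => Finset.sum_congr rfl fun i _ => ?_
  simp only [hess, Matrix.of_apply]
  ring

/-- A point at which a strongly concave function with bounded second derivative exceeds its value
at `θ₀` is close to `θ₀` if the function cannot increase much along the coordinate directions. -/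
lemma norm_sub_le_of_strongly_concave {Θ : Set (Param d)} (hΘ : Convex ℝ Θ) {L : Param d → ℝ}
    (hL : ∀ θ ∈ Θ, ContDiffAt ℝ 2 L θ) {c C t : ℝ} (hc : 0 < c) (hC : 0 ≤ C) (ht : 0 < t)
    (hconc : ∀ θ ∈ Θ, ∀ v, fderiv ℝ (fderiv ℝ L) θ v v ≤ -c * ‖v‖ ^ 2)
    (hbelow : ∀ θ ∈ Θ, ∀ v, -C * ‖v‖ ^ 2 ≤ fderiv ℝ (fderiv ℝ L) θ v v)
    {θ₀ θ₁ : Param d} (h₀ : θ₀ ∈ Θ) (h₁ : θ₁ ∈ Θ) (hle : L θ₀ ≤ L θ₁)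
    (hdir : ∀ j, ∀ σ : ℝ, (σ = 1 ∨ σ = -1) → θ₀ + (σ * t) • EuclideanSpace.single j 1 ∈ Θ ∧
      L (θ₀ + (σ * t) • EuclideanSpace.single j 1) - L θ₀ ≤ 2 * t ^ 2) :
    ‖θ₁ - θ₀‖ ≤ 2 / c * (d * ((2 + C / 2) * t)) := by
  -- A difference quotient of step t bounds each partial derivative: by the lower curvature bound a
  -- slope above (2 + C/2)t would raise L by more than 2t². So only values of L are needed to
  -- control its gradient.
  have hcoord : ∀ j, ∀ σ : ℝ, (σ = 1 ∨ σ = -1) →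
      σ * fderiv ℝ L θ₀ (EuclideanSpace.single j 1) ≤ (2 + C / 2) * t := by
    intro j σ hσ
    obtain ⟨hmem, hval⟩ := hdir j σ hσ
    have hnegL : ∀ θ ∈ Θ, ContDiffAt ℝ 2 (fun θ => -L θ) θ := fun θ hθ => (hL θ hθ).neg
    have hneg1 : fderiv ℝ (fun θ => -L θ) = fun θ => -fderiv ℝ L θ := by
      ext θ : 1
      exact fderiv_fun_neg
    have h2 := le_add_of_fderiv_fderiv_le hΘ hnegL (κ := C) (fun θ hθ v => by
      rw [hneg1, fderiv_fun_neg]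
      have := hbelow θ hθ v
      simp only [neg_apply]
      linarith) h₀ hmem
    rw [hneg1] at h2
    simp only [add_sub_cancel_left, neg_apply, map_smul, smul_eq_mul, norm_smul] at h2
    have h3 : ‖σ * t‖ * ‖(EuclideanSpace.single j 1 : Param d)‖ = t := by
      rcases hσ with rfl | rfl <;> simp [abs_of_pos ht]
    rw [h3] at h2
    have h4 : t * (σ * fderiv ℝ L θ₀ (EuclideanSpace.single j 1)) ≤ t * ((2 + C / 2) * t) := by
      nlinarith
    exact le_of_mul_le_mul_left h4 ht
  have habs : ∀ j, |fderiv ℝ L θ₀ (EuclideanSpace.single j 1)| ≤ (2 + C / 2) * t := fun j => by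
    rw [abs_le]
    have a1 := hcoord j 1 (Or.inl rfl)
    have a2 := hcoord j (-1) (Or.inr rfl)
    constructor <;> linarith
  set G := gradient L θ₀ with hG
  have hGin : ∀ v, fderiv ℝ L θ₀ v = inner ℝ G v := fun v => by
    rw [hG, gradient, InnerProductSpace.toDual_symm_apply]
  have hGnorm : ‖G‖ ≤ d * ((2 + C / 2) * t) := by
    refine euclidean_norm_le (by positivity) fun j => ?_
    have h1 := habs j
    rw [hGin] at h1
    simpa [PiLp.inner_apply, EuclideanSpace.inner_single_right] using h1
  set u := θ₁ - θ₀ with hu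
  have h5 := le_add_of_fderiv_fderiv_le hΘ hL hconc h₀ h₁
  rw [← hu, hGin] at h5
  have h6 : inner ℝ G u ≤ (d * ((2 + C / 2) * t)) * ‖u‖ :=
    (real_inner_le_norm _ _).trans (by gcongr)
  rcases (norm_nonneg u).eq_or_lt with h0 | h0
  · rw [← h0]; positivity
  · have h7 : (c / 2 * ‖u‖) * ‖u‖ ≤ (d * ((2 + C / 2) * t)) * ‖u‖ := by nlinarith
    have h8 := le_of_mul_le_mul_right h7 h0
    rw [div_mul_eq_mul_div, le_div_iff₀ hc]
    linarith

section CloseMeans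

variable {f : Param d → ℝ → ℝ} {Θ : Set (Param d)} {ψ : Obs → ℝ} {n : ℕ} {x : Fin n → Obs}

lemma abs_mean_hess_sub_le (hlip : ∀ i, ∀ θ₁ ∈ Θ, ∀ θ₂ ∈ Θ, ∀ j k,
      |hess f (x i) θ₁ j k - hess f (x i) θ₂ j k| ≤ ψ (x i) * ‖θ₁ - θ₂‖) {Kψ : ℝ}
    (hmeanψ : (1 / (n : ℝ)) * ∑ i, ψ (x i) ≤ Kψ) {θ₁ θ₂ : Param d} (h₁ : θ₁ ∈ Θ) (h₂ : θ₂ ∈ Θ)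
    (j k : Fin d) :
    |(1 / (n : ℝ)) * ∑ i, hess f (x i) θ₁ j k - (1 / (n : ℝ)) * ∑ i, hess f (x i) θ₂ j k|
      ≤ Kψ * ‖θ₁ - θ₂‖ := by
  have hn : (0 : ℝ) ≤ 1 / n := by positivity
  rw [← mul_sub, ← Finset.sum_sub_distrib, abs_mul, abs_of_nonneg hn]
  refine le_trans ?_ (mul_le_mul_of_nonneg_right hmeanψ (norm_nonneg _))
  rw [mul_assoc, Finset.sum_mul]
  refine mul_le_mul_of_nonneg_left ((Finset.abs_sum_le_sum_abs _ _).trans ?_) hn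
  exact Finset.sum_le_sum fun i _ => hlip i θ₁ h₁ θ₂ h₂ j k

/-- Compare the empirical Hessian at θ with the expected one at the nearest net point: δ for the
Lipschitz step and δ for the law of large numbers, which cost d² · 2δ ≤ c₀/2 in the quadratic form.
-/
lemma mean_fderiv_fderiv_le {P : Measure Obs}
    (hlip : ∀ i, ∀ θ₁ ∈ Θ, ∀ θ₂ ∈ Θ, ∀ j k,
      |hess f (x i) θ₁ j k - hess f (x i) θ₂ j k| ≤ ψ (x i) * ‖θ₁ - θ₂‖) {c₀ Kψ δ : ℝ}
    (hKψ : 0 < Kψ) (hmeanψ : (1 / (n : ℝ)) * ∑ i, ψ (x i) ≤ Kψ)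
    (hquad : ∀ θ ∈ Θ, ∀ v : Param d,
      ∑ j, ∑ k, v j * v k * ∫ y, hess f y θ j k ∂P ≤ -c₀ * ‖v‖ ^ 2)
    {T : Finset (Param d)} (hTΘ : ∀ θ ∈ T, θ ∈ Θ) (hT : ∀ θ ∈ Θ, ∃ a ∈ T, ‖θ - a‖ ≤ δ / Kψ)
    (hclose : ∀ a ∈ T, ∀ j k,
      |(1 / (n : ℝ)) * ∑ i, hess f (x i) a j k - ∫ y, hess f y a j k ∂P| ≤ δ)
    (hδ : (d : ℝ) ^ 2 * (2 * δ) ≤ c₀ / 2) {θ : Param d} (hθ : θ ∈ Θ) (v : Param d) :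
    ∑ i, (1 / (n : ℝ)) * fderiv ℝ (fderiv ℝ (logLik f (x i))) θ v v ≤ -(c₀ / 2) * ‖v‖ ^ 2 := by
  obtain ⟨a, haT, ha⟩ := hT θ hθ
  have haΘ := hTΘ a haT
  rw [sum_fderiv_fderiv_eq_quad]
  have h1 := abs_quad_le (b := fun j k => (1 / (n : ℝ)) * ∑ i, hess f (x i) θ j k
    - ∫ y, hess f y a j k ∂P) (B := 2 * δ) (fun j k => by
      have e1 := abs_mean_hess_sub_le hlip hmeanψ hθ haΘ j k
      have e2 := hclose a haT j k
      have e3 : Kψ * ‖θ - a‖ ≤ δ := by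
        calc Kψ * ‖θ - a‖ ≤ Kψ * (δ / Kψ) := by gcongr
          _ = δ := by field_simp
      refine (abs_sub_le _ ((1 / (n : ℝ)) * ∑ i, hess f (x i) a j k) _).trans ?_
      linarith) v
  simp only [mul_sub, Finset.sum_sub_distrib] at h1
  have h2 := hquad a haΘ v
  have h3 := (abs_le.1 h1).2
  have h5 : (d : ℝ) ^ 2 * (2 * δ) * ‖v‖ ^ 2 ≤ c₀ / 2 * ‖v‖ ^ 2 := by gcongr
  linarith

/-- The Lipschitz condition transports the second moment from the single point θ₀ to all of Θ, so
one weak law per entry suffices. -/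
lemma mean_hess_sq_le (hlip : ∀ i, ∀ θ₁ ∈ Θ, ∀ θ₂ ∈ Θ, ∀ j k,
      |hess f (x i) θ₁ j k - hess f (x i) θ₂ j k| ≤ ψ (x i) * ‖θ₁ - θ₂‖) {θ₀ θ : Param d}
    (hθ₀ : θ₀ ∈ Θ) (hθ : θ ∈ Θ) {D : ℝ} (hD : ‖θ - θ₀‖ ≤ D) (j k : Fin d) :
    (1 / (n : ℝ)) * ∑ i, hess f (x i) θ j k ^ 2
      ≤ 2 * ((1 / (n : ℝ)) * ∑ i, hess f (x i) θ₀ j k ^ 2)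
        + 2 * D ^ 2 * ((1 / (n : ℝ)) * ∑ i, ψ (x i) ^ 2) := by
  have h1 : ∀ i, hess f (x i) θ j k ^ 2
      ≤ 2 * hess f (x i) θ₀ j k ^ 2 + 2 * D ^ 2 * ψ (x i) ^ 2 := by
    intro i
    have e1 := hlip i θ hθ θ₀ hθ₀ j k
    have e3 : (hess f (x i) θ j k - hess f (x i) θ₀ j k) ^ 2 ≤ D ^ 2 * ψ (x i) ^ 2 := by
      rw [← sq_abs]
      calc _ ≤ (ψ (x i) * ‖θ - θ₀‖) ^ 2 := by gcongr
        _ = ‖θ - θ₀‖ ^ 2 * ψ (x i) ^ 2 := by ring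
        _ ≤ _ := by gcongr
    nlinarith [sq_nonneg (hess f (x i) θ j k - 2 * hess f (x i) θ₀ j k)]
  refine (mul_le_mul_of_nonneg_left (Finset.sum_le_sum fun i _ => h1 i)
    (by positivity)).trans (le_of_eq ?_)
  rw [Finset.sum_add_distrib, ← Finset.mul_sum, ← Finset.mul_sum]
  ring

lemma neg_le_mean_fderiv_fderiv (hn : 0 < n) {K : ℝ} {θ : Param d}
    (hK : ∀ j k, (1 / (n : ℝ)) * ∑ i, hess f (x i) θ j k ^ 2 ≤ K) (v : Param d) :
    -(d ^ 2 * (1 + K)) * ‖v‖ ^ 2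
      ≤ ∑ i, (1 / (n : ℝ)) * fderiv ℝ (fderiv ℝ (logLik f (x i))) θ v v := by
  have hn' : (0 : ℝ) < n := by exact_mod_cast hn
  rw [sum_fderiv_fderiv_eq_quad]
  have h1 := abs_quad_le (b := fun j k => (1 / (n : ℝ)) * ∑ i, hess f (x i) θ j k)
    (B := 1 + K) (fun j k => by
      have e1 := hK j k
      rw [abs_mul, abs_of_pos (by positivity)]
      calc (1 / (n : ℝ)) * |∑ i, hess f (x i) θ j k|
          ≤ (1 / (n : ℝ)) * ∑ i, (1 + hess f (x i) θ j k ^ 2) := by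
            gcongr
            refine (Finset.abs_sum_le_sum_abs _ _).trans (Finset.sum_le_sum fun i _ => ?_)
            rw [← sq_abs (hess f (x i) θ j k)]
            nlinarith [sq_nonneg (|hess f (x i) θ j k| - 1), sq_nonneg |hess f (x i) θ j k|]
        _ = 1 + (1 / (n : ℝ)) * ∑ i, hess f (x i) θ j k ^ 2 := by
            rw [Finset.sum_add_distrib, mul_add]
            simp [hn'.ne']
        _ ≤ _ := by linarith) v
  have := (abs_le.1 h1).1
  linarith

lemma isMaxOn_of_isUniqueMLE {θh : Param d} (h : IsUniqueMLE f Θ x θh) :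
    IsMaxOn (fun θ => ∑ i, (1 / (n : ℝ)) * logLik f (x i) θ) Θ θh := by
  intro θ hθ
  change ∑ i, (1 / (n : ℝ)) * logLik f (x i) θ ≤ ∑ i, (1 / (n : ℝ)) * logLik f (x i) θh
  rcases eq_or_ne θ θh with rfl | hne
  · exact le_rfl
  · have := (h.2 θ hθ hne).le
    unfold fullLogLik at this
    rwa [← Finset.mul_sum, ← Finset.mul_sum]

/-- Consistency of θ̂ in quantitative form, linear in t; the curvature constant from below is C =
d²(1 + K). -/
lemma norm_mle_sub_le (hΘ : Convex ℝ Θ) (hn : 0 < n)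
    (hsm : ∀ i, ∀ θ ∈ Θ, ContDiffAt ℝ 2 (logLik f (x i)) θ) {c K t : ℝ} (hc : 0 < c)
    (hK0 : 0 ≤ K) (ht : 0 < t)
    (hconc : ∀ θ ∈ Θ, ∀ v, ∑ i, (1 / (n : ℝ)) * fderiv ℝ (fderiv ℝ (logLik f (x i))) θ v v
      ≤ -c * ‖v‖ ^ 2)
    (hK : ∀ θ ∈ Θ, ∀ j k, (1 / (n : ℝ)) * ∑ i, hess f (x i) θ j k ^ 2 ≤ K) {θ₀ θh : Param d}
    (hθ₀ : θ₀ ∈ Θ) (hmle : IsUniqueMLE f Θ x θh)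
    (hdir : ∀ j, ∀ σ : ℝ, (σ = 1 ∨ σ = -1) → θ₀ + (σ * t) • EuclideanSpace.single j 1 ∈ Θ ∧
      (1 / (n : ℝ)) * ∑ i, logLik f (x i) (θ₀ + (σ * t) • EuclideanSpace.single j 1)
        - (1 / (n : ℝ)) * ∑ i, logLik f (x i) θ₀ ≤ 2 * t ^ 2) :
    ‖θh - θ₀‖ ≤ 2 / c * (d * ((2 + d ^ 2 * (1 + K) / 2) * t)) := by
  have hLdd : ∀ θ ∈ Θ, ∀ v,
      fderiv ℝ (fderiv ℝ fun θ => ∑ i, (1 / (n : ℝ)) * logLik f (x i) θ) θ v v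
      = ∑ i, (1 / (n : ℝ)) * fderiv ℝ (fderiv ℝ (logLik f (x i))) θ v v := fun θ hθ v => by
    rw [fderiv_fderiv_sum_mul fun i => hsm i θ hθ]
    simp [sum_apply, smul_apply]
  refine norm_sub_le_of_strongly_concave hΘ
    (fun θ hθ => contDiffAt_sum_mul (fun i => hsm i θ hθ) _) hc (by positivity) ht
    (fun θ hθ v => by rw [hLdd θ hθ]; exact hconc θ hθ v)
    (fun θ hθ v => by rw [hLdd θ hθ]; exact neg_le_mean_fderiv_fderiv hn (hK θ hθ) v) hθ₀ hmle.1
    (isMaxOn_of_isUniqueMLE hmle hθ₀) (fun j σ hσ => ⟨(hdir j σ hσ).1, ?_⟩)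
  rw [← Finset.mul_sum, ← Finset.mul_sum]
  exact (hdir j σ hσ).2

lemma sum_score_eq_zero (hn : 0 < n)
    (hsm : ∀ i, ∀ θ ∈ Θ, ContDiffAt ℝ 2 (logLik f (x i)) θ) {θh : Param d}
    (hmle : IsUniqueMLE f Θ x θh) (hnhds : Θ ∈ 𝓝 θh) : ∑ i, score f (x i) θh = 0 := by
  have hcrit := ((isMaxOn_of_isUniqueMLE hmle).isLocalMax hnhds).fderiv_eq_zero
  refine ext_inner_right ℝ fun v => ?_
  rw [inner_zero_left, sum_inner]
  have h1 : fderiv ℝ (fun θ => ∑ i, (1 / (n : ℝ)) * logLik f (x i) θ) θh v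
      = (1 / (n : ℝ)) * ∑ i, inner ℝ (score f (x i) θh) v := by
    rw [fderiv_sum_mul fun i => (hsm i θh hmle.1).differentiableAt (by norm_num)]
    simp only [sum_apply, smul_apply, smul_eq_mul, fderiv_apply_eq_inner_score, Finset.mul_sum]
  rw [hcrit] at h1
  have h2 : (1 / (n : ℝ)) * ∑ i, inner ℝ (score f (x i) θh) v = 0 := by rw [← h1]; rfl
  exact (mul_eq_zero.1 h2).resolve_left (by positivity)

end CloseMeans

/-- If finitely many empirical means are close to their expectations, then the full-data
log-likelihood is strongly concave, and its maximizer is interior and solves the likelihood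
equation. -/
lemma exists_close_means {f : Param d → ℝ → ℝ} {Θ : Set (Param d)} {P : Measure Obs}
    [IsProbabilityMeasure P] {θ₀ : Param d} (hsetup : StandingSetup f Θ P θ₀)
    (hmoment : MomentCondition f Θ P) (hhess : HessianCondition f Θ P) {ψ : Obs → ℝ}
    (hψ : MemLp ψ 2 P) :
    ∃ K c ρ η : ℝ, ∃ F : Set (Obs → ℝ), 0 < c ∧ 0 < ρ ∧ 0 < η ∧ F.Finite ∧
      (∀ h ∈ F, Integrable h P) ∧
      ∀ (n : ℕ) (x : Fin n → Obs) (θh : Param d), 0 < n →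
        (∀ i, ∀ θ ∈ Θ, ContDiffAt ℝ 2 (logLik f (x i)) θ) →
        (∀ i, ∀ θ₁ ∈ Θ, ∀ θ₂ ∈ Θ, ∀ j k,
          |hess f (x i) θ₁ j k - hess f (x i) θ₂ j k| ≤ ψ (x i) * ‖θ₁ - θ₂‖) →
        (∀ h ∈ F, |(1 / (n : ℝ)) * ∑ i, h (x i) - ∫ y, h y ∂P| < η) →
        IsUniqueMLE f Θ x θh →
        (∀ θ ∈ Θ, ∀ v, ∑ i, (1 / (n : ℝ)) * fderiv ℝ (fderiv ℝ (logLik f (x i))) θ v v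
          ≤ -c * ‖v‖ ^ 2) ∧
        Metric.ball θh ρ ⊆ Θ ∧ ∑ i, score f (x i) θh = 0 ∧
        (∀ θ ∈ Θ, ∀ j k, (1 / (n : ℝ)) * ∑ i, hess f (x i) θ j k ^ 2 ≤ K) ∧
        (1 / (n : ℝ)) * ∑ i, ψ (x i) ^ 2 ≤ K := by
  have hθ₀ : θ₀ ∈ Θ := interior_subset hsetup.interior
  obtain ⟨c₀, hc₀, hquad⟩ := exists_expected_hess_le hmoment.compact hhess
  -- One ρ is spent on the distance of θ̂ from θ₀, the other is the radius of the ball about θ̂.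
  obtain ⟨ρ, hρ, hball⟩ : ∃ ρ : ℝ, 0 < ρ ∧ Metric.ball θ₀ (2 * ρ) ⊆ Θ := by
    obtain ⟨ρ', hρ', hball'⟩ := Metric.isOpen_iff.1 isOpen_interior θ₀ hsetup.interior
    exact ⟨ρ' / 2, by positivity, by
      rw [mul_div_cancel₀ _ two_ne_zero]; exact hball'.trans interior_subset⟩
  obtain ⟨D, hD⟩ := hmoment.compact.isBounded.subset_closedBall θ₀
  have hDle : ∀ θ ∈ Θ, ‖θ - θ₀‖ ≤ D := fun θ hθ => by
    have := hD hθ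
    rwa [Metric.mem_closedBall, dist_eq_norm] at this
  obtain ⟨K₁, hK₁⟩ : ∃ K₁ : ℝ, K₁ = 2 * ((∑ j, ∑ k, ∫ y, hess f y θ₀ j k ^ 2 ∂P) + 1)
    + 2 * D ^ 2 * ((∫ y, ψ y ^ 2 ∂P) + 1) := ⟨_, rfl⟩
  have hE0 : ∀ j k, 0 ≤ ∫ y, hess f y θ₀ j k ^ 2 ∂P := fun j k =>
    integral_nonneg fun y => sq_nonneg _
  have hψ20 : 0 ≤ ∫ y, ψ y ^ 2 ∂P := integral_nonneg fun y => sq_nonneg _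
  have hK₁0 : 0 ≤ K₁ := by
    have : 0 ≤ ∑ j, ∑ k, ∫ y, hess f y θ₀ j k ^ 2 ∂P :=
      Finset.sum_nonneg fun j _ => Finset.sum_nonneg fun k _ => hE0 j k
    rw [hK₁]
    positivity
  have hcpos : 0 < c₀ / 2 := by positivity
  -- The bound on ‖θ̂ - θ₀‖ will be (B - 1)t; the added 1 makes it strictly smaller than Bt ≤ ρ.
  obtain ⟨B, hB⟩ : ∃ B : ℝ, B = 2 / (c₀ / 2) * (d * (2 + d ^ 2 * (1 + K₁) / 2)) + 1 := ⟨_, rfl⟩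
  have hB0 : 0 < B := by rw [hB]; positivity
  obtain ⟨t, ht, htρ, htB⟩ : ∃ t : ℝ, 0 < t ∧ t ≤ ρ ∧ t ≤ ρ / B :=
    ⟨min ρ (ρ / B), lt_min hρ (by positivity), min_le_left _ _, min_le_right _ _⟩
  obtain ⟨Kψ, hKψ⟩ : ∃ Kψ : ℝ, Kψ = |∫ y, ψ y ∂P| + 1 := ⟨_, rfl⟩
  have hKψ0 : 0 < Kψ := by rw [hKψ]; positivity
  obtain ⟨δ, hδ0, hδ⟩ : ∃ δ : ℝ, 0 < δ ∧ (d : ℝ) ^ 2 * (2 * δ) ≤ c₀ / 2 := by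
    refine ⟨c₀ / (4 * (d ^ 2 + 1)), by positivity, ?_⟩
    have : (d : ℝ) ^ 2 * (2 * (c₀ / (4 * (d ^ 2 + 1)))) = c₀ / 2 * (d ^ 2 / (d ^ 2 + 1)) := by
      field_simp; norm_num
    rw [this]
    refine mul_le_of_le_one_right (by positivity) ?_
    rw [div_le_one (by positivity)]
    linarith
  obtain ⟨T, hTΘ, hT⟩ := exists_finset_net hmoment.compact (ε := δ / Kψ) (by positivity)
  -- η ≤ t² is what yields the increment bound 2t²: the expected log-likelihood does not increase
  -- away from θ₀, and each of the two empirical means is off by less than η.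
  obtain ⟨η, hη0, hηδ, hη1, hηt⟩ : ∃ η : ℝ, 0 < η ∧ η ≤ δ ∧ η ≤ 1 ∧ η ≤ t ^ 2 :=
    ⟨min (min δ 1) (t ^ 2), lt_min (lt_min hδ0 one_pos) (by positivity),
      (min_le_left _ _).trans (min_le_left _ _), (min_le_left _ _).trans (min_le_right _ _),
      min_le_right _ _⟩
  have hmemΘ : ∀ j, ∀ σ : ℝ, (σ = 1 ∨ σ = -1) →
      θ₀ + (σ * t) • (EuclideanSpace.single j 1 : Param d) ∈ Θ := by
    intro j σ hσ
    refine hball ?_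
    rw [Metric.mem_ball, dist_eq_norm, add_sub_cancel_left, norm_smul]
    have h3 : ‖σ * t‖ * ‖(EuclideanSpace.single j 1 : Param d)‖ = t := by
      rcases hσ with rfl | rfl <;> simp [abs_of_pos ht]
    rw [h3]
    linarith
  refine ⟨max K₁ ((∫ y, ψ y ^ 2 ∂P) + 1), c₀ / 2, ρ, η,
    Set.range (fun z : T × Fin d × Fin d => fun y => hess f y z.1 z.2.1 z.2.2)
    ∪ Set.range (fun z : Fin d × Fin d => fun y => hess f y θ₀ z.1 z.2 ^ 2)
    ∪ Set.range (fun j : Fin d => fun y =>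
        logLik f y (θ₀ + ((1 : ℝ) * t) • EuclideanSpace.single j 1))
    ∪ Set.range (fun j : Fin d => fun y =>
        logLik f y (θ₀ + ((-1 : ℝ) * t) • EuclideanSpace.single j 1))
    ∪ {ψ, fun y => ψ y ^ 2, fun y => logLik f y θ₀}, hcpos, hρ, hη0, ?_, ?_, ?_⟩
  · exact ((((Set.finite_range _).union (Set.finite_range _)).union (Set.finite_range _)).union
      (Set.finite_range _)).union (Set.toFinite _)
  · intro h hh
    rcases hh with ((((⟨z, rfl⟩ | ⟨z, rfl⟩) | ⟨j, rfl⟩) | ⟨j, rfl⟩) | hh)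
    · exact (hhess.memLp _ (hTΘ _ z.1.2) _ _).integrable one_le_two
    · exact (hhess.memLp _ hθ₀ _ _).integrable_sq
    · exact hmoment.integrable _ (hmemΘ j 1 (Or.inl rfl))
    · exact hmoment.integrable _ (hmemΘ j (-1) (Or.inr rfl))
    · rcases hh with rfl | rfl | rfl
      · exact hψ.integrable one_le_two
      · exact hψ.integrable_sq
      · exact hmoment.integrable _ hθ₀
  intro n x θh hn hsm hlip hclose hmle
  have cl_hess : ∀ a ∈ T, ∀ j k,
      |(1 / (n : ℝ)) * ∑ i, hess f (x i) a j k - ∫ y, hess f y a j k ∂P| < η := fun a ha j k =>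
    hclose _ (Or.inl (Or.inl (Or.inl (Or.inl ⟨(⟨a, ha⟩, j, k), rfl⟩))))
  have cl_sq : ∀ j k, |(1 / (n : ℝ)) * ∑ i, hess f (x i) θ₀ j k ^ 2
      - ∫ y, hess f y θ₀ j k ^ 2 ∂P| < η := fun j k =>
    hclose _ (Or.inl (Or.inl (Or.inl (Or.inr ⟨(j, k), rfl⟩))))
  have cl_dir : ∀ j, ∀ σ : ℝ, (σ = 1 ∨ σ = -1) →
      |(1 / (n : ℝ)) * ∑ i, logLik f (x i) (θ₀ + (σ * t) • EuclideanSpace.single j 1)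
        - ∫ y, logLik f y (θ₀ + (σ * t) • EuclideanSpace.single j 1) ∂P| < η := by
    rintro j σ (rfl | rfl)
    · exact hclose _ (Or.inl (Or.inl (Or.inr ⟨j, rfl⟩)))
    · exact hclose _ (Or.inl (Or.inr ⟨j, rfl⟩))
  have cl_ψ : |(1 / (n : ℝ)) * ∑ i, ψ (x i) - ∫ y, ψ y ∂P| < η :=
    hclose _ (Or.inr (Or.inl rfl))
  have cl_ψ2 : |(1 / (n : ℝ)) * ∑ i, ψ (x i) ^ 2 - ∫ y, ψ y ^ 2 ∂P| < η :=
    hclose _ (Or.inr (Or.inr (Or.inl rfl)))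
  have cl_0 : |(1 / (n : ℝ)) * ∑ i, logLik f (x i) θ₀ - ∫ y, logLik f y θ₀ ∂P| < η :=
    hclose _ (Or.inr (Or.inr (Or.inr rfl)))
  have hmeanψ : (1 / (n : ℝ)) * ∑ i, ψ (x i) ≤ Kψ := by
    have h1 := (abs_lt.1 cl_ψ).2
    have h2 := le_abs_self (∫ y, ψ y ∂P)
    linarith
  have hmeanψ2 : (1 / (n : ℝ)) * ∑ i, ψ (x i) ^ 2 ≤ (∫ y, ψ y ^ 2 ∂P) + 1 := by
    have h1 := (abs_lt.1 cl_ψ2).2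
    linarith
  have hconc : ∀ θ ∈ Θ, ∀ v, ∑ i, (1 / (n : ℝ)) * fderiv ℝ (fderiv ℝ (logLik f (x i))) θ v v
      ≤ -(c₀ / 2) * ‖v‖ ^ 2 := fun θ hθ v =>
    mean_fderiv_fderiv_le hlip hKψ0 hmeanψ hquad hTΘ hT
      (fun a ha j k => (cl_hess a ha j k).le.trans hηδ) hδ hθ v
  have hsq : ∀ θ ∈ Θ, ∀ j k, (1 / (n : ℝ)) * ∑ i, hess f (x i) θ j k ^ 2 ≤ K₁ := by
    intro θ hθ j k
    have h2 := mean_hess_sq_le hlip hθ₀ hθ (hDle θ hθ) j k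
    have h3 := (abs_lt.1 (cl_sq j k)).2
    have h4 : ∫ y, hess f y θ₀ j k ^ 2 ∂P ≤ ∑ j, ∑ k, ∫ y, hess f y θ₀ j k ^ 2 ∂P :=
      (Finset.single_le_sum (f := fun k => ∫ y, hess f y θ₀ j k ^ 2 ∂P) (fun k _ => hE0 j k)
        (Finset.mem_univ k)).trans
      (Finset.single_le_sum (f := fun j => ∑ k, ∫ y, hess f y θ₀ j k ^ 2 ∂P)
        (fun j _ => Finset.sum_nonneg fun k _ => hE0 j k) (Finset.mem_univ j))
    have h5 : 2 * D ^ 2 * ((1 / (n : ℝ)) * ∑ i, ψ (x i) ^ 2)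
        ≤ 2 * D ^ 2 * ((∫ y, ψ y ^ 2 ∂P) + 1) := by gcongr
    linarith
  have hdist := norm_mle_sub_le hsetup.convex hn hsm hcpos hK₁0 ht hconc hsq hθ₀ hmle
    (fun j σ hσ => ⟨hmemΘ j σ hσ, by
      have a1 := (abs_lt.1 (cl_dir j σ hσ)).2
      have a2 := (abs_lt.1 cl_0).1
      have a3 := hsetup.maximizes _ (hmemΘ j σ hσ)
      linarith⟩)
  have hdistρ : ‖θh - θ₀‖ < ρ := by
    have h1 : 2 / (c₀ / 2) * (d * ((2 + d ^ 2 * (1 + K₁) / 2) * t)) = (B - 1) * t := by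
      rw [hB]; ring
    have h2 : B * t ≤ ρ := by
      calc B * t ≤ B * (ρ / B) := by gcongr
        _ = ρ := by field_simp
    rw [h1] at hdist
    linarith
  have hballh : Metric.ball θh ρ ⊆ Θ := by
    refine (Metric.ball_subset_ball' ?_).trans hball
    rw [dist_eq_norm]
    linarith
  exact ⟨hconc, hballh, sum_score_eq_zero hn hsm hmle
    (Filter.mem_of_superset (Metric.ball_mem_nhds _ hρ) hballh),
    fun θ hθ j k => (hsq θ hθ j k).trans (le_max_left _ _), hmeanψ2.trans (le_max_right _ _)⟩

/-! ### Regularity of the data with high probability -/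

lemma posSemidef_sub_smul_anti {d : ℕ} {Λ : Matrix (Fin d) (Fin d) ℝ} {c c' : ℝ} (hcc : c' ≤ c)
    (h : (Λ - c • (1 : Matrix (Fin d) (Fin d) ℝ)).PosSemidef) :
    (Λ - c' • (1 : Matrix (Fin d) (Fin d) ℝ)).PosSemidef := by
  have h1 := h.add ((Matrix.PosSemidef.one (n := Fin d) (R := ℝ)).smul (sub_nonneg.2 hcc))
  convert h1 using 1
  module

lemma eventually_measure_le_of_tendsto_zero {Ω : Type*} [MeasurableSpace Ω] {μ : Measure Ω}
    {s : ℕ → Set Ω} (h : Tendsto (fun k => μ (s k)) atTop (𝓝 0)) {ε : ℝ} (hε : 0 < ε) :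
    ∀ᶠ k in atTop, μ (s k) ≤ ENNReal.ofReal ε :=
  (h.eventually_lt_const (ENNReal.ofReal_pos.2 hε)).mono fun _ hk => hk.le

/-- With probability arbitrarily close to one, the data set is eventually regular. -/
lemma exists_eventually_isRegular {d : ℕ}
    (f : Param d → ℝ → ℝ) (Θ : Set (Param d)) (P : Measure Obs) [IsProbabilityMeasure P]
    (θ₀ : Param d) (hsetup : StandingSetup f Θ P θ₀)
    {Ω : Type*} [MeasurableSpace Ω] (μ : Measure Ω) [IsProbabilityMeasure μ]
    (X : ℕ → Ω → Obs) (hXm : ∀ i, Measurable (X i)) (hXlaw : ∀ i, μ.map (X i) = P)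
    (hXindep : iIndepFun X μ)
    (n r : ℕ → ℕ) (hn : Tendsto n atTop atTop)
    (θhat : (k : ℕ) → (Fin (n k) → Obs) → Param d) (hθhat_meas : ∀ k, Measurable (θhat k))
    (hθhat_mem : ∀ k x, θhat k x ∈ Θ)
    (hθhat : Tendsto (fun k => μ {ω | ¬ IsUniqueMLE f Θ (data X (n k) ω)
      (θhat k (data X (n k) ω))}) atTop (𝓝 0))
    (p : (k : ℕ) → (Fin (n k) → Obs) → Fin (n k) → ℝ)
    (hp : ∀ k x, IsSubsamplingProb x (p k x))
    (θsub : (k : ℕ) → (x : Fin (n k) → Obs) →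
      (Fin (r k - numUncensored x) → Fin (n k)) → Param d)
    (hθsub : ∀ k, ∀ᵐ ω ∂μ,
      let x := data X (n k) ω
      ∀ J : Fin (r k - numUncensored x) → Fin (n k), (∀ j, (x (J j)).Censored) →
        θsub k x J ∈ Θ ∧ IsMaxOn (subLogLik f x (p k x) J) Θ (θsub k x J))
    (hmoment : MomentCondition f Θ P) (hhess : HessianCondition f Θ P)
    {ψ : Obs → ℝ} (hψ : MemLp ψ 2 P)
    (hlip : ∀ᵐ x ∂P, ∀ θ₁ ∈ Θ, ∀ θ₂ ∈ Θ, ∀ j k,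
      |hess f x θ₁ j k - hess f x θ₂ j k| ≤ ψ x * ‖θ₁ - θ₂‖)
    (hfourth : FourthMomentNear μ X f Θ n θhat)
    (hmax : BddInProb μ fun k ω =>
      maxInvProb (data X (n k) ω) (p k (data X (n k) ω)))
    (hnondeg : PosDefInProb μ fun k ω =>
      Lc f (data X (n k) ω) (p k (data X (n k) ω)) (θhat k (data X (n k) ω)))
    {ε : ℝ} (hε : 0 < ε) :
    ∃ K c ρ : ℝ, 0 < c ∧ 0 < ρ ∧ ∀ᶠ k in atTop,
      μ {ω | ¬ IsRegular f Θ ψ K c ρ (data X (n k) ω) (p k (data X (n k) ω))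
        (θhat k (data X (n k) ω)) (θsub k (data X (n k) ω))} ≤ ENNReal.ofReal ε := by
  obtain ⟨K₁, c₁, ρ, η, F, hc₁, hρ, hη, hF, hFint, hreg⟩ :=
    exists_close_means hsetup hmoment hhess hψ
  have hε5 : 0 < ε / 5 := by positivity
  obtain ⟨δ, hδ, hfour⟩ := hfourth
  -- The fourth moment condition is needed only for the statistic θ̂ itself, at distance 0 < δ.
  obtain ⟨K₂, hK₂⟩ := hfour θhat hθhat_meas (fun k x => ⟨hθhat_mem k x, by simpa using hδ⟩) _ hε5
  obtain ⟨K₃, hK₃⟩ := hmax _ hε5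
  obtain ⟨c₂, hc₂, hΛ⟩ := hnondeg _ hε5
  have hLLN := eventually_measure_le_of_tendsto_zero
    (tendsto_measure_exists_mean_sub_ge hXm hXlaw hXindep hn hF hFint hη) hε5
  have hMLE := eventually_measure_le_of_tendsto_zero hθhat hε5
  refine ⟨max K₁ (max K₂ K₃), min c₁ c₂, ρ, lt_min hc₁ hc₂, hρ, ?_⟩
  have hsm := ae_forall_data hXm hXlaw hsetup.smooth
  have hli := ae_forall_data hXm hXlaw hlip
  filter_upwards [hK₂, hK₃, hΛ, hLLN, hMLE, hn.eventually_gt_atTop 0] with k e₁ e₂ e₃ e₄ e₅ hnk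
  set S₁ := {ω | K₂ < |(1 / (n k : ℝ)) * ∑ i : Fin (n k),
    ‖score f (data X (n k) ω i) (θhat k (data X (n k) ω))‖ ^ 4|}
  set S₂ := {ω | K₃ < |maxInvProb (data X (n k) ω) (p k (data X (n k) ω))|}
  set S₃ := {ω | ¬ (Lc f (data X (n k) ω) (p k (data X (n k) ω)) (θhat k (data X (n k) ω))
    - c₂ • (1 : Matrix (Fin d) (Fin d) ℝ)).PosSemidef}
  set S₄ := {ω | ∃ h ∈ F, η ≤ |(1 / (n k : ℝ)) * ∑ i, h (data X (n k) ω i) - ∫ x, h x ∂P|}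
  set S₅ := {ω | ¬ IsUniqueMLE f Θ (data X (n k) ω) (θhat k (data X (n k) ω))}
  have hsub : μ {ω | ¬ IsRegular f Θ ψ (max K₁ (max K₂ K₃)) (min c₁ c₂) ρ (data X (n k) ω)
      (p k (data X (n k) ω)) (θhat k (data X (n k) ω)) (θsub k (data X (n k) ω))}
      ≤ μ (S₁ ∪ S₂ ∪ S₃ ∪ S₄ ∪ S₅) := by
    -- Smoothness, the Lipschitz bound and the maximizing property of the subsample estimator hold
    -- only almost surely; all other failures lie in five events of probability at most ε/5.
    refine measure_mono_ae ?_
    filter_upwards [hsm, hli, hθsub k] with ω h₁ h₂ h₃ hbad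
    by_contra hcon
    have hcon : ω ∉ S₁ ∪ S₂ ∪ S₃ ∪ S₄ ∪ S₅ := hcon
    simp only [Set.mem_union, not_or] at hcon
    obtain ⟨⟨⟨⟨a₁, a₂⟩, a₃⟩, a₄⟩, a₅⟩ := hcon
    have a₁' := a₁
    rw [Set.mem_ofPred_eq, not_lt] at a₁'
    have a₂' := a₂
    rw [Set.mem_ofPred_eq, not_lt] at a₂'
    have a₃' := a₃
    rw [Set.mem_ofPred_eq, not_not] at a₃'
    have a₅' := a₅
    rw [Set.mem_ofPred_eq, not_not] at a₅'
    obtain ⟨b₁, b₂, b₃, b₄, b₅⟩ := hreg (n k) (data X (n k) ω) (θhat k (data X (n k) ω)) hnk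
      (fun i => h₁ i) (fun i => h₂ i)
      (fun h hh => not_le.1 fun hle => a₄ ⟨h, hh, hle⟩) a₅'
    refine hbad
      { convex := hsetup.convex
        prob := hp k _
        smooth := fun i => h₁ i
        lipschitz := fun i => h₂ i
        concave := fun θ hθ v => (b₁ θ hθ v).trans ?_
        ball := b₂
        crit := b₃
        hess_sq := fun θ hθ j l => (b₄ θ hθ j l).trans (le_max_left _ _)
        lip_sq := b₅.trans (le_max_left _ _)
        score_four := (le_abs_self _).trans
          (a₁'.trans ((le_max_left _ _).trans (le_max_right _ _)))
        inv_prob := (le_abs_self _).trans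
          (a₂'.trans ((le_max_right _ _).trans (le_max_right _ _)))
        nondeg := posSemidef_sub_smul_anti (min_le_right _ _) a₃'
        isMax := h₃ }
    have : min c₁ c₂ ≤ c₁ := min_le_left _ _
    nlinarith [sq_nonneg ‖v‖]
  refine hsub.trans ?_
  have hu : μ (S₁ ∪ S₂ ∪ S₃ ∪ S₄ ∪ S₅) ≤ μ S₁ + μ S₂ + μ S₃ + μ S₄ + μ S₅ := by
    refine (measure_union_le _ _).trans ?_
    gcongr
    refine (measure_union_le _ _).trans ?_
    gcongr
    refine (measure_union_le _ _).trans ?_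
    gcongr
    exact measure_union_le _ _
  refine (hu.trans (add_le_add (add_le_add (add_le_add (add_le_add e₁ e₂) e₃) e₄) e₅)).trans
    (le_of_eq ?_)
  rw [← ENNReal.ofReal_add, ← ENNReal.ofReal_add, ← ENNReal.ofReal_add, ← ENNReal.ofReal_add]
  · congr 1; ring
  all_goals positivity

end CensSub

/-- Conditional asymptotic normality of the censoring-subsampling estimator. Along a sequence of
pairs `(n k, r k)` with `n k, r k → ∞`, the data set number `k` consists of the first `n k` of the
independent observations `X 0, X 1, …` with common law `P`; all its uncensored observations are
kept and `r k - n₀` censored ones are drawn with replacement with probabilities `p k`. The integral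
over `drawLaw` is the conditional expectation given the data. -/
theorem theorem2 {d : ℕ} (hd : 0 < d)
    -- the model, the law of one observation and the true value
    (f : Param d → ℝ → ℝ) (Θ : Set (Param d)) (P : Measure Obs) [IsProbabilityMeasure P]
    (θ₀ : Param d) (hsetup : StandingSetup f Θ P θ₀)
    -- the independent and identically distributed data
    {Ω : Type*} [MeasurableSpace Ω] (μ : Measure Ω) [IsProbabilityMeasure μ]
    (X : ℕ → Ω → Obs) (hXm : ∀ i, Measurable (X i)) (hXlaw : ∀ i, μ.map (X i) = P)
    (hXindep : iIndepFun X μ)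
    -- the sizes of the data sets and of the subsamples
    (n r : ℕ → ℕ) (hn : Tendsto n atTop atTop) (hr : Tendsto r atTop atTop)
    (hn₀ : TendstoInMeasure μ
      (fun k ω => (numUncensored (data X (n k) ω) : ℝ) / (r k : ℝ)) atTop (fun _ => 0))
    -- the full-data maximum likelihood estimator, unique with probability tending to one
    (θhat : (k : ℕ) → (Fin (n k) → Obs) → Param d) (hθhat_meas : ∀ k, Measurable (θhat k))
    (hθhat_mem : ∀ k x, θhat k x ∈ Θ)
    (hθhat : Tendsto (fun k => μ {ω | ¬ IsUniqueMLE f Θ (data X (n k) ω)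
      (θhat k (data X (n k) ω))}) atTop (𝓝 0))
    -- the subsampling probabilities, which may depend on the data
    (p : (k : ℕ) → (Fin (n k) → Obs) → Fin (n k) → ℝ)
    (hp : ∀ k x, IsSubsamplingProb x (p k x))
    -- the subsample estimator: a maximizer of the weighted log-likelihood of the subsample
    (θsub : (k : ℕ) → (x : Fin (n k) → Obs) →
      (Fin (r k - numUncensored x) → Fin (n k)) → Param d)
    (hθsub : ∀ k, ∀ᵐ ω ∂μ,
      let x := data X (n k) ω
      ∀ J : Fin (r k - numUncensored x) → Fin (n k), (∀ j, (x (J j)).Censored) →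
        θsub k x J ∈ Θ ∧ IsMaxOn (subLogLik f x (p k x) J) Θ (θsub k x J))
    -- the assumptions on the model
    (hmoment : MomentCondition f Θ P) (hhess : HessianCondition f Θ P)
    (hscore : ScoreCondition f Θ P) (hfourth : FourthMomentNear μ X f Θ n θhat)
    -- the assumption on the subsampling probabilities
    (hmax : BddInProb μ fun k ω =>
      maxInvProb (data X (n k) ω) (p k (data X (n k) ω)))
    -- the normalizing covariance matrix is asymptotically nonsingular
    (hnondeg : PosDefInProb μ fun k ω =>
      Lc f (data X (n k) ω) (p k (data X (n k) ω)) (θhat k (data X (n k) ω))) :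
    -- conditional convergence in distribution to `N(0, I)`, in probability
    ∀ g : BoundedContinuousFunction (Param d) ℝ,
      TendstoInMeasure μ
        (fun k ω =>
          let x := data X (n k) ω
          ∫ J, g (normalizedError f x (p k x) (r k) (θhat k x) (θsub k x J))
            ∂(drawLaw x (p k x) (r k - numUncensored x)))
        atTop (fun _ => ∫ z, g z ∂(stdGaussian (Param d))) := by
  intro g
  obtain ⟨ψ, hψ, hlip⟩ := hhess.lipschitz
  rw [tendstoInMeasure_iff_dist]
  intro ε hε
  rw [ENNReal.tendsto_nhds_zero]
  intro ε' hε'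
  -- One δ for data that are not regular, one for n₀/r ≥ η. The value ⊤ is treated apart, as its
  -- `toReal` is 0.
  obtain ⟨δ, hδ, hδε⟩ : ∃ δ : ℝ, 0 < δ ∧ ENNReal.ofReal (δ + δ) ≤ ε' := by
    rcases eq_or_ne ε' ⊤ with rfl | htop
    · exact ⟨1, one_pos, le_top⟩
    · refine ⟨ε'.toReal / 2, half_pos (ENNReal.toReal_pos hε'.ne' htop), ?_⟩
      rw [add_halves, ENNReal.ofReal_toReal htop]
  obtain ⟨K, c, ρ, hc, hρ, hreg⟩ := exists_eventually_isRegular f Θ P θ₀ hsetup μ X hXm hXlaw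
    hXindep n r hn θhat hθhat_meas hθhat_mem hθhat p hp θsub hθsub hmoment hhess hψ hlip hfourth
    hmax hnondeg hδ
  obtain ⟨η, hη, hunif⟩ := exists_forall_isRegular hd hmoment.compact (f := f) (ψ := ψ) (K := K)
    hc hρ g hε
  have hn₀' := eventually_measure_le_of_tendsto_zero ((tendstoInMeasure_iff_dist.1 hn₀) η hη) hδ
  have hrη := (tendsto_natCast_atTop_atTop (R := ℝ).comp hr).eventually_ge_atTop (1 / η)
  filter_upwards [hreg, hn₀', hrη] with k h₁ h₂ h₃
  refine le_trans ?_ hδε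
  rw [ENNReal.ofReal_add hδ.le hδ.le]
  refine le_trans (le_trans (measure_mono fun ω hω => ?_) (measure_union_le _ _))
    (add_le_add h₁ h₂)
  by_contra hcon
  simp only [Set.mem_union, not_or] at hcon
  obtain ⟨a₁, a₂⟩ := hcon
  rw [Set.mem_ofPred_eq, not_not] at a₁
  rw [Set.mem_ofPred_eq, not_le, Real.dist_eq, sub_zero, abs_of_nonneg (by positivity)] at a₂
  have := hunif (n k) (data X (n k) ω) _ _ (r k) _ a₁ a₂ h₃
  exact absurd hω (not_le.2 this)
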